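/- **Positivity of the classical density.** Let $Q$ be an $n$-dimensional smooth manifold (Hausdorff, second countable), let $z=(q^i,p_i)$ denote the canonical coordinates on $T^*Q$, let $\{F,G\}=\sum_i(\partial_{q^i}F\,\partial_{p_i}G-\partial_{p_i}F\,\partial_{q^i}G)$, let $\mathcal A=p_i\,\mathrm dq^i$, and let $X_h=(\partial_{p}h,-\partial_{q}h)$, so that $\mathcal A\cdot X_h=\sum_i p_i\partial_{p_i}h$. Let $\hbar>0$, let $\mathscr H_Q$ be a complex Hilbert space, and let $\hat\alpha_1,\dots,\hat\alpha_N$ be (possibly unbounded) self-adjoint operators on $\mathscr H_Q$ that commute mutually (their resolvents commute). Let $H:T^*Q\times\mathbb R^N\to\mathbb R$ be smooth (for instance smooth, and analytic in the second variable) and let $$\widehat H(z)=H(z,\hat\alpha_1,\dots,\hat\alpha_N)$$ be defined by the joint functional calculus. Assume that for every $a$ in the joint spectrum of $(\hat\alpha_i)$ the Hamiltonian vector field of $H(\cdot,a)$ on $T^*Q$ is complete. Let $J\subseteq\mathbb R$ be an interval that contains the initial time $0$, and let $\Upsilon:J\times T^*Q\to\mathscr H_Q$ be a continuously differentiable solution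 of the quantum–classical wave equation $$i\hbar\,\partial_t\Upsilon=i\hbar\{\widehat H,\Upsilon\}+\big(\widehat H-\mathcal A\cdot X_{\widehat H}\big)\Upsilon ,$$ where the derivatives of $\widehat H$ are $(\partial_{q^i}H)(z,\hat\alpha)$ and $(\partial_{p_i}H)(z,\hat\alpha)$ and the equation is understood in the joint spectral representation of $(\hat\alpha_i)$ (that is, after applying $g(\hat\alpha)$, for all continuous functions $g$ on $\mathbb R^N$ that vanish at infinity and whose products with the functions of $a$ that occur do so too, for instance all $g$ of compact support). For each $t$ and $z$ define the hybrid density operator and the classical Liouville density $$\widehat{\mathcal D}(t,z)=\Upsilon\Upsilon^\dagger+\sum_i\partial_{p_i}\big(p_i\,\Upsilon\Upsilon^\dagger\big)+i\hbar\{\Upsilon,\Upsilon^\dagger\},\qquad \rho_c(t,z)=\operatorname{Tr}\widehat{\mathcal D}(t,z),$$ where $\Upsilon^\dagger\psi=\langle\Upsilon|\psi\rangle$. If $\widehat{\mathcal D}(0,z)$ is a positive operator for every $z\in T^*Q$, that is, $\langle\psi|\widehat{\mathcal D}(0,z)\psi\rangle\ge 0$ for all $\psi\in\mathscr H_Q$,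 then for all $t\in J$ and $z\in T^*Q$ the trace $\rho_c(t,z)$ converges (in every Hilbert basis), is real, and $\rho_c(t,z)\ge 0$. In particular $\rho_c$ is nonnegative at the initial time and stays nonnegative. -/

import Mathlib

open scoped Manifold ContDiff ZeroAtInfty

noncomputable section

namespace HybridQC

/-! ### Classical phase space -/

/-- The model space `ℝⁿ` of the configuration manifold. -/
abbrev Model (n : ℕ) : Type := EuclideanSpace ℝ (Fin n)

/-- The cotangent bundle `T*Q` of an `n`-dimensional manifold `Q`; a point `z` has base point
`z.proj` and covector `z.snd`. -/
abbrev PhaseSpace (n : ℕ) (Q : Type*) [TopologicalSpace Q] [ChartedSpace (Model n) Q]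
    [IsManifold 𝓘(ℝ, Model n) ∞ Q] : Type _ :=
  Bundle.TotalSpace (Model n →L[ℝ] ℝ)
    (fun q : Q => TangentSpace 𝓘(ℝ, Model n) q →L[ℝ] Bundle.Trivial Q ℝ q)

/-- The model with corners of `T*Q`. -/
abbrev phaseModel (n : ℕ) := 𝓘(ℝ, Model n).prod 𝓘(ℝ, Model n →L[ℝ] ℝ)

section Phase

variable {n : ℕ} {Q : Type*} [TopologicalSpace Q] [ChartedSpace (Model n) Q]
  [IsManifold 𝓘(ℝ, Model n) ∞ Q]
variable {V : Type*} [NormedAddCommGroup V] [NormedSpace ℝ V]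

/-- The differential of a vector-valued phase-space function at `z`, in the canonical coordinates
`(qⁱ, pᵢ)` of `T*Q` induced by the preferred chart of `Q` at the base point of `z`. (Mathlib
identifies the tangent space of `T*Q` at `z` with `ℝⁿ × (ℝⁿ)*` through exactly these
coordinates.) -/
def coordDeriv (F : PhaseSpace n Q → V) (z : PhaseSpace n Q) :
    (Model n × (Model n →L[ℝ] ℝ)) →L[ℝ] V :=
  mfderiv (phaseModel n) 𝓘(ℝ, V) F z

/-- `∂F/∂qⁱ` at `z`, in canonical coordinates around `z`. -/
def dq (i : Fin n) (F : PhaseSpace n Q → V) (z : PhaseSpace n Q) : V :=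
  coordDeriv F z (EuclideanSpace.single i 1, 0)

/-- `∂F/∂pᵢ` at `z`, in canonical coordinates around `z`. -/
def dp (i : Fin n) (F : PhaseSpace n Q → V) (z : PhaseSpace n Q) : V :=
  coordDeriv F z (0, EuclideanSpace.proj i)

/-- The momentum coordinate `pᵢ` of `z`, in canonical coordinates around `z`. -/
def momentum (z : PhaseSpace n Q) (i : Fin n) : ℝ :=
  (show Model n →L[ℝ] ℝ from z.snd) (EuclideanSpace.single i 1)

/-- The Hamiltonian vector field `X_h = (∂h/∂pᵢ, -∂h/∂qⁱ)`. -/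
def hamiltonianVectorField (h : PhaseSpace n Q → ℝ) (z : PhaseSpace n Q) :
    TangentSpace (phaseModel n) z :=
  show Model n × (Model n →L[ℝ] ℝ) from
    (∑ i, dp i h z • EuclideanSpace.single i (1 : ℝ),
      -∑ i, dq i h z • (EuclideanSpace.proj i : Model n →L[ℝ] ℝ))

/-- The Hamiltonian flow of `h` is complete: through every phase-space point passes an integral
curve of `X_h` that is defined for all times. -/
def HasCompleteFlow (h : PhaseSpace n Q → ℝ) : Prop :=
  ∀ z : PhaseSpace n Q, ∃ γ : ℝ → PhaseSpace n Q,
    γ 0 = z ∧ IsMIntegralCurve (I := phaseModel n) γ (hamiltonianVectorField h)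

/-- The Lagrangian `𝒜 · X_h - h = ∑ᵢ pᵢ ∂h/∂pᵢ - h` associated to `h`. -/
def lagrangian (h : PhaseSpace n Q → ℝ) (z : PhaseSpace n Q) : ℝ :=
  ∑ i, momentum z i * dp i h z - h z

end Phase

/-! ### Commuting (possibly unbounded) quantum observables and their functions -/

section Quantum

variable {N : ℕ} {𝓗 : Type*} [NormedAddCommGroup 𝓗] [InnerProductSpace ℂ 𝓗] [CompleteSpace 𝓗]

/-- The bounded operator `R` is the resolvent `(A - w)⁻¹`. -/
def IsResolvent (A : 𝓗 →ₗ.[ℂ] 𝓗) (w : ℂ) (R : 𝓗 →L[ℂ] 𝓗) : Prop :=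
  ∀ ψ φ : 𝓗, R ψ = φ ↔ ∃ h : φ ∈ A.domain, A ⟨φ, h⟩ - w • φ = ψ

/-- Two self-adjoint operators commute (in the usual sense for unbounded operators) if their
resolvents commute. For bounded operators this says `A B = B A`. -/
def OperatorsCommute (A B : 𝓗 →ₗ.[ℂ] 𝓗) : Prop :=
  ∀ (v w : ℂ) (R S : 𝓗 →L[ℂ] 𝓗), v.im ≠ 0 → w.im ≠ 0 →
    IsResolvent A v R → IsResolvent B w S → Commute R S

/-- The joint spectrum of the commuting self-adjoint operators `A₁, …, A_N`: the points `a ∈ ℝᴺ`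
that admit approximate joint eigenvectors. -/
def jointSpectrum (A : Fin N → 𝓗 →ₗ.[ℂ] 𝓗) : Set (Fin N → ℝ) :=
  {a | ∀ ε > (0 : ℝ), ∃ ψ : 𝓗, ‖ψ‖ = 1 ∧
    ∀ i, ∃ h : ψ ∈ (A i).domain, ‖A i ⟨ψ, h⟩ - (a i : ℂ) • ψ‖ < ε}

/-- `Φ` is the joint functional calculus `g ↦ g(A₁, …, A_N) = ∫ g dE` on the continuous functions
that vanish at infinity, where `E` is the joint spectral measure: a nondegenerate
`*`-representation such that `Aᵢ g(A) = (aᵢ g)(A)` whenever `aᵢ g` vanishes at infinity too. By the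
spectral theorem a commuting family of self-adjoint operators has exactly one. -/
structure IsJointCalculus (A : Fin N → 𝓗 →ₗ.[ℂ] 𝓗)
    (Φ : C₀(Fin N → ℝ, ℂ) →⋆ₙₐ[ℂ] (𝓗 →L[ℂ] 𝓗)) : Prop where
  nondegenerate : ∀ ψ : 𝓗, (∀ g, Φ g ψ = 0) → ψ = 0
  apply_coord : ∀ (i : Fin N) (g k : C₀(Fin N → ℝ, ℂ)), (∀ a, k a = (a i : ℂ) * g a) →
    ∀ ψ : 𝓗, ∃ h : Φ g ψ ∈ (A i).domain, A i ⟨Φ g ψ, h⟩ = Φ k ψ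

/-- The relation `φ = ∑ⱼ fⱼ(A) ψⱼ`, for real functions `fⱼ` on `ℝᴺ` that may be unbounded, expressed
in the spectral representation of `A` by means of its localizations
`g(A) φ = ∑ⱼ (g fⱼ)(A) ψⱼ`, where `g` and all `g fⱼ` are continuous and vanish at infinity (for
instance, `fⱼ` is continuous and `g` has compact support). For a single index it says that `ψ` lies
in the domain of `f(A) = ∫ f dE` and `f(A) ψ = φ`, if `f` is continuous. -/
def IsSpectralSum {κ : Type*} [Fintype κ] (A : Fin N → 𝓗 →ₗ.[ℂ] 𝓗)
    (f : κ → (Fin N → ℝ) → ℝ) (ψ : κ → 𝓗) (φ : 𝓗) : Prop :=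
  ∀ Φ : C₀(Fin N → ℝ, ℂ) →⋆ₙₐ[ℂ] (𝓗 →L[ℂ] 𝓗), IsJointCalculus A Φ →
    ∀ (g : C₀(Fin N → ℝ, ℂ)) (k : κ → C₀(Fin N → ℝ, ℂ)),
      (∀ j a, k j a = g a * (f j a : ℂ)) → Φ g φ = ∑ j, Φ (k j) (ψ j)

end Quantum

/-! ### Hybrid wave equation and hybrid density operator -/

section Hybrid

variable {n N : ℕ} {Q : Type*} [TopologicalSpace Q] [ChartedSpace (Model n) Q]
  [IsManifold 𝓘(ℝ, Model n) ∞ Q]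
variable {𝓗 : Type*} [NormedAddCommGroup 𝓗] [InnerProductSpace ℂ 𝓗] [CompleteSpace 𝓗]

/-- The hybrid Liouvillian of the hybrid Hamiltonian `Ĥ(z) = H(z, A₁, …, A_N)` maps `u` to a
function whose value at `z` is `ξ`:
`ξ = iℏ ∑ᵢ (∂Ĥ/∂qⁱ ∂u/∂pᵢ - ∂Ĥ/∂pᵢ ∂u/∂qⁱ) + (Ĥ - 𝒜 · X_Ĥ) u` at `z`. -/
def IsHybridLiouvillianAt (ħ : ℝ) (A : Fin N → 𝓗 →ₗ.[ℂ] 𝓗)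
    (H : PhaseSpace n Q → (Fin N → ℝ) → ℝ) (u : PhaseSpace n Q → 𝓗) (z : PhaseSpace n Q)
    (ξ : 𝓗) : Prop :=
  IsSpectralSum (κ := Fin n ⊕ Fin n ⊕ Unit) A
    (Sum.elim (fun i a => dq i (fun w => H w a) z)
      (Sum.elim (fun i a => dp i (fun w => H w a) z)
        (fun _ a => -lagrangian (fun w => H w a) z)))
    (Sum.elim (fun i => (Complex.I * ħ) • dp i u z)
      (Sum.elim (fun i => -((Complex.I * ħ) • dq i u z))
        (fun _ => u z)))
    ξ

/-- `Υ` is a (continuously differentiable) solution, on the time interval `J`, of the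
quantum-classical wave equation `iℏ ∂Υ/∂t = {iℏ Ĥ, Υ} + (Ĥ - 𝒜 · X_Ĥ) Υ` with
`Ĥ(z) = H(z, A₁, …, A_N)`. -/
structure IsSolution (ħ : ℝ) (A : Fin N → 𝓗 →ₗ.[ℂ] 𝓗)
    (H : PhaseSpace n Q → (Fin N → ℝ) → ℝ) (J : Set ℝ)
    (Υ : ℝ → PhaseSpace n Q → 𝓗) : Prop where
  contMDiffOn : ContMDiffOn (𝓘(ℝ, ℝ).prod (phaseModel n)) 𝓘(ℝ, 𝓗) 1
    (fun x : ℝ × PhaseSpace n Q => Υ x.1 x.2) (J ×ˢ Set.univ)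
  wave_equation : ∀ t ∈ J, ∀ z, ∃ Υt : 𝓗,
    HasDerivWithinAt (fun s => Υ s z) Υt J t ∧
      IsHybridLiouvillianAt ħ A H (Υ t) z ((Complex.I * ħ) • Υt)

/-- The operator `u v†`, that is `ψ ↦ ⟨v|ψ⟩ u`. -/
abbrev ketBra (u v : 𝓗) : 𝓗 →L[ℂ] 𝓗 := InnerProductSpace.rankOne ℂ u v

/-- The hybrid density operator
`𝒟(z) = u u† + ∑ᵢ ∂(pᵢ u u†)/∂pᵢ + iℏ {u, u†}` of the hybrid wavefunction `u` at `z`. Its second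
term `-div(𝕁𝒜 u u†)` is expanded as `n u u† + ∑ᵢ pᵢ ∂(u u†)/∂pᵢ`. -/
def densityOperator (ħ : ℝ) (u : PhaseSpace n Q → 𝓗) (z : PhaseSpace n Q) : 𝓗 →L[ℂ] 𝓗 :=
  ketBra (u z) (u z)
    + ((n : ℂ) • ketBra (u z) (u z)
      + ∑ i, (momentum z i : ℂ) • dp i (fun w => ketBra (u w) (u w)) z)
    + (Complex.I * ħ) •
      ∑ i, (ketBra (dq i u z) (dp i u z) - ketBra (dp i u z) (dq i u z))

/-- The classical Liouville density `ρ_c(z) = Tr 𝒟(z)`, computed in a Hilbert basis `b`. -/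
def classicalDensity {ι : Type*} (b : HilbertBasis ι ℂ 𝓗) (ħ : ℝ) (u : PhaseSpace n Q → 𝓗)
    (z : PhaseSpace n Q) : ℝ :=
  ∑' j, (inner ℂ (b j) (densityOperator ħ u z (b j))).re

end Hybrid

end HybridQC

end

/-! The density, resolved over the joint spectral value a of the commuting observables, obeys for
each a the classical Liouville equation of H(·,a). Its sign is therefore carried along the
trajectories of H(·,a), and the trace is the total over all a.

The Liouville equation comes from a commutator. Adjoin a phase variable s on which wave functions
depend as exp(is), so that ∂_s acts as multiplication by i. Then the wave equation reads YΥ = 0,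
where Y = ∂_t + X_H plus the phase component -ħ⁻¹(𝒜·X_H - H). For a scalar symbol B(t, z, a) let K_B
be the prequantum lift of the Hamiltonian field of ħB. Integration by parts
(`integral_traceDensityAt`) gives ∫ Tr(𝒟 B(·, α̂)) = i ∫ ⟨K_B Υ, Υ⟩: the three terms of 𝒟 are those
for which this holds. Moreover [Y, K_B] is K of ∂_t B + X_H B (`bracket_lift`). Both fields are
divergence-free, so YΥ = 0 forces the expectation of [Y, K_B] to vanish
(`sum_pair_bracket_eq_zero`), hence ∫ Tr(𝒟 (∂_t B + X_H B)(α̂)) = 0. This is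
`integral_traceDensityAt_transportDeriv`.

Since Υ is only continuously differentiable and 𝒟 already contains its first derivatives, everything
is done weakly: second derivatives are replaced by the weak symmetry
`integral_bilin_lineDeriv_comm`, and the time dependence of integrals of the density is read off by
`norm_sub_le_of_weak_deriv`. To deduce positivity, a nonnegative test function near a trajectory is
pulled back in time by k Euler steps of X_H. A pull-back stays nonnegative, and each step changes
the integral by O(1/k²), so that the total error disappears as k grows
(`IsLocalSolution.re_densityIntegral_nonneg`). Only one integral curve for the fixed a is used, and
no smooth dependence of the flow on its initial point. Local transport is chained along the curve by
connectedness of the time interval. The local statements are made in canonical charts; changes of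
these charts are cotangent lifts, which preserve the Poisson bivector (`IsCotangentLift.sum_bilin`).

At time 0, Tr(𝒟 g(α̂)) is the trace of √g(α̂) 𝒟 √g(α̂), hence nonnegative for g ≥ 0. Near a point a
outside the joint spectrum g(α̂) vanishes, so complete flows are needed only on the spectrum. A
partition of unity in a joins the local statements, and g increasing to 1 gives Tr 𝒟 ≥ 0. The trace
converges in each basis because 𝒟(z) has finite rank. -/

open scoped Manifold ContDiff ZeroAtInfty
noncomputable section
namespace HybridQC

/-! ### Resolvents of an unbounded self-adjoint operator at ±i. -/

section Resolvent

variable {𝓗 : Type*} [NormedAddCommGroup 𝓗] [InnerProductSpace ℂ 𝓗] [CompleteSpace 𝓗]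

lemma inner_apply_eq_of_isSelfAdjoint {A : 𝓗 →ₗ.[ℂ] 𝓗} (hA : IsSelfAdjoint A) (x y : A.domain) :
    inner ℂ (A x) (y : 𝓗) = inner ℂ (x : 𝓗) (A y) := by
  have h := LinearPMap.adjoint_isFormalAdjoint (T := A) hA.dense_domain
  rw [LinearPMap.isSelfAdjoint_def.1 hA] at h
  exact h x y

/-- The number ⟨Ax, x⟩ is real, so the cross term has real part zero for imaginary w. The identity
yields injectivity, closed range and the norm bound for the inverse of A - w. -/
lemma norm_sq_sub_smul {A : 𝓗 →ₗ.[ℂ] 𝓗} (hA : IsSelfAdjoint A) {w : ℂ} (hw : w.re = 0)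
    (x : A.domain) : ‖A x - w • (x : 𝓗)‖ ^ 2 = ‖A x‖ ^ 2 + ‖w‖ ^ 2 * ‖(x : 𝓗)‖ ^ 2 := by
  have hreal : (inner ℂ (A x) (x : 𝓗)).im = 0 := by
    have h1 := inner_apply_eq_of_isSelfAdjoint hA x x
    have h2 := inner_conj_symm (𝕜 := ℂ) (x : 𝓗) (A x)
    rw [← h1] at h2
    have := congrArg Complex.im h2
    simp only [Complex.conj_im] at this
    linarith
  rw [@norm_sub_sq ℂ, inner_smul_right, norm_smul]
  have : RCLike.re (w * inner ℂ (A x) (x : 𝓗)) = 0 := by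
    simp [hw, hreal]
  rw [this]; ring

/-- On the closed graph of A the map A - w is bounded below, so its range is closed. A vector y
orthogonal to the range lies in the domain of the adjoint with A*y = w̄y; as A* = A, the norm
identity at w̄ gives y = 0. -/
lemma isSelfAdjoint_sub_smul_surjective {A : 𝓗 →ₗ.[ℂ] 𝓗} (hA : IsSelfAdjoint A) {w : ℂ}
    (hw : w.re = 0) (hw1 : ‖w‖ = 1) (ψ : 𝓗) : ∃ x : A.domain, A x - w • (x : 𝓗) = ψ := by
  let f : A.graph →ₗ[ℂ] 𝓗 :=
    (LinearMap.snd ℂ 𝓗 𝓗 - w • LinearMap.fst ℂ 𝓗 𝓗).comp A.graph.subtype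
  have hf : ∀ p : A.graph, ‖p‖ ≤ 1 * ‖f p‖ := by
    rintro ⟨⟨x, y⟩, hp⟩
    obtain ⟨z, hz1, hz2⟩ := (LinearPMap.mem_graph_iff A).1 hp
    simp only at hz1 hz2
    have h := norm_sq_sub_smul hA hw z
    rw [hw1, hz1, hz2] at h
    have hfe : f ⟨⟨x, y⟩, hp⟩ = y - w • x := by simp [f]
    rw [hfe, one_mul]
    change ‖(x, y)‖ ≤ _
    rw [Prod.norm_mk]
    refine max_le ?_ ?_ <;> refine le_of_sq_le_sq ?_ (norm_nonneg _) <;> 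
      nlinarith [sq_nonneg ‖x‖, sq_nonneg ‖y‖]
  have hgc : IsClosed (A.graph : Set (𝓗 × 𝓗)) := hA.isClosed
  have : CompleteSpace A.graph := hgc.completeSpace_coe
  have hfc : Continuous f := by
    change Continuous (fun p : A.graph => (p : 𝓗 × 𝓗).2 - w • (p : 𝓗 × 𝓗).1)
    fun_prop
  have hcl : IsClosed (Set.range f) := by
    have hal : AntilipschitzWith 1 f := by
      refine AddMonoidHomClass.antilipschitz_of_bound f ?_
      simpa using hf
    let fc : A.graph →L[ℂ] 𝓗 := ⟨f, hfc⟩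
    exact (hal.isClosed_range (f := f) (show UniformContinuous fc from fc.uniformContinuous))
  have hbot : (LinearMap.range f)ᗮ = ⊥ := by
    rw [Submodule.eq_bot_iff]
    intro y hy
    rw [Submodule.mem_orthogonal] at hy
    have h1 : ∀ x : A.domain, inner ℂ (star w • y) (x : 𝓗) = inner ℂ y (A x) := by
      intro x
      have := hy (A x - w • (x : 𝓗)) ⟨⟨((x : 𝓗), A x), A.mem_graph x⟩, by simp [f]⟩
      rw [inner_sub_left, sub_eq_zero, inner_smul_left] at this
      have h2 := congrArg (starRingEnd ℂ) this
      rw [map_mul, inner_conj_symm, inner_conj_symm] at h2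
      rw [inner_smul_left, h2]
      simp
    have hd : y ∈ A.adjoint.domain := LinearPMap.mem_adjoint_domain_of_exists y ⟨_, h1⟩
    have hAy : A.adjoint ⟨y, hd⟩ = star w • y :=
      LinearPMap.adjoint_apply_eq hA.dense_domain ⟨y, hd⟩ h1
    -- The equality of the adjoint with A is substituted for a variable operator, because the
    -- membership proof inside the argument depends on it.
    have key : ∀ B : 𝓗 →ₗ.[ℂ] 𝓗, B = A → ∀ h : y ∈ B.domain, B ⟨y, h⟩ = star w • y → y = 0 := by
      rintro B rfl h hB
      have h3 := norm_sq_sub_smul hA (w := star w) (by simpa using hw) ⟨y, h⟩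
      rw [hB] at h3
      simp only [sub_self, norm_zero, norm_smul, norm_star, hw1] at h3
      have : ‖y‖ = 0 := by nlinarith [norm_nonneg y]
      exact norm_eq_zero.1 this
    exact key _ (LinearPMap.isSelfAdjoint_def.1 hA) hd hAy
  have htop : LinearMap.range f = ⊤ := by
    have h1 := (Submodule.topologicalClosure_eq_top_iff (K := LinearMap.range f)).2 hbot
    have h2 : IsClosed ((LinearMap.range f : Submodule ℂ 𝓗) : Set 𝓗) := by
      rw [LinearMap.coe_range]; exact hcl
    rwa [h2.submodule_topologicalClosure_eq] at h1
  obtain ⟨⟨⟨x, y⟩, hp⟩, hx⟩ := LinearMap.range_eq_top.1 htop ψ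
  obtain ⟨z, hz1, hz2⟩ := (LinearPMap.mem_graph_iff A).1 hp
  simp only at hz1 hz2
  refine ⟨z, ?_⟩
  rw [hz1, hz2, ← hx]
  simp [f]

lemma exists_isResolvent {A : 𝓗 →ₗ.[ℂ] 𝓗} (hA : IsSelfAdjoint A) {w : ℂ}
    (hw : w.re = 0) (hw1 : ‖w‖ = 1) : ∃ R : 𝓗 →L[ℂ] 𝓗, IsResolvent A w R := by
  let T : A.domain →ₗ[ℂ] 𝓗 := A.toFun - w • A.domain.subtype
  have hT : ∀ x, T x = A x - w • (x : 𝓗) := fun x => rfl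
  have hbound : ∀ x : A.domain, ‖(x : 𝓗)‖ ≤ ‖T x‖ := by
    intro x
    refine le_of_sq_le_sq ?_ (norm_nonneg _)
    rw [hT, norm_sq_sub_smul hA hw, hw1]
    nlinarith [sq_nonneg ‖A x‖]
  have hinj : Function.Injective T := by
    rw [← LinearMap.ker_eq_bot, LinearMap.ker_eq_bot']
    intro x hx
    have := hbound x
    rw [hx, norm_zero] at this
    exact Subtype.ext (norm_le_zero_iff.1 this)
  have hsurj : Function.Surjective T := fun ψ => isSelfAdjoint_sub_smul_surjective hA hw hw1 ψ
  let e := LinearEquiv.ofBijective T ⟨hinj, hsurj⟩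
  refine ⟨(A.domain.subtype.comp e.symm.toLinearMap).mkContinuous 1 ?_, ?_⟩
  · intro ψ
    have := hbound (e.symm ψ)
    have h2 : T (e.symm ψ) = ψ := e.apply_symm_apply ψ
    rw [h2] at this
    simpa using this
  · intro ψ φ
    constructor
    · intro h
      have h' : ((e.symm ψ : A.domain) : 𝓗) = φ := h
      subst h'
      exact ⟨(e.symm ψ).2, e.apply_symm_apply ψ⟩
    · rintro ⟨h, h2⟩
      have : e ⟨φ, h⟩ = ψ := h2
      change ((e.symm ψ : A.domain) : 𝓗) = φ
      rw [← this, e.symm_apply_apply]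

variable {A : 𝓗 →ₗ.[ℂ] 𝓗} {R S : 𝓗 →L[ℂ] 𝓗}

lemma IsResolvent.exists_apply {w : ℂ} (hR : IsResolvent A w R) (ψ : 𝓗) :
    ∃ h : R ψ ∈ A.domain, A ⟨R ψ, h⟩ = ψ + w • R ψ := by
  obtain ⟨h, h2⟩ := (hR ψ (R ψ)).1 rfl
  exact ⟨h, by rw [sub_eq_iff_eq_add] at h2; exact h2⟩

lemma IsResolvent.star_eq (hA : IsSelfAdjoint A) (hR : IsResolvent A Complex.I R)
    (hS : IsResolvent A (-Complex.I) S) : star R = S := by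
  rw [ContinuousLinearMap.star_eq_adjoint, eq_comm, ContinuousLinearMap.eq_adjoint_iff]
  intro φ ψ
  obtain ⟨hx, hx2⟩ := hR.exists_apply ψ
  obtain ⟨hy, hy2⟩ := hS.exists_apply φ
  have h := inner_apply_eq_of_isSelfAdjoint hA ⟨S φ, hy⟩ ⟨R ψ, hx⟩
  rw [hx2, hy2, inner_add_left, inner_add_right, inner_smul_left, inner_smul_right] at h
  simp only [map_neg, Complex.conj_I, neg_neg] at h
  exact (add_right_cancel h).symm

/-- The resolvent identity between i and -i, where the resolvent at -i is the adjoint of the one at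
i. A character of the generated algebra must then send R to 0 or to (a - i)⁻¹ with a real. -/
lemma IsResolvent.sub_star (hA : IsSelfAdjoint A) (hR : IsResolvent A Complex.I R)
    (hS : IsResolvent A (-Complex.I) S) :
    R - star R = (2 * Complex.I) • (star R * R) := by
  rw [hR.star_eq hA hS]
  ext ψ
  obtain ⟨hx, hx2⟩ := hR.exists_apply ψ
  obtain ⟨hz, hz2⟩ := hS.exists_apply (R ψ)
  have key : S ψ = R ψ - (2 * Complex.I) • S (R ψ) := by
    refine (hS _ _).2 ⟨A.domain.sub_mem hx (A.domain.smul_mem _ hz), ?_⟩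
    have : A ⟨R ψ - (2 * Complex.I) • S (R ψ), A.domain.sub_mem hx (A.domain.smul_mem _ hz)⟩
        = A ⟨R ψ, hx⟩ - (2 * Complex.I) • A ⟨S (R ψ), hz⟩ := by
      rw [← LinearPMap.map_smul, ← LinearPMap.map_sub]; rfl
    rw [this, hx2, hz2]
    module
  change R ψ - S ψ = (2 * Complex.I) • S (R ψ)
  rw [key]
  abel

end Resolvent

end HybridQC
end

open scoped Manifold ContDiff ZeroAtInfty
noncomputable section
namespace HybridQC

/-! ### The joint functional calculus, from the Gelfand transform of the algebra of the resolvents.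
-/

section Calculus

/-- A self-adjoint coordinate recovered from the values of its resolvent at `i`. -/
lemma inv_eq_of_resolvent_relation {r : ℂ} (hr : r - star r = 2 * Complex.I * (star r * r))
    (h0 : r ≠ 0) : r⁻¹ = ((r⁻¹).re : ℂ) - Complex.I := by
  have h1 : star r ≠ 0 := by simpa using h0
  have h2 : (star r)⁻¹ - r⁻¹ = 2 * Complex.I := by
    field_simp
    rw [hr]; ring
  have h3 : (star r)⁻¹ = star (r⁻¹) := by simp
  rw [h3] at h2
  have h4 := congrArg Complex.im h2
  simp only [Complex.sub_im, Complex.star_def, Complex.conj_im, Complex.mul_im, Complex.re_ofNat,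
    Complex.I_im, Complex.im_ofNat, Complex.I_re] at h4
  apply Complex.ext
  · simp
  · simp only [Complex.sub_im, Complex.ofReal_im, Complex.I_im]; linarith

-- A zero of some `r i` plays the role of a point at infinity. Since 1/r has imaginary part -1, its
-- real part blows up as r tends to 0, and g, vanishing at infinity, extends continuously by 0.
open Classical in
lemma continuous_comp_resolvent {N : ℕ} {X : Type*} [TopologicalSpace X]
    (r : Fin N → C(X, ℂ))
    (hr : ∀ i x, r i x - star (r i x) = 2 * Complex.I * (star (r i x) * r i x))
    (g : C₀(Fin N → ℝ, ℂ)) :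
    Continuous fun x => if ∀ i, r i x ≠ 0 then g fun i => ((r i x)⁻¹).re else 0 := by
  rw [continuous_iff_continuousAt]
  intro x
  by_cases hx : ∀ i, r i x ≠ 0
  · have hev : ∀ᶠ y in nhds x, ∀ i, r i y ≠ 0 := by
      rw [Filter.eventually_all]
      exact fun i => (r i).continuous.continuousAt.eventually_ne (hx i)
    have h1 : ContinuousAt (fun y => g fun i => ((r i y)⁻¹).re) x := by
      refine g.continuous.continuousAt.comp (continuousAt_pi.2 fun i => ?_)
      exact Complex.continuous_re.continuousAt.comp ((r i).continuous.continuousAt.inv₀ (hx i))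
    refine h1.congr ?_
    filter_upwards [hev] with y hy
    rw [if_pos hy]
  · unfold ContinuousAt
    beta_reduce
    rw [if_neg hx]
    rw [Metric.tendsto_nhds]
    intro ε hε
    obtain ⟨i, hi⟩ := not_forall.1 hx
    rw [not_not] at hi
    have h1 : ∀ᶠ p in Filter.cocompact (Fin N → ℝ), dist (g p) 0 < ε :=
      (Metric.tendsto_nhds.1 g.zero_at_infty') ε hε
    rw [← Metric.cobounded_eq_cocompact, ← comap_norm_atTop, Filter.eventually_comap] at h1
    obtain ⟨M, hM⟩ := Filter.eventually_atTop.1 h1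
    -- With the margin 2 the modulus of the real coordinate still exceeds |M| after the contribution
    -- 1 of the imaginary part is subtracted.
    have h2 : ∀ᶠ y in nhds x, ‖r i y‖ < (|M| + 2)⁻¹ := by
      have : Filter.Tendsto (fun y => ‖r i y‖) (nhds x) (nhds 0) := by
        have h := ((r i).continuous.norm.tendsto x)
        rwa [hi, norm_zero] at h
      exact this.eventually_lt_const (by positivity)
    filter_upwards [h2] with y hy
    split_ifs with hy'
    · refine hM _ ?_ _ rfl
      have h3 := inv_eq_of_resolvent_relation (hr i y) (hy' i)
      have h4 : ‖(r i y)⁻¹‖ ≤ |((r i y)⁻¹).re| + 1 := by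
        calc ‖(r i y)⁻¹‖ = ‖(((r i y)⁻¹).re : ℂ) - Complex.I‖ := by rw [← h3]
          _ ≤ _ := by
            refine (norm_sub_le _ _).trans ?_
            rw [Complex.norm_real, Real.norm_eq_abs, Complex.norm_I]
      have h5 : |M| + 2 < ‖(r i y)⁻¹‖ := by
        rw [norm_inv]
        exact (lt_inv_comm₀ (by positivity) (norm_pos_iff.2 (hy' i))).2 hy
      have h6 := norm_le_pi_norm (fun i => ((r i y)⁻¹).re) i
      rw [Real.norm_eq_abs] at h6
      linarith [le_abs_self M]
    · simpa using hε

open Classical in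
/-- Functions of a family of continuous functions, given by the resolvents of the family. -/
def compResolvent {N : ℕ} {X : Type*} [TopologicalSpace X] [CompactSpace X] (r : Fin N → C(X, ℂ))
    (hr : ∀ i x, r i x - star (r i x) = 2 * Complex.I * (star (r i x) * r i x)) :
    C₀(Fin N → ℝ, ℂ) →⋆ₙₐ[ℂ] C(X, ℂ) where
  toFun g := ⟨_, continuous_comp_resolvent r hr g⟩
  map_smul' c g := by ext x; simp
  map_zero' := by ext x; simp
  map_add' g h := by ext x; simp only [ContinuousMap.add_apply, ContinuousMap.coe_mk]; split_ifs <;> simp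
  map_mul' g h := by ext x; simp only [ContinuousMap.mul_apply, ContinuousMap.coe_mk]; split_ifs <;> simp
  map_star' g := by ext x; simp only [ContinuousMap.star_apply, ContinuousMap.coe_mk]; split_ifs <;> simp

/-- Pointwise on the Gelfand spectrum, the first property is g = (aᵢ - i)⁻¹(aᵢg - ig), trivially
true where some resolvent vanishes. The second property identifies an image that is injective in the
application, which yields nondegeneracy. -/
lemma exists_calculus_of_resolvents {N : ℕ} {𝓑 : Type*} [CommCStarAlgebra 𝓑] (r : Fin N → 𝓑)
    (hr : ∀ i, r i - star (r i) = (2 * Complex.I) • (star (r i) * r i)) :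
    ∃ Ψ : C₀(Fin N → ℝ, ℂ) →⋆ₙₐ[ℂ] 𝓑,
      (∀ i (g k : C₀(Fin N → ℝ, ℂ)), (∀ a, k a = (a i : ℂ) * g a) →
        Ψ g = r i * (Ψ k - Complex.I • Ψ g)) ∧
      ∀ g : C₀(Fin N → ℝ, ℂ), (∀ a, g a = ∏ i, ((a i : ℂ) - Complex.I)⁻¹) → Ψ g = ∏ i, r i := by
  let G := gelfandStarTransform 𝓑
  have hr' : ∀ i x, G (r i) x - star (G (r i) x)
      = 2 * Complex.I * (star (G (r i) x) * G (r i) x) := by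
    intro i x
    have := congrArg (fun f => G f x) (hr i)
    simpa [map_sub, map_star, map_smul, map_mul] using this
  let Θ := compResolvent (fun i => G (r i)) hr'
  have hΘ : ∀ g x, (∀ i, G (r i) x ≠ 0) → Θ g x = g fun i => ((G (r i) x)⁻¹).re := by
    intro g x h
    exact if_pos h
  have hΘ0 : ∀ g x, ¬ (∀ i, G (r i) x ≠ 0) → Θ g x = 0 := by
    intro g x h
    exact if_neg h
  refine ⟨(G.symm : _ →⋆ₐ[ℂ] 𝓑).toNonUnitalStarAlgHom.comp Θ, ?_, ?_⟩
  · intro i g k hk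
    have key : Θ g = G (r i) * (Θ k - Complex.I • Θ g) := by
      ext x
      simp only [ContinuousMap.mul_apply, ContinuousMap.sub_apply, ContinuousMap.smul_apply]
      by_cases h : ∀ i, G (r i) x ≠ 0
      · rw [hΘ _ _ h, hΘ _ _ h, hk, smul_eq_mul, ← sub_mul,
          ← inv_eq_of_resolvent_relation (hr' i x) (h i), ← mul_assoc, mul_inv_cancel₀ (h i),
          one_mul]
      · rw [hΘ0 _ _ h, hΘ0 _ _ h]; simp
    have h1 := congrArg G.symm key
    rwa [map_mul, map_sub, map_smul, G.symm_apply_apply] at h1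
  · intro g hg
    have key : Θ g = ∏ i, G (r i) := by
      ext x
      rw [ContinuousMap.prod_apply]
      by_cases h : ∀ i, G (r i) x ≠ 0
      · rw [hΘ _ _ h, hg]
        refine Finset.prod_congr rfl fun i _ => ?_
        rw [← inv_eq_of_resolvent_relation (hr' i x) (h i), inv_inv]
      · rw [hΘ0 _ _ h]
        obtain ⟨i, hi⟩ := not_forall.1 h
        rw [not_not] at hi
        exact (Finset.prod_eq_zero (Finset.mem_univ i) hi).symm
    have h1 := congrArg G.symm key
    rw [map_prod] at h1
    simp only [G.symm_apply_apply] at h1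
    exact h1

/-- The function `a ↦ ∏ᵢ (aᵢ - i)⁻¹`. -/
def prodResolvent (N : ℕ) : C₀(Fin N → ℝ, ℂ) where
  toFun a := ∏ i, ((a i : ℂ) - Complex.I)⁻¹
  continuous_toFun := by
    refine continuous_finsetProd _ fun i _ => Continuous.inv₀ (by fun_prop) fun a h => ?_
    have := congrArg Complex.im h
    simp at this
  zero_at_infty' := by
    rw [← Metric.cobounded_eq_cocompact, tendsto_zero_iff_norm_tendsto_zero]
    have h1 : ∀ (i : Fin N) (a : Fin N → ℝ), |a i| ≤ ‖(a i : ℂ) - Complex.I‖ ∧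
        1 ≤ ‖(a i : ℂ) - Complex.I‖ := fun i a =>
      ⟨by simpa using Complex.abs_re_le_norm ((a i : ℂ) - Complex.I),
       by simpa using Complex.abs_im_le_norm ((a i : ℂ) - Complex.I)⟩
    have h2 : ∀ a : Fin N → ℝ, ‖a‖ ≤ ∏ i, ‖(a i : ℂ) - Complex.I‖ := by
      intro a
      refine (pi_norm_le_iff_of_nonneg (Finset.prod_nonneg fun i _ => norm_nonneg _)).2 fun i => ?_
      rw [← Finset.mul_prod_erase _ _ (Finset.mem_univ i), Real.norm_eq_abs]
      calc |a i| ≤ ‖(a i : ℂ) - Complex.I‖ := (h1 i a).1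
        _ ≤ _ := le_mul_of_one_le_right (norm_nonneg _) (by
          simpa using Finset.prod_le_prod (s := Finset.univ.erase i) (f := fun _ => (1 : ℝ))
            (fun _ _ => zero_le_one) fun j _ => (h1 j a).2)
    have h3 : ∀ a : Fin N → ℝ, ‖∏ i, ((a i : ℂ) - Complex.I)⁻¹‖
        = (∏ i, ‖(a i : ℂ) - Complex.I‖)⁻¹ := by
      intro a; rw [norm_prod]; simp [norm_inv, Finset.prod_inv_distrib]
    simp only [h3]
    exact tendsto_inv_atTop_zero.comp
      (Filter.tendsto_atTop_mono h2 tendsto_norm_cobounded_atTop)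

variable {N : ℕ} {𝓗 : Type*} [NormedAddCommGroup 𝓗] [InnerProductSpace ℂ 𝓗] [CompleteSpace 𝓗]

/-- The resolvents at i and their adjoints, which are the resolvents at -i, commute, so they
generate a commutative C*-algebra. The function ∏(aᵢ - i)⁻¹ is sent to the product of the
resolvents, and this product is injective, whence nondegeneracy. Multiplication by aᵢ corresponds to
applying Aᵢ because Ψ g lies in the range of the i-th resolvent. -/
theorem exists_isJointCalculus (A : Fin N → 𝓗 →ₗ.[ℂ] 𝓗) (hA : ∀ i, IsSelfAdjoint (A i))
    (hcomm : ∀ i j, OperatorsCommute (A i) (A j)) :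
    ∃ Φ : C₀(Fin N → ℝ, ℂ) →⋆ₙₐ[ℂ] (𝓗 →L[ℂ] 𝓗), IsJointCalculus A Φ := by
  choose R hR using fun i => exists_isResolvent (hA i) (w := Complex.I) (by simp) (by simp)
  choose S hS using fun i => exists_isResolvent (hA i) (w := -Complex.I) (by simp) (by simp)
  have hst : ∀ i, star (R i) = S i := fun i => (hR i).star_eq (hA i) (hS i)
  let s : Set (𝓗 →L[ℂ] 𝓗) := Set.range R
  have hc1 : ∀ a ∈ s, ∀ b ∈ s, a * b = b * a := by
    rintro _ ⟨i, rfl⟩ _ ⟨j, rfl⟩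
    exact hcomm i j Complex.I Complex.I _ _ (by simp) (by simp) (hR i) (hR j)
  have hc2 : ∀ a ∈ s, ∀ b ∈ s, a * star b = star b * a := by
    rintro _ ⟨i, rfl⟩ _ ⟨j, rfl⟩
    rw [hst]
    exact hcomm i j Complex.I (-Complex.I) _ _ (by simp) (by simp) (hR i) (hS j)
  let S₀ := StarAlgebra.adjoin ℂ s
  let S₁ := S₀.topologicalClosure
  have hcl : IsClosed (S₁ : Set (𝓗 →L[ℂ] 𝓗)) := S₀.isClosed_topologicalClosure
  have hcomm₀ : ∀ x y : S₀, x * y = y * x :=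
    (StarAlgebra.isMulCommutative_adjoin ℂ hc1 hc2).is_comm.comm
  have hcomm₁ : ∀ x y : S₁, x * y = y * x :=
    (StarSubalgebra.commRingTopologicalClosure S₀ hcomm₀).mul_comm
  let _ : CStarAlgebra S₁ := StarSubalgebra.cstarAlgebra S₁ (h_closed := hcl)
  let _ : CommCStarAlgebra S₁ := { (inferInstance : CStarAlgebra S₁) with mul_comm := hcomm₁ }
  have hmem : ∀ i, R i ∈ S₁ := fun i =>
    S₀.le_topologicalClosure (StarAlgebra.subset_adjoin ℂ s ⟨i, rfl⟩)
  obtain ⟨Ψ, hΨ1, hΨ2⟩ := exists_calculus_of_resolvents (fun i => (⟨R i, hmem i⟩ : S₁)) (by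
    intro i
    apply Subtype.ext
    exact (hR i).sub_star (hA i) (hS i))
  refine ⟨S₁.subtype.toNonUnitalStarAlgHom.comp Ψ, ?_, ?_⟩
  · intro ψ hψ
    have h1 := hψ (prodResolvent N)
    have h2 : (S₁.subtype.toNonUnitalStarAlgHom.comp Ψ) (prodResolvent N)
        = ((∏ i, (⟨R i, hmem i⟩ : S₁) : S₁) : 𝓗 →L[ℂ] 𝓗) := by
      rw [← hΨ2 (prodResolvent N) (fun a => rfl)]; rfl
    rw [h2] at h1
    have hinj : ∀ i (φ : 𝓗), R i φ = 0 → φ = 0 := by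
      intro i φ h
      obtain ⟨h', h''⟩ := (hR i φ 0).1 h
      rw [← h'']
      have : A i ⟨0, h'⟩ = 0 := (A i).map_zero
      simp [this]
    have h3 : ∀ (t : Finset (Fin N)) (φ : 𝓗),
        ((∏ i ∈ t, (⟨R i, hmem i⟩ : S₁) : S₁) : 𝓗 →L[ℂ] 𝓗) φ = 0 → φ = 0 := by
      intro t
      induction t using Finset.induction_on with
      | empty => intro φ h; simpa using h
      | insert i t hi ih =>
        intro φ h
        rw [Finset.prod_insert hi] at h
        exact ih φ (hinj i _ h)
    exact h3 _ _ h1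
  · intro i g k hk ψ
    have h1 := congrArg (fun x : S₁ => (x : 𝓗 →L[ℂ] 𝓗) ψ) (hΨ1 i g k hk)
    have h2 : (Ψ g : 𝓗 →L[ℂ] 𝓗) ψ
        = R i ((Ψ k : 𝓗 →L[ℂ] 𝓗) ψ - Complex.I • (Ψ g : 𝓗 →L[ℂ] 𝓗) ψ) := h1
    obtain ⟨h, h3⟩ := (hR i _ _).1 h2.symm
    refine ⟨h, ?_⟩
    exact sub_left_injective h3

end Calculus

end HybridQC
end

open scoped Manifold ContDiff ZeroAtInfty
noncomputable section
namespace HybridQC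

/-! ### Operators f(A) for real f, continuous with compact support. -/

section FunctionsOfObservables

variable {P : Type*} [NormedAddCommGroup P]
variable {𝓗 : Type*} [NormedAddCommGroup 𝓗] [InnerProductSpace ℂ 𝓗] [CompleteSpace 𝓗]

/-- Continuous functions of compact support. -/
def IsCc (f : P → ℝ) : Prop := Continuous f ∧ HasCompactSupport f

lemma IsCc.add {f g : P → ℝ} (hf : IsCc f) (hg : IsCc g) : IsCc fun a => f a + g a :=
  ⟨hf.1.add hg.1, hf.2.add hg.2⟩

lemma IsCc.neg {f : P → ℝ} (hf : IsCc f) : IsCc fun a => -f a :=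
  ⟨hf.1.neg, hf.2.neg⟩

lemma IsCc.sub {f g : P → ℝ} (hf : IsCc f) (hg : IsCc g) : IsCc fun a => f a - g a := by
  simpa only [sub_eq_add_neg] using hf.add hg.neg

lemma IsCc.mul_left {f g : P → ℝ} (hf : Continuous f) (hg : IsCc g) : IsCc fun a => f a * g a :=
  ⟨hf.mul hg.1, hg.2.mul_left⟩

lemma IsCc.mul_right {f g : P → ℝ} (hf : IsCc f) (hg : Continuous g) : IsCc fun a => f a * g a :=
  ⟨hf.1.mul hg, hf.2.mul_right⟩

lemma isCc_zero : IsCc (fun _ : P => (0 : ℝ)) := ⟨continuous_const, HasCompactSupport.zero⟩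

lemma IsCc.sum {κ : Type*} {s : Finset κ} {f : κ → P → ℝ} (hf : ∀ j, IsCc (f j)) :
    IsCc fun a => ∑ j ∈ s, f j a := by
  classical
  induction s using Finset.induction_on with
  | empty => simpa using isCc_zero
  | insert j s hj ih => simpa only [Finset.sum_insert hj] using (hf j).add ih

open Classical in
/-- A continuous real function of compact support as a complex function vanishing at infinity
(and `0` for all other functions). -/
def toC0 (f : P → ℝ) : C₀(P, ℂ) :=
  if h : IsCc f then
    { toFun := fun a => (f a : ℂ)
      continuous_toFun := Complex.continuous_ofReal.comp h.1
      zero_at_infty' := (h.2.comp_left (g := ((↑) : ℝ → ℂ)) Complex.ofReal_zero).is_zero_at_infty }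
  else 0

lemma toC0_apply {f : P → ℝ} (h : IsCc f) (a : P) : toC0 f a = (f a : ℂ) := by
  rw [toC0, dif_pos h]; rfl

lemma toC0_add {f g : P → ℝ} (hf : IsCc f) (hg : IsCc g) :
    toC0 (fun a => f a + g a) = toC0 f + toC0 g := by
  ext a; simp [toC0_apply, hf, hg, hf.add hg]

lemma toC0_sub {f g : P → ℝ} (hf : IsCc f) (hg : IsCc g) :
    toC0 (fun a => f a - g a) = toC0 f - toC0 g := by
  ext a; simp [toC0_apply, hf, hg, hf.sub hg]

lemma toC0_smul {f : P → ℝ} (hf : IsCc f) (c : ℝ) :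
    toC0 (fun a => c * f a) = (c : ℂ) • toC0 f := by
  ext a; simp [toC0_apply, hf, IsCc.mul_left continuous_const hf]

lemma toC0_mul {f g : P → ℝ} (hf : IsCc f) (hg : IsCc g) :
    toC0 (fun a => f a * g a) = toC0 f * toC0 g := by
  ext a; simp [toC0_apply, hf, hg, hf.mul_right hg.1]

lemma toC0_zero : toC0 (fun _ : P => (0 : ℝ)) = 0 := by
  ext a; simp [toC0_apply isCc_zero]

lemma star_toC0 {f : P → ℝ} (hf : IsCc f) : star (toC0 f) = toC0 f := by
  ext a; simp [toC0_apply hf]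

lemma norm_toC0_le {f : P → ℝ} (hf : IsCc f) {C : ℝ} (hC : 0 ≤ C) (h : ∀ a, |f a| ≤ C) :
    ‖toC0 f‖ ≤ C := by
  rw [← ZeroAtInftyContinuousMap.norm_toBCF_eq_norm]
  refine (BoundedContinuousFunction.norm_le hC).2 fun a => ?_
  change ‖toC0 f a‖ ≤ C
  rw [toC0_apply hf, Complex.norm_real]
  exact h a

/-- The operator `f(A₁, …, A_N)` for a continuous real function `f` of compact support. -/
def op (Φ : C₀(P, ℂ) →⋆ₙₐ[ℂ] (𝓗 →L[ℂ] 𝓗)) (f : P → ℝ) : 𝓗 →L[ℂ] 𝓗 := Φ (toC0 f)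

variable (Φ : C₀(P, ℂ) →⋆ₙₐ[ℂ] (𝓗 →L[ℂ] 𝓗))

lemma op_add {f g : P → ℝ} (hf : IsCc f) (hg : IsCc g) :
    op Φ (fun a => f a + g a) = op Φ f + op Φ g := by
  rw [op, toC0_add hf hg, map_add]; rfl

lemma op_sub {f g : P → ℝ} (hf : IsCc f) (hg : IsCc g) :
    op Φ (fun a => f a - g a) = op Φ f - op Φ g := by
  rw [op, toC0_sub hf hg, map_sub]; rfl

lemma op_smul {f : P → ℝ} (hf : IsCc f) (c : ℝ) :
    op Φ (fun a => c * f a) = (c : ℂ) • op Φ f := by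
  rw [op, toC0_smul hf, map_smul]; rfl

lemma op_mul {f g : P → ℝ} (hf : IsCc f) (hg : IsCc g) :
    op Φ (fun a => f a * g a) = op Φ f * op Φ g := by
  rw [op, toC0_mul hf hg, map_mul]; rfl

lemma op_zero : op Φ (fun _ => 0) = 0 := by
  rw [op, toC0_zero, map_zero]

lemma op_neg {f : P → ℝ} (hf : IsCc f) : op Φ (fun a => -f a) = -op Φ f := by
  have := op_smul Φ hf (-1)
  simpa using this

lemma op_sum {κ : Type*} (s : Finset κ) {f : κ → P → ℝ} (hf : ∀ j, IsCc (f j)) :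
    op Φ (fun a => ∑ j ∈ s, f j a) = ∑ j ∈ s, op Φ (f j) := by
  classical
  induction s using Finset.induction_on with
  | empty => simpa using op_zero Φ
  | insert j s hj ih =>
    simp only [Finset.sum_insert hj]
    rw [op_add Φ (hf j) (IsCc.sum hf), ih]

lemma inner_op_left {f : P → ℝ} (hf : IsCc f) (v w : 𝓗) :
    inner ℂ (op Φ f v) w = inner ℂ v (op Φ f w) := by
  have h : star (op Φ f) = op Φ f := by
    rw [op, ← map_star, star_toC0 hf]
  rw [← ContinuousLinearMap.adjoint_inner_left, ← ContinuousLinearMap.star_eq_adjoint, h]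

lemma norm_map_le (g : C₀(P, ℂ)) : ‖Φ g‖ ≤ ‖g‖ := NonUnitalStarAlgHom.norm_apply_le Φ g

lemma norm_op_le {f : P → ℝ} (hf : IsCc f) {C : ℝ} (hC : 0 ≤ C) (h : ∀ a, |f a| ≤ C) :
    ‖op Φ f‖ ≤ C :=
  (norm_map_le Φ _).trans (norm_toC0_le hf hC h)

lemma IsCc.sqrt {f : P → ℝ} (hf : IsCc f) : IsCc fun a => Real.sqrt (f a) :=
  ⟨hf.1.sqrt, hf.2.comp_left Real.sqrt_zero⟩

/-- Nonnegative f factor as the square of √f, which is again continuous with compact support.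
Positivity of 𝒟 is later tested on the vectors √f(A)b. -/
lemma inner_op_eq_sqrt {f : P → ℝ} (hf : IsCc f) (h0 : ∀ a, 0 ≤ f a) (v w : 𝓗) :
    inner ℂ v (op Φ f w)
      = inner ℂ (op Φ (fun a => Real.sqrt (f a)) v) (op Φ (fun a => Real.sqrt (f a)) w) := by
  have h1 : f = fun a => Real.sqrt (f a) * Real.sqrt (f a) := by
    funext a; rw [Real.mul_self_sqrt (h0 a)]
  have h2 : op Φ f = op Φ (fun a => Real.sqrt (f a)) * op Φ (fun a => Real.sqrt (f a)) := by
    rw [← op_mul Φ hf.sqrt hf.sqrt, ← h1]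
  rw [inner_op_left Φ hf.sqrt, h2]
  rfl

end FunctionsOfObservables

/-! ### Locality of the calculus on the joint spectrum, and strong approximation of the identity. -/

section Spectrum

variable {N : ℕ} {𝓗 : Type*} [NormedAddCommGroup 𝓗] [InnerProductSpace ℂ 𝓗] [CompleteSpace 𝓗]
variable {A : Fin N → 𝓗 →ₗ.[ℂ] 𝓗} {Φ : C₀(Fin N → ℝ, ℂ) →⋆ₙₐ[ℂ] (𝓗 →L[ℂ] 𝓗)}

/-- If f(A)φ were nonzero with f concentrated near a₀, its normalization would be an approximate
joint eigenvector at a₀. This allows the flow to be incomplete for values a off the spectrum. -/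
lemma IsJointCalculus.op_eq_zero_of_notMem_jointSpectrum (hΦ : IsJointCalculus A Φ)
    {a₀ : Fin N → ℝ} (ha : a₀ ∉ jointSpectrum A) :
    ∃ δ > (0 : ℝ), ∀ f : (Fin N → ℝ) → ℝ, IsCc f → Function.support f ⊆ Metric.ball a₀ δ →
      op Φ f = 0 := by
  simp only [jointSpectrum, Set.mem_ofPred_eq, not_forall] at ha
  obtain ⟨ε, hε, hno⟩ := ha
  refine ⟨ε / 4, by positivity, fun f hf hsupp => ?_⟩
  by_contra hne
  obtain ⟨φ, hφ⟩ : ∃ φ, op Φ f φ ≠ 0 := by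
    by_contra h
    push Not at h
    exact hne (ContinuousLinearMap.ext h)
  apply hno
  have hpos : 0 < ‖op Φ f φ‖ := norm_pos_iff.2 hφ
  let c : ℂ := ((‖op Φ f φ‖⁻¹ : ℝ) : ℂ)
  have hcn : ‖c‖ = ‖op Φ f φ‖⁻¹ := by
    simp [c]
  refine ⟨c • op Φ f φ, ?_, fun i => ?_⟩
  · rw [norm_smul, hcn, inv_mul_cancel₀ hpos.ne']
  have hfi : IsCc fun a : Fin N → ℝ => a i * f a := IsCc.mul_left (continuous_apply i) hf
  obtain ⟨h1, h2⟩ := hΦ.apply_coord i (toC0 f) (toC0 fun a => a i * f a) (fun a => by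
    rw [toC0_apply hf, toC0_apply hfi]; push_cast; rfl) φ
  refine ⟨(A i).domain.smul_mem c h1, ?_⟩
  have h3 : A i ⟨c • op Φ f φ, (A i).domain.smul_mem c h1⟩ = c • op Φ (fun a => a i * f a) φ := by
    have h2' : A i ⟨op Φ f φ, h1⟩ = op Φ (fun a => a i * f a) φ := h2
    rw [← h2', ← LinearPMap.map_smul]; rfl
  -- This bump is 1 on the support of f, so inserting it changes nothing in (aᵢ - a₀ᵢ)f, while (aᵢ -
  -- a₀ᵢ)k is bounded by the outer radius ε/2.
  let k : ContDiffBump a₀ := ⟨ε / 4, ε / 2, by positivity, by linarith⟩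
  have hk : IsCc fun a => (a i - a₀ i) * k a :=
    IsCc.mul_left (by fun_prop) ⟨k.continuous, k.hasCompactSupport⟩
  have h4 : (fun a : Fin N → ℝ => a i * f a - a₀ i * f a)
      = fun a => ((a i - a₀ i) * k a) * f a := by
    funext a
    by_cases hfa : f a = 0
    · simp [hfa]
    · have : k a = 1 := k.one_of_mem_closedBall (Metric.ball_subset_closedBall (hsupp hfa))
      rw [this]; ring
  have h5 : op Φ (fun a => a i * f a) - (a₀ i : ℂ) • op Φ f
      = op Φ (fun a => (a i - a₀ i) * k a) * op Φ f := by
    rw [← op_mul Φ hk hf, ← h4, op_sub Φ hfi (IsCc.mul_left continuous_const hf), op_smul Φ hf]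
  have h6 : ‖op Φ (fun a => (a i - a₀ i) * k a)‖ ≤ ε / 2 := by
    refine norm_op_le Φ hk (by positivity) fun a => ?_
    by_cases hka : k a = 0
    · simp [hka]; positivity
    · have hmem : a ∈ Function.support k := hka
      rw [k.support_eq] at hmem
      have h7 : |a i - a₀ i| ≤ ε / 2 := by
        have := (dist_le_pi_dist a a₀ i).trans (Metric.mem_ball.1 hmem).le
        rwa [Real.dist_eq] at this
      rw [abs_mul]
      have h8 : |k a| ≤ 1 := by rw [abs_of_nonneg k.nonneg]; exact k.le_one
      calc |a i - a₀ i| * |k a| ≤ (ε / 2) * 1 := by gcongr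
        _ = ε / 2 := mul_one _
  have h9 : A i ⟨c • op Φ f φ, (A i).domain.smul_mem c h1⟩ - (a₀ i : ℂ) • (c • op Φ f φ)
      = c • (op Φ (fun a => (a i - a₀ i) * k a) (op Φ f φ)) := by
    rw [h3, smul_comm, ← smul_sub]
    congr 1
    exact congrArg (fun T : 𝓗 →L[ℂ] 𝓗 => T φ) h5
  rw [h9, norm_smul, hcn]
  calc ‖op Φ f φ‖⁻¹ * ‖op Φ (fun a => (a i - a₀ i) * k a) (op Φ f φ)‖
      ≤ ‖op Φ f φ‖⁻¹ * (ε / 2 * ‖op Φ f φ‖) := by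
        gcongr
        exact (ContinuousLinearMap.le_opNorm _ _).trans (by gcongr)
    _ = ε / 2 := by field_simp
    _ < ε := by linarith

/-- Smooth functions with compact support that increase to `1`. -/
def cutoffBump (N n : ℕ) : ContDiffBump (0 : Fin N → ℝ) :=
  ⟨n + 1, n + 2, by positivity, by linarith⟩

lemma cutoffBump_isCc (N n : ℕ) : IsCc (cutoffBump N n) :=
  ⟨(cutoffBump N n).continuous, (cutoffBump N n).hasCompactSupport⟩

/-- The operators are contractions, so convergence on a dense subspace suffices. On a vector g(A)ψ
it follows from uniform convergence of the cut-off functions to g, and by nondegeneracy these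
vectors span a dense subspace. -/
lemma IsJointCalculus.tendsto_op_cutoffBump (hΦ : IsJointCalculus A Φ) (w : 𝓗) :
    Filter.Tendsto (fun n => op Φ (cutoffBump N n) w) Filter.atTop (nhds w) := by
  have hb : ∀ n, ‖op Φ (cutoffBump N n)‖ ≤ 1 := fun n =>
    norm_op_le Φ (cutoffBump_isCc N n) zero_le_one fun a => by
      rw [abs_of_nonneg (cutoffBump N n).nonneg]; exact (cutoffBump N n).le_one
  let S : Submodule ℂ 𝓗 :=
    { carrier := {w | Filter.Tendsto (fun n => op Φ (cutoffBump N n) w) Filter.atTop (nhds w)}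
      add_mem' := fun {x y} hx hy => by simpa using Filter.Tendsto.add hx hy
      zero_mem' := by simp
      smul_mem' := fun c x hx => by simpa using Filter.Tendsto.const_smul hx c }
  have hS : ∀ g ψ, Φ g ψ ∈ S := by
    intro g ψ
    change Filter.Tendsto (fun n => op Φ (cutoffBump N n) (Φ g ψ)) Filter.atTop (nhds (Φ g ψ))
    rw [Metric.tendsto_atTop]
    intro ε hε
    have h1 : ∀ᶠ p in Filter.cocompact (Fin N → ℝ), dist (g p) 0 < ε / (2 * (‖ψ‖ + 1)) :=
      (Metric.tendsto_nhds.1 g.zero_at_infty') _ (by positivity)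
    rw [← Metric.cobounded_eq_cocompact, ← comap_norm_atTop, Filter.eventually_comap] at h1
    obtain ⟨M, hM⟩ := Filter.eventually_atTop.1 h1
    obtain ⟨m, hm⟩ := exists_nat_gt M
    refine ⟨m, fun n hn => ?_⟩
    have h2 : op Φ (cutoffBump N n) (Φ g ψ) - Φ g ψ = Φ (toC0 (cutoffBump N n) * g - g) ψ := by
      rw [map_sub, map_mul]; rfl
    rw [dist_eq_norm, h2]
    have h3 : ‖toC0 (cutoffBump N n) * g - g‖ ≤ ε / (2 * (‖ψ‖ + 1)) := by
      rw [← ZeroAtInftyContinuousMap.norm_toBCF_eq_norm]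
      refine (BoundedContinuousFunction.norm_le (by positivity)).2 fun a => ?_
      change ‖toC0 (cutoffBump N n) a * g a - g a‖ ≤ _
      rw [toC0_apply (cutoffBump_isCc N n)]
      by_cases ha : ‖a‖ ≤ n + 1
      · rw [(cutoffBump N n).one_of_mem_closedBall (by simpa [cutoffBump] using ha)]
        simp; positivity
      · have hMa : M ≤ ‖a‖ := by
          have : (m : ℝ) ≤ n := by exact_mod_cast hn
          push Not at ha
          linarith
        have h4 := hM _ hMa a rfl
        rw [dist_zero_right] at h4
        have h5 : ((cutoffBump N n a : ℝ) : ℂ) * g a - g a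
            = (((cutoffBump N n a - 1 : ℝ)) : ℂ) * g a := by push_cast; ring
        rw [h5, norm_mul, Complex.norm_real, Real.norm_eq_abs]
        have h6 : |cutoffBump N n a - 1| ≤ 1 := by
          rw [abs_le]
          constructor <;> linarith [(cutoffBump N n).nonneg (x := a),
            (cutoffBump N n).le_one (x := a)]
        calc |cutoffBump N n a - 1| * ‖g a‖ ≤ 1 * ‖g a‖ := by gcongr
          _ ≤ _ := by rw [one_mul]; exact h4.le
    calc ‖Φ (toC0 (cutoffBump N n) * g - g) ψ‖
        ≤ ε / (2 * (‖ψ‖ + 1)) * ‖ψ‖ :=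
          (ContinuousLinearMap.le_opNorm _ _).trans
            (by gcongr; exact (norm_map_le Φ _).trans h3)
      _ < ε := by
        rw [div_mul_eq_mul_div, div_lt_iff₀ (by positivity)]
        nlinarith [norm_nonneg ψ]
  have hbot : Sᗮ = ⊥ := by
    rw [Submodule.eq_bot_iff]
    intro y hy
    rw [Submodule.mem_orthogonal] at hy
    refine hΦ.nondegenerate y fun g => ?_
    refine ext_inner_left ℂ fun ψ => ?_
    have h1 := hy _ (hS (star g) ψ)
    rw [map_star, ContinuousLinearMap.star_eq_adjoint,
      ContinuousLinearMap.adjoint_inner_left] at h1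
    rw [h1, inner_zero_right]
  have htop := (Submodule.topologicalClosure_eq_top_iff (K := S)).2 hbot
  have hw : w ∈ closure (S : Set 𝓗) := by
    rw [← Submodule.topologicalClosure_coe, htop]; trivial
  rw [Metric.tendsto_atTop]
  intro ε hε
  obtain ⟨s, hs, hws⟩ := Metric.mem_closure_iff.1 hw (ε / 3) (by positivity)
  obtain ⟨m, hm⟩ := Metric.tendsto_atTop.1 (show Filter.Tendsto _ _ _ from hs) (ε / 3)
    (by positivity)
  refine ⟨m, fun n hn => ?_⟩
  have h1 := hm n hn
  rw [dist_eq_norm] at h1 hws ⊢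
  have h2 : op Φ (cutoffBump N n) w - w
      = op Φ (cutoffBump N n) (w - s) + (op Φ (cutoffBump N n) s - s) - (w - s) := by
    rw [map_sub]; abel
  have h3 : ‖op Φ (cutoffBump N n) (w - s)‖ ≤ 1 * ‖w - s‖ :=
    (ContinuousLinearMap.le_opNorm _ _).trans (by gcongr; exact hb n)
  rw [h2]
  calc _ ≤ ‖op Φ (cutoffBump N n) (w - s)‖ + ‖op Φ (cutoffBump N n) s - s‖ + ‖w - s‖ :=
        (norm_sub_le _ _).trans (by gcongr; exact norm_add_le _ _)
    _ < ε := by linarith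

end Spectrum

end HybridQC
end

open scoped Manifold ContDiff ZeroAtInfty
noncomputable section
namespace HybridQC

/-! ### Test functions on X × P as maps from X to functions on P. -/

section Currying

variable {X : Type*} [NormedAddCommGroup X]
variable {P : Type*} [NormedAddCommGroup P]

lemma IsCc.slice {f : X × P → ℝ} (hf : IsCc f) (x : X) : IsCc fun a => f (x, a) := by
  refine ⟨hf.1.comp (by fun_prop), ?_⟩
  refine HasCompactSupport.intro (hf.2.isCompact.image continuous_snd) fun a ha => ?_
  by_contra h
  exact ha ⟨(x, a), subset_tsupport _ h, rfl⟩

lemma continuous_toC0_slice {f : X × P → ℝ} (hf : IsCc f) :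
    Continuous fun x => toC0 fun a => f (x, a) := by
  rw [Metric.continuous_iff]
  intro x ε hε
  obtain ⟨δ, hδ, h⟩ := Metric.uniformContinuous_iff.1
    (hf.2.uniformContinuous_of_continuous hf.1) (ε / 2) (by positivity)
  refine ⟨δ, hδ, fun y hy => ?_⟩
  rw [dist_eq_norm, ← toC0_sub (hf.slice y) (hf.slice x)]
  refine (norm_toC0_le ((hf.slice y).sub (hf.slice x)) (by positivity) fun a => ?_).trans_lt
    (half_lt_self hε)
  have := @h (y, a) (x, a) (by rw [Prod.dist_eq]; exact max_lt hy (by simpa using hδ))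
  rw [Real.dist_eq] at this
  exact this.le

variable [NormedSpace ℝ X] [NormedSpace ℝ P]

/-- The derivative of `f` in the direction `v` of the first factor. -/
def dir (v : X) (f : X × P → ℝ) (y : X × P) : ℝ := fderiv ℝ f y (v, 0)

/-- Smooth functions of compact support. -/
def IsTest {Y : Type*} [NormedAddCommGroup Y] [NormedSpace ℝ Y] (f : Y → ℝ) : Prop :=
  ContDiff ℝ ∞ f ∧ HasCompactSupport f

lemma IsTest.isCc {Y : Type*} [NormedAddCommGroup Y] [NormedSpace ℝ Y] {f : Y → ℝ}
    (hf : IsTest f) : IsCc f := ⟨hf.1.continuous, hf.2⟩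

lemma contDiff_dir {f : X × P → ℝ} (hf : ContDiff ℝ ∞ f) (v : X) : ContDiff ℝ ∞ (dir v f) :=
  (hf.fderiv_right (m := ∞) (by simp)).clm_apply contDiff_const

lemma IsTest.dir {f : X × P → ℝ} (hf : IsTest f) (v : X) : IsTest (dir v f) :=
  ⟨contDiff_dir hf.1 v, hf.2.fderiv_apply (𝕜 := ℝ) (v, 0)⟩

lemma dir_zero (f : X × P → ℝ) : dir 0 f = 0 := by
  funext y
  have : ((0 : X), (0 : P)) = 0 := rfl
  simp [dir, this]

lemma differentiable_of_smooth {Y : Type*} [NormedAddCommGroup Y] [NormedSpace ℝ Y] {f : Y → ℝ}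
    (hf : ContDiff ℝ ∞ f) : Differentiable ℝ f := hf.differentiable (by simp)

lemma hasDerivAt_slice {f : X × P → ℝ} (hf : ContDiff ℝ ∞ f) (x v : X) (a : P) (s : ℝ) :
    HasDerivAt (fun s : ℝ => f (x + s • v, a)) (dir v f (x + s • v, a)) s := by
  have h1 : HasDerivAt (fun s : ℝ => (x + s • v, a)) (v, (0 : P)) s := by
    refine HasDerivAt.prodMk ?_ (hasDerivAt_const _ _)
    simpa using ((hasDerivAt_id s).smul_const v).const_add x
  exact ((differentiable_of_smooth hf) _).hasFDerivAt.comp_hasDerivAt s h1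

/-- The limit must hold in the sup norm over a. Uniform continuity of the compactly supported `dir v
f` makes the mean value estimate uniform in a. -/
lemma hasLineDerivAt_toC0_slice {f : X × P → ℝ} (hf : IsTest f) (v x : X) :
    HasLineDerivAt ℝ (fun x => toC0 fun a => f (x, a)) (toC0 fun a => dir v f (x, a)) x v := by
  unfold HasLineDerivAt
  rw [hasDerivAt_iff_isLittleO, Asymptotics.isLittleO_iff]
  intro ε hε
  obtain ⟨δ, hδ, h⟩ := Metric.uniformContinuous_iff.1
    ((hf.dir v).2.uniformContinuous_of_continuous (hf.dir v).1.continuous) ε hε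
  have h1 : ∀ᶠ s : ℝ in nhds 0, |s| * ‖v‖ < δ := by
    have : Filter.Tendsto (fun s : ℝ => |s| * ‖v‖) (nhds 0) (nhds (|0| * ‖v‖)) :=
      Continuous.tendsto (by fun_prop) 0
    simp only [abs_zero, zero_mul] at this
    exact this.eventually_lt_const hδ
  filter_upwards [h1] with s hs
  have hc : ∀ x, IsCc fun a => f (x, a) := hf.isCc.slice
  have hc' : IsCc fun a => s * dir v f (x, a) :=
    IsCc.mul_left continuous_const ((hf.dir v).isCc.slice x)
  have h2 : toC0 (fun a => f (x + s • v, a)) - toC0 (fun a => f (x + (0 : ℝ) • v, a))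
      - (s - 0) • toC0 (fun a => dir v f (x, a))
      = toC0 fun a => f (x + s • v, a) - f (x, a) - s * dir v f (x, a) := by
    rw [toC0_sub ((hc _).sub (hc _)) hc', toC0_sub (hc _) (hc _), toC0_smul ((hf.dir v).isCc.slice x)]
    simp only [zero_smul, add_zero, sub_zero]
    congr 1
  rw [h2]
  refine norm_toC0_le (((hc _).sub (hc _)).sub hc') (by positivity) fun a => ?_
  have h3 := Convex.norm_image_sub_le_of_norm_hasDerivWithin_le
    (f := fun σ : ℝ => f (x + σ • v, a) - σ * dir v f (x, a))
    (f' := fun σ => dir v f (x + σ • v, a) - dir v f (x, a)) (s := Set.uIcc 0 s) (C := ε)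
    (x := 0) (y := s)
    (fun σ _ => ((hasDerivAt_slice hf.1 x v a σ).sub
      (by simpa using (hasDerivAt_id σ).mul_const (dir v f (x, a)))).hasDerivWithinAt)
    (fun σ hσ => by
      have hσ' : |σ| ≤ |s| := by
        have := Set.abs_sub_left_of_mem_uIcc hσ
        simpa using this
      have h5 : dist (x + σ • v, a) (x, a) < δ := by
        rw [Prod.dist_eq]
        refine max_lt ?_ (by simpa using hδ)
        simp only [dist_self_add_left, norm_smul, Real.norm_eq_abs]
        exact (mul_le_mul_of_nonneg_right hσ' (norm_nonneg v)).trans_lt hs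
      have := h h5
      rw [dist_eq_norm] at this
      exact this.le)
    (convex_uIcc 0 s) Set.left_mem_uIcc Set.right_mem_uIcc
  simp only [zero_smul, add_zero, zero_mul, sub_zero, Real.norm_eq_abs] at h3 ⊢
  rwa [sub_right_comm] at h3

end Currying

/-! ### Integration by parts for functions with only first derivatives. -/

section IntegrationByParts

open MeasureTheory

variable {X : Type*} [NormedAddCommGroup X] [NormedSpace ℝ X] [FiniteDimensional ℝ X]
  [MeasurableSpace X] [BorelSpace X] (μ : Measure X) [μ.IsAddHaarMeasure]
variable {F G W : Type*} [NormedAddCommGroup F] [NormedSpace ℝ F] [NormedAddCommGroup G]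
  [NormedSpace ℝ G] [NormedAddCommGroup W] [NormedSpace ℝ W]

lemma integrable_bilin_left (B : F →L[ℝ] G →L[ℝ] W) {f : X → F} {g : X → G}
    (hf : Continuous f) (hfs : HasCompactSupport f) (hg : Continuous g) :
    Integrable (fun x => B (f x) (g x)) μ := by
  refine Continuous.integrable_of_hasCompactSupport (by fun_prop) ?_
  refine hfs.mono fun x hx => ?_
  contrapose! hx
  simp only [Function.mem_support, not_not] at hx ⊢
  simp [hx]

lemma integrable_bilin_right (B : F →L[ℝ] G →L[ℝ] W) {f : X → F} {g : X → G}
    (hf : Continuous f) (hg : Continuous g) (hgs : HasCompactSupport g) :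
    Integrable (fun x => B (f x) (g x)) μ := by
  refine Continuous.integrable_of_hasCompactSupport (by fun_prop) ?_
  refine hgs.mono fun x hx => ?_
  contrapose! hx
  simp only [Function.mem_support, not_not] at hx ⊢
  simp [hx]

lemma HasCompactSupport.lineDeriv {g g' : X → G} {v : X} (hgs : HasCompactSupport g)
    (hg' : ∀ x, HasLineDerivAt ℝ g (g' x) x v) : HasCompactSupport g' := by
  refine hgs.mono' fun x hx => ?_
  by_contra h
  apply hx
  have h1 : g =ᶠ[nhds x] fun _ => (0 : G) := notMem_tsupport_iff_eventuallyEq.1 h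
  have h2 := (hg' x).congr_of_eventuallyEq (h1.symm)
  exact h2.unique ((hasFDerivAt_const (0 : G) x).hasLineDerivAt v)

/-- Differentiation of a translate under the integral sign. -/
lemma hasDerivAt_integral_bilin_translate (B : F →L[ℝ] G →L[ℝ] W) {f : X → F} {g g' : X → G}
    {v : X} (hf : Continuous f) (hfs : HasCompactSupport f) (hg : Continuous g)
    (hg' : Continuous g') (hgs : HasCompactSupport g)
    (hd : ∀ x, HasLineDerivAt ℝ g (g' x) x v) :
    HasDerivAt (fun s : ℝ => ∫ x, B (f x) (g (x + s • v)) ∂μ) (∫ x, B (f x) (g' x) ∂μ) 0 := by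
  have hgs' : HasCompactSupport g' := HasCompactSupport.lineDeriv hgs hd
  obtain ⟨C, hC⟩ := hg'.bounded_above_of_compact_support hgs'
  have key := hasDerivAt_integral_of_dominated_loc_of_deriv_le (μ := μ) (𝕜 := ℝ)
    (F := fun s x => B (f x) (g (x + s • v))) (F' := fun s x => B (f x) (g' (x + s • v)))
    (x₀ := (0 : ℝ)) (s := Set.univ) (bound := fun x => ‖B‖ * ‖f x‖ * C) Filter.univ_mem
    (Filter.Eventually.of_forall fun s =>
      (integrable_bilin_left μ B hf hfs (by fun_prop)).aestronglyMeasurable)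
    (integrable_bilin_left μ B hf hfs (by fun_prop))
    (integrable_bilin_left μ B hf hfs (by fun_prop)).aestronglyMeasurable
    (Filter.Eventually.of_forall fun x s _ =>
      (B.le_opNorm₂ _ _).trans (by gcongr; exact hC _))
    (Continuous.integrable_of_hasCompactSupport (by fun_prop)
      ((hfs.norm.mul_left (f := fun _ => ‖B‖)).mul_right (f' := fun _ => C)))
    (Filter.Eventually.of_forall fun x s _ => by
      have h1 : HasDerivAt (fun s : ℝ => g (x + s • v)) (g' (x + s • v)) s := by
        have h2 : HasDerivAt (fun τ : ℝ => g (x + s • v + τ • v)) (g' (x + s • v)) 0 :=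
          hd (x + s • v)
        have h3 := HasDerivAt.comp_sub_const (f := fun τ : ℝ => g (x + s • v + τ • v)) s s
          (by simpa using h2)
        refine h3.congr_of_eventuallyEq (Filter.Eventually.of_forall fun τ => ?_)
        simp only [sub_smul]
        congr 1
        abel
      exact (B (f x)).hasFDerivAt.comp_hasDerivAt s h1)
  simpa using key.2

/-- Mixed derivatives commute weakly: `∫ ⟨∂ₓf, ∂ᵧg⟩ = ∫ ⟨∂ᵧf, ∂ₓg⟩`. -/
lemma integral_bilin_lineDeriv_comm (B : F →L[ℝ] G →L[ℝ] W)
    {f f₁ f₂ : X → F} {g g₁ g₂ : X → G} {v w : X} (hf : Continuous f) (hf₁ : Continuous f₁)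
    (hf₂ : Continuous f₂) (hg : Continuous g) (hg₁ : Continuous g₁) (hg₂ : Continuous g₂)
    (hfs : HasCompactSupport f) (hgs : HasCompactSupport g)
    (hfd₁ : ∀ x, HasLineDerivAt ℝ f (f₁ x) x v) (hfd₂ : ∀ x, HasLineDerivAt ℝ f (f₂ x) x w)
    (hgd₁ : ∀ x, HasLineDerivAt ℝ g (g₁ x) x v) (hgd₂ : ∀ x, HasLineDerivAt ℝ g (g₂ x) x w) :
    ∫ x, B (f₁ x) (g₂ x) ∂μ = ∫ x, B (f₂ x) (g₁ x) ∂μ := by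
  have hfs₁ : HasCompactSupport f₁ := HasCompactSupport.lineDeriv hfs hfd₁
  have hgs₁ : HasCompactSupport g₁ := HasCompactSupport.lineDeriv hgs hgd₁
  -- Second derivatives need not exist, so one of the two derivatives is taken as a derivative of a
  -- translation parameter: ∫B(∂ᵥf, g(· + sw)) = -∫B(f(· - sw), ∂ᵥg), by parts in v and translation
  -- invariance, and this is differentiated at s = 0.
  have h1 := hasDerivAt_integral_bilin_translate μ B hf₁ hfs₁ hg hg₂ hgs hgd₂
  have h2 := hasDerivAt_integral_bilin_translate μ B.flip hg₁ hgs₁ hf hf₂ hfs hfd₂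
  have hline : ∀ (s : ℝ) x, HasLineDerivAt ℝ (fun x => g (x + s • w)) (g₁ (x + s • w)) x v := by
    intro s x
    have := hgd₁ (x + s • w)
    unfold HasLineDerivAt at this ⊢
    refine this.congr_of_eventuallyEq (Filter.Eventually.of_forall fun τ => ?_)
    simp only
    congr 1; abel
  have h3 : ∀ s : ℝ, ∫ x, B (f₁ x) (g (x + s • w)) ∂μ
      = -∫ x, B.flip (g₁ x) (f (x + (-s) • w)) ∂μ := by
    intro s
    have h4 := integral_bilinear_hasLineDerivAt_right_eq_neg_left_of_integrable (μ := μ) (B := B)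
      (f := f) (f' := f₁) (g := fun x => g (x + s • w)) (g' := fun x => g₁ (x + s • w)) (v := v)
      (integrable_bilin_left μ B hf₁ hfs₁ (by fun_prop))
      (integrable_bilin_left μ B hf hfs (by fun_prop))
      (integrable_bilin_left μ B hf hfs (by fun_prop)) (fun x _ => hfd₁ x) (fun x _ => hline s x)
    rw [eq_neg_iff_add_eq_zero, add_comm, ← eq_neg_iff_add_eq_zero, ← h4,
      ← integral_add_right_eq_self _ (s • w)]
    simp
  have h2' : HasDerivAt (fun s : ℝ => ∫ x, B.flip (g₁ x) (f (x + s • w)) ∂μ)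
      (∫ x, B.flip (g₁ x) (f₂ x) ∂μ) (-(0 : ℝ)) := by
    rw [neg_zero]; exact h2
  have h5 := h2'.scomp (0 : ℝ) (hasDerivAt_neg (0 : ℝ))
  have h6 := h1.unique (h5.neg.congr_of_eventuallyEq (Filter.Eventually.of_forall h3))
  simpa using h6

end IntegrationByParts

end HybridQC
end

open scoped Manifold ContDiff ZeroAtInfty
noncomputable section
namespace HybridQC

/-! ### The pairing ∫⟨v, f(x, A)w⟩ and its algebra. -/

section Pairing

open MeasureTheory

variable {𝓗 : Type*} [NormedAddCommGroup 𝓗] [InnerProductSpace ℂ 𝓗]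

/-- The inner product as a real bilinear map. -/
def innerR (𝓗 : Type*) [NormedAddCommGroup 𝓗] [InnerProductSpace ℂ 𝓗] : 𝓗 →L[ℝ] 𝓗 →L[ℝ] ℂ :=
  LinearMap.mkContinuous₂
    (LinearMap.mk₂ ℝ (fun v w : 𝓗 => inner ℂ v w) (fun _ _ _ => inner_add_left _ _ _)
      (fun c v w => by
        rw [← Complex.coe_smul, inner_smul_left]; simp)
      (fun _ _ _ => inner_add_right _ _ _)
      (fun c v w => by
        rw [← Complex.coe_smul, inner_smul_right]; simp)) 1
    (fun v w => by simpa using norm_inner_le_norm v w)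

lemma innerR_apply (v w : 𝓗) : innerR 𝓗 v w = inner ℂ v w := rfl

variable [CompleteSpace 𝓗]
variable {P : Type*} [NormedAddCommGroup P]
variable (Φ : C₀(P, ℂ) →⋆ₙₐ[ℂ] (𝓗 →L[ℂ] 𝓗))

/-- A calculus as a continuous real linear map. -/
def calculusL : C₀(P, ℂ) →L[ℝ] (𝓗 →L[ℝ] 𝓗) :=
  LinearMap.mkContinuous
    { toFun := fun g => (Φ g).restrictScalars ℝ
      map_add' := fun g h => by rw [map_add]; rfl
      map_smul' := fun c g => by
        rw [← Complex.coe_smul, map_smul]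
        ext v
        simp } 1
    (fun g => by
      rw [one_mul]
      simpa using norm_map_le Φ g)

variable {X : Type*} [NormedAddCommGroup X]

/-- The vector field `x ↦ f(x, A) w(x)`. -/
def opField (f : X × P → ℝ) (w : X → 𝓗) (x : X) : 𝓗 := op Φ (fun a => f (x, a)) (w x)

lemma continuous_opField {f : X × P → ℝ} (hf : IsCc f) {w : X → 𝓗} (hw : Continuous w) :
    Continuous (opField Φ f w) :=
  ((calculusL Φ).continuous.comp (continuous_toC0_slice hf)).clm_apply hw

lemma hasCompactSupport_opField {f : X × P → ℝ} (hf : IsCc f) (w : X → 𝓗) :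
    HasCompactSupport (opField Φ f w) := by
  refine HasCompactSupport.intro (hf.2.isCompact.image continuous_fst) fun x hx => ?_
  have : (fun a => f (x, a)) = fun _ => 0 := by
    funext a
    by_contra h
    exact hx ⟨(x, a), subset_tsupport _ h, rfl⟩
  rw [opField, this, op_zero]; rfl

lemma opField_add_left {f g : X × P → ℝ} (hf : IsCc f) (hg : IsCc g) (w : X → 𝓗) (x : X) :
    opField Φ (fun y => f y + g y) w x = opField Φ f w x + opField Φ g w x := by
  simp only [opField]
  rw [op_add Φ (hf.slice x) (hg.slice x)]; rfl

lemma hasLineDerivAt_opField [NormedSpace ℝ X] [NormedSpace ℝ P] {f : X × P → ℝ} (hf : IsTest f)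
    {w : X → 𝓗} {v x : X} {w' : 𝓗} (hw : HasLineDerivAt ℝ w w' x v) :
    HasLineDerivAt ℝ (opField Φ f w)
      (opField Φ (dir v f) w x + op Φ (fun a => f (x, a)) w') x v := by
  have h1 : HasDerivAt (fun s : ℝ => calculusL Φ (toC0 fun a => f (x + s • v, a)))
      (calculusL Φ (toC0 fun a => dir v f (x, a))) 0 :=
    (calculusL Φ).hasFDerivAt.comp_hasDerivAt 0 (hasLineDerivAt_toC0_slice hf v x)
  have h2 := h1.clm_apply hw
  simp only [zero_smul, add_zero] at h2
  exact h2

variable [MeasurableSpace X] (μ : Measure X)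

/-- The sesquilinear expression `∫ ⟨v(x)|f(x, A) w(x)⟩ dx`. -/
def pair (v : X → 𝓗) (f : X × P → ℝ) (w : X → 𝓗) : ℂ :=
  ∫ x, inner ℂ (v x) (opField Φ f w x) ∂μ

variable [BorelSpace X] [IsFiniteMeasureOnCompacts μ]

lemma integrable_inner_opField {f : X × P → ℝ} (hf : IsCc f) {v w : X → 𝓗} (hv : Continuous v)
    (hw : Continuous w) : Integrable (fun x => inner ℂ (v x) (opField Φ f w x)) μ := by
  refine Continuous.integrable_of_hasCompactSupport
    (hv.inner (continuous_opField Φ hf hw)) ?_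
  refine (hasCompactSupport_opField Φ hf w).mono fun x hx => ?_
  contrapose! hx
  simp only [Function.mem_support, not_not] at hx ⊢
  rw [hx, inner_zero_right]

section Algebra

variable {f g : X × P → ℝ} {v v' w w' : X → 𝓗}

lemma pair_add_mid (hf : IsCc f) (hg : IsCc g) (hv : Continuous v) (hw : Continuous w) :
    pair Φ μ v (fun y => f y + g y) w = pair Φ μ v f w + pair Φ μ v g w := by
  unfold pair
  rw [← integral_add (integrable_inner_opField Φ μ hf hv hw)
    (integrable_inner_opField Φ μ hg hv hw)]
  simp only [opField_add_left Φ hf hg, inner_add_right]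

lemma pair_smul_mid (hf : IsCc f) (c : ℝ) :
    pair Φ μ v (fun y => c * f y) w = c * pair Φ μ v f w := by
  unfold pair
  rw [← integral_const_mul]
  congr 1
  funext x
  simp only [opField]
  rw [op_smul Φ (hf.slice x), smul_apply, inner_smul_right]

lemma pair_neg_mid (hf : IsCc f) : pair Φ μ v (fun y => -f y) w = -pair Φ μ v f w := by
  have := pair_smul_mid Φ μ (v := v) (w := w) hf (-1)
  simpa using this

lemma pair_sub_mid (hf : IsCc f) (hg : IsCc g) (hv : Continuous v) (hw : Continuous w) :
    pair Φ μ v (fun y => f y - g y) w = pair Φ μ v f w - pair Φ μ v g w := by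
  have := pair_add_mid Φ μ hf hg.neg hv hw
  rw [pair_neg_mid Φ μ hg] at this
  simpa only [sub_eq_add_neg] using this

lemma pair_zero_mid : pair Φ μ v (fun _ => 0) w = 0 := by
  simp [pair, opField, op_zero]

lemma pair_sum_mid {κ : Type*} (s : Finset κ) {f : κ → X × P → ℝ} (hf : ∀ j, IsCc (f j))
    (hv : Continuous v) (hw : Continuous w) :
    pair Φ μ v (fun y => ∑ j ∈ s, f j y) w = ∑ j ∈ s, pair Φ μ v (f j) w := by
  classical
  induction s using Finset.induction_on with
  | empty => simpa using pair_zero_mid Φ μ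
  | insert j s hj ih =>
    simp only [Finset.sum_insert hj]
    rw [pair_add_mid Φ μ (hf j) (IsCc.sum hf) hv hw, ih]

lemma pair_add_left (hf : IsCc f) (hv : Continuous v) (hv' : Continuous v') (hw : Continuous w) :
    pair Φ μ (fun x => v x + v' x) f w = pair Φ μ v f w + pair Φ μ v' f w := by
  unfold pair
  rw [← integral_add (integrable_inner_opField Φ μ hf hv hw)
    (integrable_inner_opField Φ μ hf hv' hw)]
  simp only [inner_add_left]

lemma pair_add_right (hf : IsCc f) (hv : Continuous v) (hw : Continuous w) (hw' : Continuous w') :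
    pair Φ μ v f (fun x => w x + w' x) = pair Φ μ v f w + pair Φ μ v f w' := by
  unfold pair
  rw [← integral_add (integrable_inner_opField Φ μ hf hv hw)
    (integrable_inner_opField Φ μ hf hv hw')]
  simp only [opField, map_add, inner_add_right]

lemma pair_smul_left (c : ℂ) : pair Φ μ (fun x => c • v x) f w = star c * pair Φ μ v f w := by
  unfold pair
  rw [← integral_const_mul]
  simp only [inner_smul_left]
  rfl

lemma pair_smul_right (c : ℂ) : pair Φ μ v f (fun x => c • w x) = c * pair Φ μ v f w := by
  unfold pair
  rw [← integral_const_mul]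
  simp only [opField, map_smul, inner_smul_right]

lemma star_pair (hf : IsCc f) : star (pair Φ μ v f w) = pair Φ μ w f v := by
  unfold pair
  rw [Complex.star_def, ← integral_conj]
  congr 1
  funext x
  rw [inner_conj_symm]
  exact inner_op_left Φ (hf.slice x) _ _

end Algebra

end Pairing

/-! ### Expectation of a commutator of two first-order operators. -/

section CovariantDerivative

open MeasureTheory

variable {𝓗 : Type*} [NormedAddCommGroup 𝓗] [InnerProductSpace ℂ 𝓗] [CompleteSpace 𝓗]
variable {P : Type*} [NormedAddCommGroup P] [NormedSpace ℝ P]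
variable (Φ : C₀(P, ℂ) →⋆ₙₐ[ℂ] (𝓗 →L[ℂ] 𝓗))
variable {X : Type*} [NormedAddCommGroup X] [NormedSpace ℝ X] [FiniteDimensional ℝ X]
  [MeasurableSpace X] [BorelSpace X] (μ : Measure X) [μ.IsAddHaarMeasure]

lemma hasLineDerivAt_of_contDiff {u : X → 𝓗} (hu : ContDiff ℝ 1 u) (e x : X) :
    HasLineDerivAt ℝ u (fderiv ℝ u x e) x e :=
  ((hu.differentiable (by simp)) x).hasFDerivAt.hasLineDerivAt e

lemma continuous_fderiv_dir {u : X → 𝓗} (hu : ContDiff ℝ 1 u) (e : X) :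
    Continuous fun x => fderiv ℝ u x e :=
  (hu.continuous_fderiv (by simp)).clm_apply continuous_const

lemma pair_lineDeriv {u : X → 𝓗} (hu : ContDiff ℝ 1 u) {f : X × P → ℝ} (hf : IsTest f) (e : X) :
    pair Φ μ (fun x => fderiv ℝ u x e) f u + pair Φ μ u (dir e f) u
      + pair Φ μ u f (fun x => fderiv ℝ u x e) = 0 := by
  have hu' := continuous_fderiv_dir hu e
  have h1 : ∀ x, HasLineDerivAt ℝ (opField Φ f u)
      (opField Φ (dir e f) u x + opField Φ f (fun x => fderiv ℝ u x e) x) x e := fun x =>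
    hasLineDerivAt_opField Φ hf (hasLineDerivAt_of_contDiff hu e x)
  have hc := hasCompactSupport_opField Φ hf.isCc u
  have hc' : Continuous fun x => opField Φ (dir e f) u x
      + opField Φ f (fun x => fderiv ℝ u x e) x :=
    (continuous_opField Φ (hf.dir e).isCc hu.continuous).add (continuous_opField Φ hf.isCc hu')
  have h2 := integral_bilinear_hasLineDerivAt_right_eq_neg_left_of_integrable (μ := μ)
    (B := innerR 𝓗) (v := e)
    (integrable_bilin_right μ (innerR 𝓗) hu' (continuous_opField Φ hf.isCc hu.continuous) hc)
    (integrable_bilin_right μ (innerR 𝓗) hu.continuous hc' (HasCompactSupport.lineDeriv hc h1))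
    (integrable_bilin_right μ (innerR 𝓗) hu.continuous
      (continuous_opField Φ hf.isCc hu.continuous) hc)
    (fun x _ => hasLineDerivAt_of_contDiff hu e x) (fun x _ => h1 x)
  simp only [innerR_apply, inner_add_right] at h2
  rw [integral_add (integrable_inner_opField Φ μ (hf.dir e).isCc hu.continuous hu.continuous)
    (integrable_inner_opField Φ μ hf.isCc hu.continuous hu')] at h2
  unfold pair
  linear_combination h2

/-- Weak symmetry of mixed derivatives is applied to u and to x ↦ f(x, A)u(x). The product rule puts
the derivatives of f on the right-hand side, and no second derivative of u occurs. -/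
lemma pair_lineDeriv_lineDeriv {u : X → 𝓗} (hu : ContDiff ℝ 1 u) (hus : HasCompactSupport u)
    {f : X × P → ℝ} (hf : IsTest f) (d e : X) :
    pair Φ μ (fun x => fderiv ℝ u x d) f (fun x => fderiv ℝ u x e)
        - pair Φ μ (fun x => fderiv ℝ u x e) f (fun x => fderiv ℝ u x d)
      = pair Φ μ (fun x => fderiv ℝ u x e) (dir d f) u
        - pair Φ μ (fun x => fderiv ℝ u x d) (dir e f) u := by
  have hd := continuous_fderiv_dir hu d
  have he := continuous_fderiv_dir hu e
  have h1 : ∀ e x, HasLineDerivAt ℝ (opField Φ f u)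
      (opField Φ (dir e f) u x + opField Φ f (fun x => fderiv ℝ u x e) x) x e := fun e x =>
    hasLineDerivAt_opField Φ hf (hasLineDerivAt_of_contDiff hu e x)
  have hc' : ∀ e, Continuous fun x => opField Φ (dir e f) u x
      + opField Φ f (fun x => fderiv ℝ u x e) x := fun e =>
    (continuous_opField Φ (hf.dir e).isCc hu.continuous).add
      (continuous_opField Φ hf.isCc (continuous_fderiv_dir hu e))
  have h2 := integral_bilin_lineDeriv_comm μ (innerR 𝓗) hu.continuous hd he
    (continuous_opField Φ hf.isCc hu.continuous) (hc' d) (hc' e) hus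
    (hasCompactSupport_opField Φ hf.isCc u) (hasLineDerivAt_of_contDiff hu d)
    (hasLineDerivAt_of_contDiff hu e) (h1 d) (h1 e)
  simp only [innerR_apply, inner_add_right] at h2
  rw [integral_add (integrable_inner_opField Φ μ (hf.dir e).isCc hd hu.continuous)
    (integrable_inner_opField Φ μ hf.isCc hd he),
    integral_add (integrable_inner_opField Φ μ (hf.dir d).isCc he hu.continuous)
    (integrable_inner_opField Φ μ hf.isCc he hd)] at h2
  unfold pair
  linear_combination h2

/-- The derivative `∂ₑu + iσu`: the derivative of the function `exp(iσs) u` on `X × ℝ` in the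
direction `(e, σ)`, at `s = 0`. -/
def covDeriv (e : X) (σ : ℝ) (u : X → 𝓗) (x : X) : 𝓗 := fderiv ℝ u x e + (Complex.I * σ) • u x

lemma continuous_covDeriv {u : X → 𝓗} (hu : ContDiff ℝ 1 u) (e : X) (σ : ℝ) :
    Continuous (covDeriv e σ u) :=
  (continuous_fderiv_dir hu e).add (hu.continuous.const_smul _)

lemma pair_covDeriv_left {u w : X → 𝓗} (hu : ContDiff ℝ 1 u) (hw : Continuous w)
    {f : X × P → ℝ} (hf : IsCc f) (e : X) (σ : ℝ) :
    pair Φ μ (covDeriv e σ u) f w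
      = pair Φ μ (fun x => fderiv ℝ u x e) f w - Complex.I * σ * pair Φ μ u f w := by
  have := pair_add_left Φ μ (v' := fun x => (Complex.I * σ) • u x) hf (continuous_fderiv_dir hu e)
    (hu.continuous.const_smul (Complex.I * σ)) hw
  rw [pair_smul_left] at this
  change pair Φ μ (fun x => fderiv ℝ u x e + (Complex.I * σ) • u x) f w = _
  rw [this]
  simp
  ring

lemma pair_covDeriv_right {u w : X → 𝓗} (hu : ContDiff ℝ 1 u) (hw : Continuous w)
    {f : X × P → ℝ} (hf : IsCc f) (e : X) (σ : ℝ) :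
    pair Φ μ w f (covDeriv e σ u)
      = pair Φ μ w f (fun x => fderiv ℝ u x e) + Complex.I * σ * pair Φ μ w f u := by
  have := pair_add_right Φ μ (w' := fun x => (Complex.I * σ) • u x) hf hw
    (continuous_fderiv_dir hu e) (hu.continuous.const_smul (Complex.I * σ))
  rw [pair_smul_right] at this
  exact this

/-- The phase terms enter only through ∫∂⟨u, f(A)u⟩ = 0, so the identity keeps the form it has for
plain derivatives. This expresses that the operators ∂ + iσ commute. -/
lemma pair_covDeriv_covDeriv {u : X → 𝓗} (hu : ContDiff ℝ 1 u) (hus : HasCompactSupport u)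
    {f : X × P → ℝ} (hf : IsTest f) (d e : X) (σ τ : ℝ) :
    pair Φ μ (covDeriv d σ u) f (covDeriv e τ u) - pair Φ μ (covDeriv e τ u) f (covDeriv d σ u)
      = pair Φ μ (covDeriv e τ u) (dir d f) u - pair Φ μ (covDeriv d σ u) (dir e f) u := by
  have h1 := pair_lineDeriv_lineDeriv Φ μ hu hus hf d e
  have h2 := pair_lineDeriv Φ μ hu hf d
  have h3 := pair_lineDeriv Φ μ hu hf e
  have c := hu.continuous
  rw [pair_covDeriv_left Φ μ hu (continuous_covDeriv hu _ _) hf.isCc,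
    pair_covDeriv_left Φ μ hu (continuous_covDeriv hu _ _) hf.isCc,
    pair_covDeriv_left Φ μ hu c (hf.dir _).isCc,
    pair_covDeriv_left Φ μ hu c (hf.dir _).isCc,
    pair_covDeriv_right Φ μ hu (continuous_fderiv_dir hu _) hf.isCc,
    pair_covDeriv_right Φ μ hu (continuous_fderiv_dir hu _) hf.isCc,
    pair_covDeriv_right Φ μ hu c hf.isCc, pair_covDeriv_right Φ μ hu c hf.isCc]
  linear_combination h1 + Complex.I * τ * h2 - Complex.I * σ * h3

/-- If `u` is annihilated by `Y = ∑ⱼ Yⱼ Dⱼ`, then the expectation of the commutator of `Y` with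
`K = ∑ⱼ Kⱼ Dⱼ` vanishes, for divergence-free `Y` and `K`. -/
lemma sum_pair_bracket_eq_zero {κ : Type*} [Fintype κ] (e : κ → X) (σ : κ → ℝ) {u : X → 𝓗}
    (hu : ContDiff ℝ 1 u) (hus : HasCompactSupport u) {Y K : κ → X × P → ℝ}
    (hY : ∀ j, ContDiff ℝ ∞ (Y j)) (hK : ∀ j, IsTest (K j))
    (hdivY : ∀ y, ∑ j, dir (e j) (Y j) y = 0) (hdivK : ∀ y, ∑ j, dir (e j) (K j) y = 0)
    (heq : ∀ j, ∑ k, pair Φ μ (covDeriv (e j) (σ j) u) (fun y => K j y * Y k y)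
      (covDeriv (e k) (σ k) u) = 0) :
    ∑ k, pair Φ μ (covDeriv (e k) (σ k) u)
      (fun y => ∑ j, (Y j y * dir (e j) (K k) y - K j y * dir (e j) (Y k) y)) u = 0 := by
  -- The functions KⱼYₖ are the coefficients of ⟨Ku, Yu⟩. This expression and its conjugate vanish,
  -- and their difference is computed from the symmetry of the mixed terms.
  have hW : ∀ j k, IsTest fun y => K j y * Y k y := fun j k =>
    ⟨(hK j).1.mul (hY k), (hK j).2.mul_right⟩
  have c : ∀ k, Continuous (covDeriv (e k) (σ k) u) := fun k => continuous_covDeriv hu _ _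
  have hdirW : ∀ i j k y, dir (e i) (fun y => K j y * Y k y) y
      = K j y * dir (e i) (Y k) y + Y k y * dir (e i) (K j) y := by
    intro i j k y
    unfold dir
    rw [fderiv_fun_mul (differentiable_of_smooth (hK j).1 y) (differentiable_of_smooth (hY k) y)]
    simp
  have h1 : ∀ j k, pair Φ μ (covDeriv (e j) (σ j) u) (fun y => K j y * Y k y)
        (covDeriv (e k) (σ k) u)
      - pair Φ μ (covDeriv (e k) (σ k) u) (fun y => K j y * Y k y) (covDeriv (e j) (σ j) u)
      = pair Φ μ (covDeriv (e k) (σ k) u) (dir (e j) fun y => K j y * Y k y) u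
        - pair Φ μ (covDeriv (e j) (σ j) u) (dir (e k) fun y => K j y * Y k y) u := fun j k =>
    pair_covDeriv_covDeriv Φ μ hu hus (hW j k) _ _ _ _
  have h2 : ∀ j, ∑ k, pair Φ μ (covDeriv (e k) (σ k) u) (fun y => K j y * Y k y)
      (covDeriv (e j) (σ j) u) = 0 := by
    intro j
    have := congrArg star (heq j)
    rw [star_sum, star_zero] at this
    rw [← this]
    exact Finset.sum_congr rfl fun k _ => (star_pair Φ μ (hW j k).isCc).symm
  have h3 : ∑ j, ∑ k, pair Φ μ (covDeriv (e k) (σ k) u) (dir (e j) fun y => K j y * Y k y) u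
      - ∑ j, ∑ k, pair Φ μ (covDeriv (e j) (σ j) u) (dir (e k) fun y => K j y * Y k y) u = 0 := by
    simp only [← Finset.sum_sub_distrib, ← h1]
    simp only [Finset.sum_sub_distrib, heq, h2]
    simp
  have ct : ∀ i j k, IsCc (dir (e i) fun y => K j y * Y k y) := fun i j k =>
    ((hW j k).dir _).isCc
  rw [Finset.sum_comm] at h3
  simp only [← pair_sum_mid Φ μ Finset.univ (fun j => ct _ _ _) (c _) hu.continuous] at h3
  rw [← Finset.sum_sub_distrib] at h3
  simp only [← pair_sub_mid Φ μ (IsCc.sum fun j => ct _ _ _) (IsCc.sum fun j => ct _ _ _) (c _)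
    hu.continuous] at h3
  -- The product rule produces the divergences of K and Y as additional terms; both are zero, and
  -- what remains is minus the k-th component of [Y, K].
  have h4 : ∀ k y, ∑ j, (Y j y * dir (e j) (K k) y - K j y * dir (e j) (Y k) y)
      = -(∑ j, dir (e j) (fun y => K j y * Y k y) y - ∑ j, dir (e j) (fun y => K k y * Y j y) y) := by
    intro k y
    simp only [hdirW, Finset.sum_add_distrib, Finset.sum_sub_distrib, ← Finset.mul_sum]
    rw [hdivY, hdivK]
    ring
  simp only [h4]
  rw [← neg_eq_zero, ← Finset.sum_neg_distrib, ← h3]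
  refine Finset.sum_congr rfl fun k _ => ?_
  rw [pair_neg_mid Φ μ ((IsCc.sum fun j => ct _ _ _).sub (IsCc.sum fun j => ct _ _ _)), neg_neg]

end CovariantDerivative

end HybridQC
end

open scoped Manifold ContDiff ZeroAtInfty
noncomputable section
namespace HybridQC

/-! ### Rules for derivatives along the first factor. -/

section DirAlgebra

variable {X : Type*} [NormedAddCommGroup X] [NormedSpace ℝ X]
variable {P : Type*} [NormedAddCommGroup P] [NormedSpace ℝ P]
variable {f g : X × P → ℝ}

lemma dir_add (hf : ContDiff ℝ ∞ f) (hg : ContDiff ℝ ∞ g) (v : X) :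
    dir v (fun y => f y + g y) = fun y => dir v f y + dir v g y := by
  funext y
  unfold dir
  rw [fderiv_fun_add (differentiable_of_smooth hf y) (differentiable_of_smooth hg y)]
  simp

lemma dir_sub (hf : ContDiff ℝ ∞ f) (hg : ContDiff ℝ ∞ g) (v : X) :
    dir v (fun y => f y - g y) = fun y => dir v f y - dir v g y := by
  funext y
  unfold dir
  rw [fderiv_fun_sub (differentiable_of_smooth hf y) (differentiable_of_smooth hg y)]
  simp

lemma dir_neg (v : X) : dir v (fun y => -f y) = fun y => -dir v f y := by
  funext y
  unfold dir
  rw [fderiv_fun_neg]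
  simp

lemma dir_mul (hf : ContDiff ℝ ∞ f) (hg : ContDiff ℝ ∞ g) (v : X) :
    dir v (fun y => f y * g y) = fun y => f y * dir v g y + dir v f y * g y := by
  funext y
  unfold dir
  rw [fderiv_fun_mul (differentiable_of_smooth hf y) (differentiable_of_smooth hg y)]
  simp [mul_comm]

lemma dir_const (c : ℝ) (v : X) : dir v (fun _ : X × P => c) = fun _ => 0 := by
  funext y
  simp [dir]

lemma dir_const_mul (hf : ContDiff ℝ ∞ f) (c : ℝ) (v : X) :
    dir v (fun y => c * f y) = fun y => c * dir v f y := by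
  rw [dir_mul contDiff_const hf, dir_const]
  simp

lemma dir_sum {κ : Type*} (s : Finset κ) {f : κ → X × P → ℝ} (hf : ∀ j, ContDiff ℝ ∞ (f j))
    (v : X) : dir v (fun y => ∑ j ∈ s, f j y) = fun y => ∑ j ∈ s, dir v (f j) y := by
  funext y
  unfold dir
  rw [fderiv_fun_sum fun j _ => differentiable_of_smooth (hf j) y]
  simp

lemma dir_comm (hf : ContDiff ℝ ∞ f) (v w : X) : dir v (dir w f) = dir w (dir v f) := by
  funext y
  have h1 : ∀ v : X, DifferentiableAt ℝ (fun y => fderiv ℝ f y) y := fun v =>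
    (hf.fderiv_right (m := ∞) (by simp)).differentiable (by simp) y
  have h2 : ∀ v w : X, dir v (dir w f) y = fderiv ℝ (fderiv ℝ f) y (v, 0) (w, 0) := by
    intro v w
    change fderiv ℝ (fun y => fderiv ℝ f y (w, 0)) y (v, 0) = _
    rw [fderiv_clm_apply (h1 v) (differentiableAt_const _)]
    simp
  rw [h2, h2]
  exact (hf.contDiffAt.isSymmSndFDerivAt
    (by
      rw [minSmoothness_of_isRCLikeNormedField]
      exact WithTop.coe_le_coe.2 (le_top : (2 : ℕ∞) ≤ ⊤))) _ _

lemma dir_linear (m : X →L[ℝ] ℝ) (v : X) : dir v (fun y : X × P => m y.1) = fun _ => m v := by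
  funext y
  unfold dir
  have : (fun y : X × P => m y.1) = (m.comp (ContinuousLinearMap.fst ℝ X P)) := rfl
  rw [this, ContinuousLinearMap.fderiv]
  rfl

end DirAlgebra

/-! ### Prequantum lifts, their bracket, and the weak Liouville equation. -/

section Hamiltonian

open MeasureTheory

variable {X : Type*} [NormedAddCommGroup X] [NormedSpace ℝ X]
variable {P : Type*} [NormedAddCommGroup P] [NormedSpace ℝ P] {n : ℕ}

/-- The index set of the coordinates time, phase, positions, momenta. -/
abbrev CoordIdx (n : ℕ) : Type := Unit ⊕ Unit ⊕ Fin n ⊕ Fin n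

/-- The families indexed by `CoordIdx n`. -/
def coordFamily {α : Type*} (t s : α) (q p : Fin n → α) : CoordIdx n → α :=
  Sum.elim (fun _ => t) (Sum.elim (fun _ => s) (Sum.elim q p))

lemma sum_coordIdx {M : Type*} [AddCommMonoid M] (F : CoordIdx n → M) :
    ∑ k, F k = F (.inl ()) + (F (.inr (.inl ())) +
      (∑ i, F (.inr (.inr (.inl i))) + ∑ i, F (.inr (.inr (.inr i))))) := by
  simp [Fintype.sum_sum_type]

variable (ħ : ℝ) (τ : X) (q p : Fin n → X) (m : Fin n → X →L[ℝ] ℝ) (h B : X × P → ℝ)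

/-- The lift of the Hamiltonian vector field, with the time and phase components. -/
def liftY : CoordIdx n → X × P → ℝ :=
  coordFamily (fun _ => 1) (fun y => -ħ⁻¹ * (∑ i, m i y.1 * dir (p i) h y - h y))
    (fun i => dir (p i) h) (fun i y => -dir (q i) h y)

/-- The prequantum lift of the Hamiltonian vector field of `ħ B`. -/
def liftK : CoordIdx n → X × P → ℝ :=
  coordFamily (fun _ => 0) (fun y => B y - ∑ i, m i y.1 * dir (p i) B y)
    (fun i y => ħ * dir (p i) B y) (fun i y => -(ħ * dir (q i) B y))

/-- The derivative of `B` along the Hamiltonian flow of `h`. -/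
def transportDeriv (y : X × P) : ℝ :=
  dir τ B y + ∑ i, (dir (p i) h y * dir (q i) B y - dir (q i) h y * dir (p i) B y)

/-- The coordinate directions. -/
def coordDir : CoordIdx n → X := coordFamily τ 0 q p

/-- The phase components of the coordinate directions. -/
def coordPhase (n : ℕ) : CoordIdx n → ℝ := coordFamily 0 1 0 0

variable {ħ τ q p m h B}

lemma contDiff_liftY (hh : ContDiff ℝ ∞ h) (k : CoordIdx n) :
    ContDiff ℝ ∞ (liftY ħ q p m h k) := by
  have hd := contDiff_dir hh
  rcases k with _ | _ | i | i
  · exact contDiff_const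
  · exact contDiff_const.mul ((ContDiff.sum fun i _ =>
      (((m i).contDiff.comp contDiff_fst)).mul (hd _)).sub hh)
  · exact hd _
  · exact (hd _).neg

lemma isTest_liftK (hB : IsTest B) (k : CoordIdx n) : IsTest (liftK ħ q p m B k) := by
  have hd := hB.dir
  rcases k with _ | _ | i | i
  · exact ⟨contDiff_const, HasCompactSupport.zero⟩
  · have hc : IsCc fun y => ∑ i, m i y.1 * dir (p i) B y :=
      IsCc.sum fun i => IsCc.mul_left (by fun_prop) (hd _).isCc
    exact ⟨hB.1.sub (ContDiff.sum fun i _ => (((m i).contDiff.comp contDiff_fst)).mul (hd _).1),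
      (hB.isCc.sub hc).2⟩
  · exact ⟨contDiff_const.mul (hd _).1, (hd _).2.mul_left⟩
  · exact ⟨(contDiff_const.mul (hd _).1).neg, ((hd _).2.mul_left).neg⟩

lemma isTest_transportDeriv (hh : ContDiff ℝ ∞ h) (hB : IsTest B) :
    IsTest (transportDeriv τ q p h B) := by
  have hd := hB.dir
  have hd' := contDiff_dir hh
  exact ⟨(hd _).1.add (ContDiff.sum fun i _ => ((hd' _).mul (hd _).1).sub ((hd' _).mul (hd _).1)),
    ((hd _).isCc.add (IsCc.sum fun i => (IsCc.mul_left (hd' _).continuous (hd _).isCc).sub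
      (IsCc.mul_left (hd' _).continuous (hd _).isCc))).2⟩

/-- The phase direction is zero in X and the time coefficient is constant, so the divergence
consists of mixed partials of h, which cancel in pairs. No condition on the phase coefficient is
needed. -/
lemma div_liftY (hh : ContDiff ℝ ∞ h) (y : X × P) :
    ∑ k, dir (coordDir τ q p k) (liftY ħ q p m h k) y = 0 := by
  rw [sum_coordIdx]
  simp only [coordDir, liftY, coordFamily, Sum.elim_inl, Sum.elim_inr, dir_const, dir_zero,
    Pi.zero_apply, zero_add, dir_neg]
  rw [← Finset.sum_add_distrib]
  refine Finset.sum_eq_zero fun i _ => ?_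
  rw [dir_comm hh]; ring

lemma div_liftK (hB : ContDiff ℝ ∞ B) (y : X × P) :
    ∑ k, dir (coordDir τ q p k) (liftK ħ q p m B k) y = 0 := by
  have hd := contDiff_dir hB
  rw [sum_coordIdx]
  simp only [coordDir, liftK, coordFamily, Sum.elim_inl, Sum.elim_inr, dir_const, dir_zero,
    Pi.zero_apply, zero_add, dir_neg, dir_const_mul (hd _)]
  rw [← Finset.sum_add_distrib]
  refine Finset.sum_eq_zero fun i _ => ?_
  rw [dir_comm hB]; ring

/-- Prequantization turns Poisson brackets into commutators. In the q and p components this is the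
product rule with symmetric second derivatives; in the phase component it depends on the rate of Y
being the Lagrangian, up to -ħ⁻¹. The condition `hτ` says that h is independent of time. -/
lemma bracket_lift (hħ : ħ ≠ 0) (hh : ContDiff ℝ ∞ h) (hB : ContDiff ℝ ∞ B)
    (hτ : dir τ h = fun _ => 0)
    (hmτ : ∀ i, m i τ = 0) (hmq : ∀ i j, m i (q j) = 0)
    (hmp : ∀ i j, m i (p j) = if i = j then 1 else 0) (k : CoordIdx n) (y : X × P) :
    ∑ j, (liftY ħ q p m h j y * dir (coordDir τ q p j) (liftK ħ q p m B k) y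
      - liftK ħ q p m B j y * dir (coordDir τ q p j) (liftY ħ q p m h k) y)
      = liftK ħ q p m (transportDeriv τ q p h B) k y := by
  have hd := contDiff_dir hB
  have hd' := contDiff_dir hh
  have hdd := fun v w => contDiff_dir (hd w) v
  have hdd' := fun v w => contDiff_dir (hd' w) v
  have hm : ∀ i, ContDiff ℝ ∞ fun y : X × P => m i y.1 := fun i =>
    (m i).contDiff.comp contDiff_fst
  have hmd : ∀ i v, ContDiff ℝ ∞ fun y : X × P => m i y.1 * dir v B y := fun i v =>
    (hm i).mul (hd v)
  have hmd' : ∀ i v, ContDiff ℝ ∞ fun y : X × P => m i y.1 * dir v h y := fun i v =>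
    (hm i).mul (hd' v)
  have hT : ∀ v, dir v (transportDeriv τ q p h B) = fun y => dir v (dir τ B) y
      + ∑ i, ((dir (p i) h y * dir v (dir (q i) B) y + dir v (dir (p i) h) y * dir (q i) B y)
        - (dir (q i) h y * dir v (dir (p i) B) y + dir v (dir (q i) h) y * dir (p i) B y)) := by
    intro v
    unfold transportDeriv
    rw [dir_add (hd _) (ContDiff.sum fun i _ => ((hd' _).mul (hd _)).sub ((hd' _).mul (hd _))),
      dir_sum _ (fun i => ((hd' _).mul (hd _)).sub ((hd' _).mul (hd _)))]
    simp only [dir_sub ((hd' _).mul (hd _)) ((hd' _).mul (hd _)), dir_mul (hd' _) (hd _)]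
  rw [sum_coordIdx]
  rcases k with _ | _ | k | k
  · simp only [coordDir, liftK, liftY, coordFamily, Sum.elim_inl, Sum.elim_inr, dir_const]
    simp
  · have h1 : ∀ v, dir v (fun y => B y - ∑ i, m i y.1 * dir (p i) B y) = fun y => dir v B y
        - ∑ i, (m i y.1 * dir v (dir (p i) B) y + m i v * dir (p i) B y) := by
      intro v
      rw [dir_sub hB (ContDiff.sum fun i _ => hmd i _), dir_sum _ (fun i => hmd i _)]
      simp only [dir_mul (hm _) (hd _), dir_linear]
    have h2 : ∀ v, dir v (fun y => -ħ⁻¹ * (∑ i, m i y.1 * dir (p i) h y - h y)) = fun y =>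
        -ħ⁻¹ * (∑ i, (m i y.1 * dir v (dir (p i) h) y + m i v * dir (p i) h y) - dir v h y) := by
      intro v
      rw [dir_const_mul ((ContDiff.sum fun i _ => hmd' i _).sub hh),
        dir_sub (ContDiff.sum fun i _ => hmd' i _) hh, dir_sum _ (fun i => hmd' i _)]
      simp only [dir_mul (hm _) (hd' _), dir_linear]
    simp only [coordDir, liftK, liftY, coordFamily, Sum.elim_inl, Sum.elim_inr, hT, h1, h2, dir_zero,
      hmτ, hmq, hmp, hτ]
    -- Contribution of the j-th conjugate pair to the phase component. The Kronecker terms, from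
    -- differentiating the momenta, cancel the derivatives along `p j` of the bare B and h; the
    -- remaining second-order terms assemble into the momentum derivative of the Poisson bracket.
    have key : ∀ j, dir (p j) h y * (dir (q j) B y
          - ∑ i, (m i y.1 * dir (q j) (dir (p i) B) y + 0 * dir (p i) B y))
        - ħ * dir (p j) B y * (-ħ⁻¹ * (∑ i, (m i y.1 * dir (q j) (dir (p i) h) y
          + 0 * dir (p i) h y) - dir (q j) h y))
        + (-dir (q j) h y * (dir (p j) B y - ∑ i, (m i y.1 * dir (p j) (dir (p i) B) y
          + (if i = j then 1 else 0) * dir (p i) B y))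
        - -(ħ * dir (q j) B y) * (-ħ⁻¹ * (∑ i, (m i y.1 * dir (p j) (dir (p i) h) y
          + (if i = j then 1 else 0) * dir (p i) h y) - dir (p j) h y)))
        = (dir (p j) h y * dir (q j) B y - dir (q j) h y * dir (p j) B y)
          - ∑ i, m i y.1 * ((dir (p j) h y * dir (p i) (dir (q j) B) y
            + dir (p i) (dir (p j) h) y * dir (q j) B y)
            - (dir (q j) h y * dir (p i) (dir (p j) B) y
            + dir (p i) (dir (q j) h) y * dir (p j) B y)) := by
      intro j
      have e1 : ∑ i, m i y.1 * ((dir (p j) h y * dir (p i) (dir (q j) B) y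
            + dir (p i) (dir (p j) h) y * dir (q j) B y)
            - (dir (q j) h y * dir (p i) (dir (p j) B) y
            + dir (p i) (dir (q j) h) y * dir (p j) B y))
          = dir (p j) h y * (∑ i, m i y.1 * dir (q j) (dir (p i) B) y)
            + dir (q j) B y * (∑ i, m i y.1 * dir (p j) (dir (p i) h) y)
            - dir (q j) h y * (∑ i, m i y.1 * dir (p j) (dir (p i) B) y)
            - dir (p j) B y * (∑ i, m i y.1 * dir (q j) (dir (p i) h) y) := by
        simp only [Finset.mul_sum, ← Finset.sum_add_distrib, ← Finset.sum_sub_distrib]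
        refine Finset.sum_congr rfl fun i _ => ?_
        rw [dir_comm hB (p i) (q j), dir_comm hB (p i) (p j), dir_comm hh (p i) (q j),
          dir_comm hh (p i) (p j)]
        ring
      rw [e1]
      simp only [zero_mul, add_zero, Finset.sum_add_distrib, ite_mul, one_mul,
        Finset.sum_ite_eq', Finset.mem_univ, if_true]
      field_simp
      ring
    simp only [zero_mul, one_mul, mul_zero, add_zero, sub_zero, Pi.zero_apply, zero_add, map_zero,
      Finset.sum_const_zero] at key ⊢
    rw [← Finset.sum_add_distrib]
    simp only [key]
    unfold transportDeriv
    rw [Finset.sum_sub_distrib, Finset.sum_comm]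
    simp only [mul_add (m _ _), Finset.sum_add_distrib, ← Finset.mul_sum,
      fun i => dir_comm hB (p i) τ]
    ring
  · simp only [coordDir, liftK, liftY, coordFamily, Sum.elim_inl, Sum.elim_inr, hT, dir_zero,
      dir_const_mul (hd _)]
    simp only [Pi.zero_apply, mul_zero, sub_zero, zero_mul, one_mul, zero_add]
    rw [← Finset.sum_add_distrib, dir_comm hB (p k) τ, mul_add, Finset.mul_sum]
    congr 1
    refine Finset.sum_congr rfl fun i _ => ?_
    rw [dir_comm hB (p k) (q i), dir_comm hB (p k) (p i), dir_comm hh (p k) (q i),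
      dir_comm hh (p k) (p i)]
    ring
  · simp only [coordDir, liftK, liftY, coordFamily, Sum.elim_inl, Sum.elim_inr, hT, dir_zero,
      dir_const_mul (hd _), dir_neg]
    simp only [Pi.zero_apply, mul_zero, sub_zero, zero_mul, one_mul, zero_add, neg_zero]
    rw [← Finset.sum_add_distrib, dir_comm hB (q k) τ, mul_add, neg_add, Finset.mul_sum,
      ← Finset.sum_neg_distrib]
    congr 1
    refine Finset.sum_congr rfl fun i _ => ?_
    rw [dir_comm hB (q k) (q i), dir_comm hB (q k) (p i), dir_comm hh (q k) (q i),
      dir_comm hh (q k) (p i)]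
    ring

variable [FiniteDimensional ℝ X] [MeasurableSpace X] [BorelSpace X] (μ : Measure X)
  [μ.IsAddHaarMeasure]
variable {𝓗 : Type*} [NormedAddCommGroup 𝓗] [InnerProductSpace ℂ 𝓗] [CompleteSpace 𝓗]
variable (Φ : C₀(P, ℂ) →⋆ₙₐ[ℂ] (𝓗 →L[ℂ] 𝓗))

/-- The trace of `T 𝒟`, where `𝒟` is the hybrid density operator of a wave function with value `u`
and derivatives `uq`, `up` at a point with momenta `m`. -/
def traceDensity (ħ : ℝ) (m : Fin n → ℝ) (u : 𝓗) (uq up : Fin n → 𝓗) (T : 𝓗 →L[ℂ] 𝓗) : ℂ :=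
  (1 + n) * inner ℂ u (T u) + ∑ i, m i * (inner ℂ u (T (up i)) + inner ℂ (up i) (T u))
    + Complex.I * ħ * ∑ i, (inner ℂ (up i) (T (uq i)) - inner ℂ (uq i) (T (up i)))

variable (ħ q p m) in
/-- The trace of `T 𝒟(x)` for the hybrid density operator `𝒟(x)` of the wave function `u`. -/
def traceDensityAt (u : X → 𝓗) (x : X) (T : 𝓗 →L[ℂ] 𝓗) : ℂ :=
  traceDensity ħ (fun i => m i x) (u x) (fun i => fderiv ℝ u x (q i))
    (fun i => fderiv ℝ u x (p i)) T

/-- Integrating ∂(pᵢ·) by parts cancels the n surplus copies of ⟨u, Bu⟩ and leaves B - ∑pᵢ∂B/∂pᵢ,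
the phase component of K_B. The Poisson bracket term, quadratic in derivatives of u, becomes linear
in them with coefficients the derivatives of B, the q and p components. -/
lemma integral_traceDensityAt (hmp : ∀ i j, m i (p j) = if i = j then 1 else 0)
    {u : X → 𝓗} (hu : ContDiff ℝ 1 u) (hus : HasCompactSupport u) (hB : IsTest B) :
    ∫ x, traceDensityAt ħ q p m u x (op Φ fun a => B (x, a)) ∂μ
      = Complex.I * ∑ k, pair Φ μ (covDeriv (coordDir τ q p k) (coordPhase n k) u)
          (liftK ħ q p m B k) u := by
  have hd := hB.dir
  have cu := hu.continuous
  have cv := fun v => continuous_fderiv_dir hu v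
  have hm : ∀ i, ContDiff ℝ ∞ fun y : X × P => m i y.1 := fun i =>
    (m i).contDiff.comp contDiff_fst
  have hmB : ∀ i, IsTest fun y => m i y.1 * B y := fun i => ⟨(hm i).mul hB.1, hB.2.mul_left⟩
  have hmd : ∀ i, IsCc fun y => m i y.1 * dir (p i) B y := fun i =>
    IsCc.mul_left (hm i).continuous (hd _).isCc
  have h1 : ∫ x, traceDensityAt ħ q p m u x (op Φ fun a => B (x, a)) ∂μ
      = (1 + n) * pair Φ μ u B u
        + ∑ i, (pair Φ μ u (fun y => m i y.1 * B y) (fun x => fderiv ℝ u x (p i))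
            + pair Φ μ (fun x => fderiv ℝ u x (p i)) (fun y => m i y.1 * B y) u)
        + Complex.I * ħ * ∑ i, (pair Φ μ (fun x => fderiv ℝ u x (p i)) B
            (fun x => fderiv ℝ u x (q i))
          - pair Φ μ (fun x => fderiv ℝ u x (q i)) B (fun x => fderiv ℝ u x (p i))) := by
    have hI : ∀ {v w : X → 𝓗} {f : X × P → ℝ}, IsCc f → Continuous v → Continuous w →
      Integrable (fun x => inner ℂ (v x) (op Φ (fun a => f (x, a)) (w x))) μ :=
      fun hf hv hw => integrable_inner_opField Φ μ hf hv hw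
    have hmB' : ∀ i x, op Φ (fun a => m i x * B (x, a)) = (m i x : ℂ) • op Φ fun a => B (x, a) :=
      fun i x => op_smul Φ (hB.isCc.slice x) _
    have e2 : ∀ i x, (m i x : ℂ) * (inner ℂ (u x) (op Φ (fun a => B (x, a)) (fderiv ℝ u x (p i)))
        + inner ℂ (fderiv ℝ u x (p i)) (op Φ (fun a => B (x, a)) (u x)))
        = inner ℂ (u x) (op Φ (fun a => m i x * B (x, a)) (fderiv ℝ u x (p i)))
        + inner ℂ (fderiv ℝ u x (p i)) (op Φ (fun a => m i x * B (x, a)) (u x)) := by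
      intro i x
      rw [hmB', smul_apply, smul_apply, inner_smul_right, inner_smul_right]
      ring
    have i2 : ∀ i, Integrable (fun x =>
        inner ℂ (u x) (op Φ (fun a => m i x * B (x, a)) (fderiv ℝ u x (p i)))) μ := fun i =>
      hI (f := fun y => m i y.1 * B y) (hmB i).isCc cu (cv _)
    have i2' : ∀ i, Integrable (fun x =>
        inner ℂ (fderiv ℝ u x (p i)) (op Φ (fun a => m i x * B (x, a)) (u x))) μ := fun i =>
      hI (f := fun y => m i y.1 * B y) (hmB i).isCc (cv _) cu
    have i3 := fun i => hI hB.isCc (cv (p i)) (cv (q i))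
    have i3' := fun i => hI hB.isCc (cv (q i)) (cv (p i))
    simp only [traceDensityAt, traceDensity, e2]
    rw [integral_add, integral_add, integral_const_mul, integral_const_mul,
      integral_finsetSum, integral_finsetSum]
    · simp only [pair, opField]
      congr 1
      · congr 1
        exact Finset.sum_congr rfl fun i _ => integral_add (i2 i) (i2' i)
      · congr 1
        exact Finset.sum_congr rfl fun i _ => integral_sub (i3 i) (i3' i)
    · exact fun i _ => (i3 i).sub (i3' i)
    · exact fun i _ => (i2 i).add (i2' i)
    · exact (hI hB.isCc cu cu).const_mul _
    · exact integrable_finsetSum _ fun i _ => (i2 i).add (i2' i)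
    · exact ((hI hB.isCc cu cu).const_mul _).add
        (integrable_finsetSum _ fun i _ => (i2 i).add (i2' i))
    · exact (integrable_finsetSum _ fun i _ => (i3 i).sub (i3' i)).const_mul _
  have h2 : ∀ i, pair Φ μ u (fun y => m i y.1 * B y) (fun x => fderiv ℝ u x (p i))
      + pair Φ μ (fun x => fderiv ℝ u x (p i)) (fun y => m i y.1 * B y) u
      = -pair Φ μ u B u - pair Φ μ u (fun y => m i y.1 * dir (p i) B y) u := by
    intro i
    have h3 := pair_lineDeriv Φ μ hu (hmB i) (p i)
    rw [dir_mul (hm i) hB.1, dir_linear, hmp, if_pos rfl] at h3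
    simp only [one_mul] at h3
    rw [pair_add_mid Φ μ (hmd i) hB.isCc cu cu] at h3
    linear_combination h3
  have h3 : ∀ i, pair Φ μ (fun x => fderiv ℝ u x (p i)) B (fun x => fderiv ℝ u x (q i))
      - pair Φ μ (fun x => fderiv ℝ u x (q i)) B (fun x => fderiv ℝ u x (p i))
      = pair Φ μ (fun x => fderiv ℝ u x (q i)) (dir (p i) B) u
        - pair Φ μ (fun x => fderiv ℝ u x (p i)) (dir (q i) B) u := fun i =>
    pair_lineDeriv_lineDeriv Φ μ hu hus hB (p i) (q i)
  rw [h1, sum_coordIdx]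
  simp only [h2, h3, coordDir, coordPhase, liftK, coordFamily, Sum.elim_inl, Sum.elim_inr]
  have hK0 : IsCc fun y => B y - ∑ i, m i y.1 * dir (p i) B y :=
    hB.isCc.sub (IsCc.sum hmd)
  have hKp : ∀ i, IsCc fun y => ħ * dir (p i) B y := fun i =>
    IsCc.mul_left continuous_const (hd _).isCc
  have hKq : ∀ i, IsCc fun y => ħ * dir (q i) B y := fun i =>
    IsCc.mul_left continuous_const (hd _).isCc
  rw [pair_zero_mid, pair_covDeriv_left Φ μ hu cu hK0,
    pair_sub_mid Φ μ hB.isCc (IsCc.sum hmd) cu cu, pair_sum_mid Φ μ _ hmd cu cu]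
  simp only [pair_covDeriv_left Φ μ hu cu (hKp _), pair_covDeriv_left Φ μ hu cu (hKq _).neg,
    pair_neg_mid Φ μ (hKq _), pair_smul_mid Φ μ (hd _).isCc]
  have hz : pair Φ μ (fun x => fderiv ℝ u x 0) (fun y => B y - ∑ i, m i y.1 * dir (p i) B y) u
      = 0 := by
    simp [pair]
  rw [hz]
  simp only [Pi.zero_apply, Finset.sum_sub_distrib, Finset.sum_neg_distrib,
    Finset.sum_const, Finset.card_univ, Fintype.card_fin, nsmul_eq_mul, Complex.ofReal_zero,
    Complex.ofReal_one, mul_zero, zero_mul, sub_zero, ← Finset.mul_sum]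
  have hII : Complex.I * Complex.I = -1 := Complex.I_mul_I
  linear_combination (pair Φ μ u B u - ∑ i, pair Φ μ u (fun y => m i y.1 * dir (p i) B y) u) * hII

/-- The weak form of the Liouville equation for the density of a solution of the
quantum-classical wave equation. -/
theorem integral_traceDensityAt_transportDeriv (hħ : ħ ≠ 0) (hh : ContDiff ℝ ∞ h) (hB : IsTest B)
    (hτ : dir τ h = fun _ => 0)
    (hmτ : ∀ i, m i τ = 0) (hmq : ∀ i j, m i (q j) = 0)
    (hmp : ∀ i j, m i (p j) = if i = j then 1 else 0)
    {u : X → 𝓗} (hu : ContDiff ℝ 1 u) (hus : HasCompactSupport u)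
    (heq : ∀ j x, ∑ k, opField Φ (fun y => liftK ħ q p m B j y * liftY ħ q p m h k y)
      (covDeriv (coordDir τ q p k) (coordPhase n k) u) x = 0) :
    ∫ x, traceDensityAt ħ q p m u x (op Φ fun a => transportDeriv τ q p h B (x, a)) ∂μ = 0 := by
  rw [integral_traceDensityAt (τ := τ) μ Φ hmp hu hus (isTest_transportDeriv hh hB)]
  -- The coefficients of Y need not have compact support, so Yu = 0 enters only after multiplication
  -- by the compactly supported Kⱼ, which is what the commutator argument uses.
  have key := sum_pair_bracket_eq_zero Φ μ (coordDir τ q p) (coordPhase n) hu hus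
    (contDiff_liftY (ħ := ħ) (q := q) (p := p) (m := m) hh)
    (isTest_liftK (ħ := ħ) (q := q) (p := p) (m := m) hB)
    (div_liftY hh) (div_liftK hB.1) (fun j => by
      have hc : ∀ k, IsCc fun y => liftK ħ q p m B j y * liftY ħ q p m h k y := fun k =>
        (isTest_liftK hB j).isCc.mul_right (contDiff_liftY hh k).continuous
      unfold pair
      rw [← integral_finsetSum _ fun k _ => integrable_inner_opField Φ μ (hc k)
        (continuous_covDeriv hu _ _) (continuous_covDeriv hu _ _)]
      simp only [← inner_sum, heq, inner_zero_right, integral_zero])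
  simp only [bracket_lift hħ hh hB.1 hτ hmτ hmq hmp] at key
  rw [show (fun k => pair Φ μ (covDeriv (coordDir τ q p k) (coordPhase n k) u)
    (liftK ħ q p m (transportDeriv τ q p h B) k) u) = fun k => pair Φ μ
    (covDeriv (coordDir τ q p k) (coordPhase n k) u)
    (fun y => liftK ħ q p m (transportDeriv τ q p h B) k y) u from rfl, key, mul_zero]

end Hamiltonian

end HybridQC
end

open scoped Manifold ContDiff ZeroAtInfty
noncomputable section
namespace HybridQC

/-! ### Vector-valued functions of time with a bounded weak derivative. -/

section WeakDerivative

open MeasureTheory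

variable {G : Type*} [NormedAddCommGroup G] [NormedSpace ℝ G] [CompleteSpace G]

/-- A smooth function with compact support in an interval whose derivative is the difference of two
translates of a bump function. -/
lemma exists_deriv_eq_sub_translate (φ : ContDiffBump (0 : ℝ)) {x y : ℝ} (hxy : x < y) :
    ∃ η : ℝ → ℝ, ContDiff ℝ ∞ η ∧
      (∀ t, t ∉ Set.Icc (x - φ.rOut) (y + φ.rOut) → η t = 0) ∧
      ∀ t, deriv η t = φ.normed volume (x - t) - φ.normed volume (y - t) := by
  let ψ : ℝ → ℝ := φ.normed volume
  have hψ : ContDiff ℝ ∞ ψ := φ.contDiff_normed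
  have hψc : Continuous ψ := hψ.continuous
  have hψ0 : ∀ t, φ.rOut ≤ |t| → ψ t = 0 := by
    intro t ht
    by_contra h
    have : t ∈ Function.support (φ.normed volume) := h
    rw [φ.support_normed_eq] at this
    simp only [Metric.mem_ball, dist_zero_right, Real.norm_eq_abs] at this
    linarith
  let Ψ : ℝ → ℝ := fun t => ∫ s in (0 : ℝ)..t, ψ s
  have hΨd : ∀ t, HasDerivAt Ψ (ψ t) t := fun t => hψc.integral_hasStrictDerivAt 0 t |>.hasDerivAt
  have hΨ : ContDiff ℝ ∞ Ψ := by
    rw [contDiff_infty_iff_deriv]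
    refine ⟨fun t => (hΨd t).differentiableAt, ?_⟩
    have : deriv Ψ = ψ := funext fun t => (hΨd t).deriv
    rwa [this]
  have hdiff : ∀ a b, Ψ b - Ψ a = ∫ s in a..b, ψ s := fun a b =>
    intervalIntegral.integral_interval_sub_left (hψc.intervalIntegrable _ _)
      (hψc.intervalIntegrable _ _)
  refine ⟨fun t => Ψ (y - t) - Ψ (x - t), ?_, ?_, ?_⟩
  · exact (hΨ.comp (contDiff_const.sub contDiff_id)).sub (hΨ.comp (contDiff_const.sub contDiff_id))
  · intro t ht
    beta_reduce
    rw [hdiff, intervalIntegral.integral_congr (g := fun _ => (0 : ℝ))]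
    · simp
    intro s hs
    rw [Set.uIcc_of_le (by linarith)] at hs
    apply hψ0
    rw [Set.mem_Icc, not_and_or, not_le, not_le] at ht
    rcases ht with ht | ht
    · exact le_trans (by linarith [hs.1]) (le_abs_self s)
    · exact le_trans (by linarith [hs.2]) (neg_le_abs s)
  · intro t
    have h1 : HasDerivAt (fun t => Ψ (y - t) - Ψ (x - t)) (ψ (y - t) * (-1) - ψ (x - t) * (-1)) t :=
      ((hΨd (y - t)).comp t ((hasDerivAt_id t).const_sub y)).sub
        ((hΨd (x - t)).comp t ((hasDerivAt_id t).const_sub x))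
    rw [h1.deriv]
    ring

/-- Testing with η whose derivative is a difference of two translated mollifiers shows that the
mollification of F takes the same value at x and y. Each of these is within ε/2 of F. -/
lemma eq_of_integral_deriv_smul_eq_zero {F : ℝ → G} (hF : Continuous F) {a b : ℝ}
    (h : ∀ η : ℝ → ℝ, IsTest η → tsupport η ⊆ Set.Ioo a b → ∫ t, deriv η t • F t = 0)
    {x y : ℝ} (hx : a < x) (hxy : x < y) (hy : y < b) : F x = F y := by
  refine eq_of_forall_dist_le fun ε hε => ?_
  obtain ⟨δ₁, hδ₁, h1⟩ := Metric.continuousAt_iff.1 (hF.continuousAt (x := x)) (ε / 2) (by positivity)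
  obtain ⟨δ₂, hδ₂, h2⟩ := Metric.continuousAt_iff.1 (hF.continuousAt (x := y)) (ε / 2) (by positivity)
  obtain ⟨r, hr, hr'⟩ : ∃ r > 0, r < min (min δ₁ δ₂) (min (x - a) (b - y)) :=
    exists_between (lt_min (lt_min hδ₁ hδ₂) (lt_min (by linarith) (by linarith)))
  simp only [lt_min_iff] at hr'
  let φ : ContDiffBump (0 : ℝ) := ⟨r / 2, r, by positivity, by linarith⟩
  obtain ⟨η, hη, hη0, hηd⟩ := exists_deriv_eq_sub_translate φ hxy
  have hsub : tsupport η ⊆ Set.Icc (x - r) (y + r) := by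
    refine closure_minimal (fun t ht => ?_) isClosed_Icc
    by_contra hc
    exact ht (hη0 t hc)
  have h3 := h η ⟨hη, HasCompactSupport.of_support_subset_isCompact isCompact_Icc
    (subset_closure.trans hsub)⟩ (hsub.trans fun t ht => ⟨by linarith [ht.1], by linarith [ht.2]⟩)
  have hconv : ∀ z, MeasureTheory.convolution (φ.normed volume) F
      (ContinuousLinearMap.lsmul ℝ ℝ) volume z = ∫ t, φ.normed volume (z - t) • F t := by
    intro z
    rw [MeasureTheory.convolution_eq_swap]
    simp
  have hint : ∀ z, Integrable fun t => φ.normed volume (z - t) • F t := by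
    intro z
    refine Continuous.integrable_of_hasCompactSupport ?_ ?_
    · exact (φ.continuous_normed.comp (by fun_prop)).smul hF
    · refine HasCompactSupport.smul_right ?_
      exact φ.hasCompactSupport_normed.comp_homeomorph (Homeomorph.subLeft z)
  simp only [hηd, sub_smul] at h3
  rw [integral_sub (hint x) (hint y), ← hconv, ← hconv, sub_eq_zero] at h3
  have h4 := φ.dist_normed_convolution_le (μ := volume) (x₀ := x) (ε := ε / 2)
    hF.aestronglyMeasurable
    (fun t ht => (h1 ((Metric.mem_ball.1 ht).trans hr'.1.1)).le)
  have h5 := φ.dist_normed_convolution_le (μ := volume) (x₀ := y) (ε := ε / 2)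
    hF.aestronglyMeasurable
    (fun t ht => (h2 ((Metric.mem_ball.1 ht).trans hr'.1.2)).le)
  rw [h3] at h4
  calc dist (F x) (F y) ≤ _ := dist_triangle_left _ _ _
    _ ≤ ε := by linarith

/-- A function with a bounded weak derivative is Lipschitz continuous. -/
lemma norm_sub_le_of_weak_deriv {F e : ℝ → G} {a b C : ℝ} (hab : a ≤ b)
    (hF : ContinuousOn F (Set.Icc a b)) (he : ContinuousOn e (Set.Icc a b))
    (heC : ∀ t ∈ Set.Icc a b, ‖e t‖ ≤ C)
    (h : ∀ η : ℝ → ℝ, IsTest η → tsupport η ⊆ Set.Ioo a b →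
      ∫ t, (deriv η t • F t + η t • e t) = 0) :
    ‖F b - F a‖ ≤ C * (b - a) := by
  rcases hab.eq_or_lt with rfl | hlt
  · simp
  let F₁ : ℝ → G := Set.IccExtend hab ((Set.Icc a b).domRestrict F)
  let e₁ : ℝ → G := Set.IccExtend hab ((Set.Icc a b).domRestrict e)
  have hF₁ : Continuous F₁ := hF.domRestrict.Icc_extend'
  have he₁ : Continuous e₁ := he.domRestrict.Icc_extend'
  have hFe : ∀ t ∈ Set.Icc a b, F₁ t = F t := fun t ht => Set.IccExtend_of_mem hab _ ht
  have hee : ∀ t ∈ Set.Icc a b, e₁ t = e t := fun t ht => Set.IccExtend_of_mem hab _ ht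
  -- A primitive of the weak derivative. The difference F₁ - S has vanishing weak derivative, so it
  -- is constant on the open interval and, by continuity, up to the end points.
  let S : ℝ → G := fun t => ∫ s in a..t, e₁ s
  have hS : ∀ t, HasDerivAt S (e₁ t) t := fun t =>
    (he₁.integral_hasStrictDerivAt a t).hasDerivAt
  have hSc : Continuous S := continuous_iff_continuousAt.2 fun t => (hS t).continuousAt
  have key : ∀ η : ℝ → ℝ, IsTest η → tsupport η ⊆ Set.Ioo a b →
      ∫ t, deriv η t • (F₁ t - S t) = 0 := by
    intro η hη hsub
    have hηd : ∀ t, HasDerivAt η (deriv η t) t := fun t =>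
      (differentiable_of_smooth hη.1 t).hasDerivAt
    have hη'c : Continuous (deriv η) := hη.1.continuous_deriv (by simp)
    have hη's : HasCompactSupport (deriv η) := hη.2.deriv
    have i1 : ∀ {f : ℝ → G}, Continuous f → Integrable fun t => deriv η t • f t := fun hf =>
      Continuous.integrable_of_hasCompactSupport (hη'c.smul hf) hη's.smul_right
    have i2 : ∀ {f : ℝ → G}, Continuous f → Integrable fun t => η t • f t := fun hf =>
      Continuous.integrable_of_hasCompactSupport (hη.1.continuous.smul hf) hη.2.smul_right
    have h1 : ∫ t, η t • e₁ t = -∫ t, deriv η t • S t :=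
      integral_bilinear_hasDerivAt_right_eq_neg_left_of_integrable
        (L := ContinuousLinearMap.lsmul ℝ ℝ) (fun t _ => hηd t) (fun t _ => hS t)
        (i2 he₁) (i1 hSc) (i2 hSc)
    have h2 : ∀ t, deriv η t • F t + η t • e t = deriv η t • F₁ t + η t • e₁ t := by
      intro t
      by_cases ht : t ∈ tsupport η
      · have := Set.Ioo_subset_Icc_self (hsub ht)
        rw [hFe t this, hee t this]
      · rw [image_eq_zero_of_notMem_tsupport ht, show deriv η t = 0 from by_contra fun hc => ht (support_deriv_subset hc)]
        simp
    have h3 := h η hη hsub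
    simp only [h2] at h3
    rw [integral_add (i1 hF₁) (i2 he₁), h1] at h3
    simp only [smul_sub]
    rw [integral_sub (i1 hF₁) (i1 hSc)]
    rwa [← sub_eq_add_neg] at h3
  have hD : Continuous fun t => F₁ t - S t := hF₁.sub hSc
  have hconst : ∀ x ∈ Set.Ioo a b, F₁ x - S x = F₁ ((a + b) / 2) - S ((a + b) / 2) := by
    intro x hx
    rcases lt_trichotomy x ((a + b) / 2) with hlt' | heq | hgt
    · exact eq_of_integral_deriv_smul_eq_zero hD key hx.1 hlt' (by linarith)
    · rw [heq]
    · exact (eq_of_integral_deriv_smul_eq_zero hD key (by linarith) hgt hx.2).symm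
  have hconst' : ∀ x ∈ Set.Icc a b, F₁ x - S x = F₁ ((a + b) / 2) - S ((a + b) / 2) := by
    have hcl : IsClosed {x | F₁ x - S x = F₁ ((a + b) / 2) - S ((a + b) / 2)} :=
      isClosed_eq hD continuous_const
    rw [← closure_Ioo hlt.ne]
    exact closure_minimal hconst hcl
  have h1 := (hconst' b (Set.right_mem_Icc.2 hab)).trans
    (hconst' a (Set.left_mem_Icc.2 hab)).symm
  have hSa : S a = 0 := intervalIntegral.integral_same
  rw [hFe b (Set.right_mem_Icc.2 hab), hFe a (Set.left_mem_Icc.2 hab), hSa, sub_zero,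
    sub_eq_iff_eq_add] at h1
  rw [h1, add_sub_cancel_left]
  have h2 := intervalIntegral.norm_integral_le_of_norm_le_const (a := a) (b := b) (f := e₁) (C := C)
    (fun t ht => by
      rw [Set.uIoc_of_le hab] at ht
      rw [hee t (Set.Ioc_subset_Icc_self ht)]
      exact heC t (Set.Ioc_subset_Icc_self ht))
  rwa [abs_of_nonneg (by linarith)] at h2

end WeakDerivative

end HybridQC
end

open scoped Manifold ContDiff ZeroAtInfty
noncomputable section
namespace HybridQC

/-! ### Linearity and boundedness of T ↦ Tr(T𝒟). -/

section TraceDensity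

variable {n : ℕ} {𝓗 : Type*} [NormedAddCommGroup 𝓗] [InnerProductSpace ℂ 𝓗]

lemma traceDensity_add (ħ : ℝ) (m : Fin n → ℝ) (u : 𝓗) (uq up : Fin n → 𝓗) (S T : 𝓗 →L[ℂ] 𝓗) :
    traceDensity ħ m u uq up (S + T) = traceDensity ħ m u uq up S + traceDensity ħ m u uq up T := by
  simp only [traceDensity, add_apply, inner_add_right]
  have h1 : ∀ i, (m i : ℂ) * (inner ℂ u (S (up i)) + inner ℂ u (T (up i))
      + (inner ℂ (up i) (S u) + inner ℂ (up i) (T u)))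
      = m i * (inner ℂ u (S (up i)) + inner ℂ (up i) (S u))
        + m i * (inner ℂ u (T (up i)) + inner ℂ (up i) (T u)) := fun i => by ring
  have h2 : ∀ i, inner ℂ (up i) (S (uq i)) + inner ℂ (up i) (T (uq i))
      - (inner ℂ (uq i) (S (up i)) + inner ℂ (uq i) (T (up i)))
      = (inner ℂ (up i) (S (uq i)) - inner ℂ (uq i) (S (up i)))
        + (inner ℂ (up i) (T (uq i)) - inner ℂ (uq i) (T (up i))) := fun i => by ring
  simp only [h1, h2, Finset.sum_add_distrib]
  ring

lemma traceDensity_smul (ħ : ℝ) (m : Fin n → ℝ) (u : 𝓗) (uq up : Fin n → 𝓗) (c : ℂ)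
    (T : 𝓗 →L[ℂ] 𝓗) :
    traceDensity ħ m u uq up (c • T) = c * traceDensity ħ m u uq up T := by
  simp only [traceDensity, smul_apply, inner_smul_right, ← mul_add, ← mul_sub, mul_left_comm _ c,
    ← Finset.mul_sum]

lemma traceDensity_zero (ħ : ℝ) (m : Fin n → ℝ) (u : 𝓗) (uq up : Fin n → 𝓗) :
    traceDensity ħ m u uq up (0 : 𝓗 →L[ℂ] 𝓗) = 0 := by
  simp [traceDensity]

/-- A bound for the functional `traceDensity`. -/
def traceDensityBound (ħ : ℝ) (m : Fin n → ℝ) (u : 𝓗) (uq up : Fin n → 𝓗) : ℝ :=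
  (1 + n) * (‖u‖ * ‖u‖) + ∑ i, |m i| * (2 * (‖u‖ * ‖up i‖)) + |ħ| * ∑ i, 2 * (‖up i‖ * ‖uq i‖)

lemma norm_traceDensity_le (ħ : ℝ) (m : Fin n → ℝ) (u : 𝓗) (uq up : Fin n → 𝓗)
    (T : 𝓗 →L[ℂ] 𝓗) :
    ‖traceDensity ħ m u uq up T‖ ≤ traceDensityBound ħ m u uq up * ‖T‖ := by
  have h0 : ∀ v w : 𝓗, ‖inner ℂ v (T w)‖ ≤ ‖v‖ * ‖w‖ * ‖T‖ := fun v w =>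
    (norm_inner_le_norm _ _).trans (by
      calc ‖v‖ * ‖T w‖ ≤ ‖v‖ * (‖T‖ * ‖w‖) := by gcongr; exact T.le_opNorm w
        _ = _ := by ring)
  unfold traceDensity traceDensityBound
  refine (norm_add₃_le).trans ?_
  rw [add_mul ((1 + (n : ℝ)) * (‖u‖ * ‖u‖) + _), add_mul ((1 + (n : ℝ)) * (‖u‖ * ‖u‖))]
  refine add_le_add (add_le_add ?_ ?_) ?_
  · rw [norm_mul]
    have : ‖(1 + n : ℂ)‖ = 1 + n := by
      have h := Complex.norm_natCast (1 + n)
      push_cast at h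
      exact h
    rw [this, mul_assoc]
    gcongr
    exact h0 _ _
  · rw [Finset.sum_mul]
    refine (norm_sum_le _ _).trans (Finset.sum_le_sum fun i _ => ?_)
    rw [norm_mul, Complex.norm_real, Real.norm_eq_abs, mul_assoc]
    gcongr
    refine (norm_add_le _ _).trans ?_
    have h1 := h0 u (up i)
    have h2 := h0 (up i) u
    linarith
  · rw [norm_mul, norm_mul, Complex.norm_I, Complex.norm_real, Real.norm_eq_abs, one_mul, mul_assoc,
      Finset.sum_mul]
    gcongr
    refine (norm_sum_le _ _).trans (Finset.sum_le_sum fun i _ => ?_)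
    refine (norm_sub_le _ _).trans ?_
    have h1 := h0 (up i) (uq i)
    have h2 := h0 (uq i) (up i)
    linarith

end TraceDensity

/-! ### Local solutions in canonical coordinates and their Liouville equation. -/

section Local

open MeasureTheory

variable {E : Type*} [NormedAddCommGroup E] [NormedSpace ℝ E]
variable {P : Type*} [NormedAddCommGroup P] [NormedSpace ℝ P] {n : ℕ}
variable {𝓗 : Type*} [NormedAddCommGroup 𝓗] [InnerProductSpace ℂ 𝓗] [CompleteSpace 𝓗]

/-- `v` is a solution of the quantum-classical wave equation on the open set `O` of a canonical
coordinate space, localized in the spectral representation to the open set `V`. -/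
structure IsLocalSolution (ħ : ℝ) (q p : Fin n → E) (m : Fin n → E →L[ℝ] ℝ)
    (Φ : C₀(P, ℂ) →⋆ₙₐ[ℂ] (𝓗 →L[ℂ] 𝓗)) (h : E × P → ℝ) (O : Set E) (V : Set P) (J : Set ℝ)
    (v : ℝ → E → 𝓗) : Prop where
  isOpen_left : IsOpen O
  isOpen_right : IsOpen V
  uniqueDiffOn : UniqueDiffOn ℝ J
  contDiff : ContDiff ℝ ∞ h
  contDiffOn : ContDiffOn ℝ 1 (fun x : ℝ × E => v x.1 x.2) (J ×ˢ O)
  wave : ∀ t ∈ J, ∀ z ∈ O, ∃ vt : 𝓗, HasDerivWithinAt (fun s => v s z) vt J t ∧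
    ∀ g : P → ℝ, IsCc g → tsupport g ⊆ V →
      op Φ g vt
        + (op Φ (fun a => g a * (-ħ⁻¹ * (∑ i, m i z * dir (p i) h (z, a) - h (z, a))))
            (Complex.I • v t z)
          + (∑ i, op Φ (fun a => g a * dir (p i) h (z, a)) (fderiv ℝ (v t) z (q i))
            + ∑ i, op Φ (fun a => g a * -dir (q i) h (z, a)) (fderiv ℝ (v t) z (p i)))) = 0

variable {ħ : ℝ} {q p : Fin n → E} {m : Fin n → E →L[ℝ] ℝ}
  {Φ : C₀(P, ℂ) →⋆ₙₐ[ℂ] (𝓗 →L[ℂ] 𝓗)} {h : E × P → ℝ} {O : Set E} {V : Set P} {J : Set ℝ}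
  {v : ℝ → E → 𝓗}

namespace IsLocalSolution

lemma hasFDerivAt (hv : IsLocalSolution ħ q p m Φ h O V J v) {t : ℝ} (ht : t ∈ J) {z : E}
    (hz : z ∈ O) :
    HasFDerivAt (v t) ((fderivWithin ℝ (fun x : ℝ × E => v x.1 x.2) (J ×ˢ O) (t, z)).comp
      (ContinuousLinearMap.inr ℝ ℝ E)) z := by
  have h1 : HasFDerivWithinAt (fun x : ℝ × E => v x.1 x.2) _ (J ×ˢ O) (t, z) :=
    ((hv.contDiffOn.differentiableOn (by simp)) (t, z) ⟨ht, hz⟩).hasFDerivWithinAt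
  have h2 : HasFDerivWithinAt (fun z : E => (t, z)) (ContinuousLinearMap.inr ℝ ℝ E) O z :=
    (hasFDerivAt_prodMk_right t z).hasFDerivWithinAt
  exact (h1.comp z h2 fun w hw => ⟨ht, hw⟩).hasFDerivAt (hv.isOpen_left.mem_nhds hz)

lemma continuousOn (hv : IsLocalSolution ħ q p m Φ h O V J v) :
    ContinuousOn (fun x : ℝ × E => v x.1 x.2) (J ×ˢ O) := hv.contDiffOn.continuousOn

lemma continuousOn_fderiv (hv : IsLocalSolution ħ q p m Φ h O V J v) (w : E) :
    ContinuousOn (fun x : ℝ × E => fderiv ℝ (v x.1) x.2 w) (J ×ˢ O) := by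
  have h1 := hv.contDiffOn.continuousOn_fderivWithin
    (hv.uniqueDiffOn.prod hv.isOpen_left.uniqueDiffOn) (by simp)
  have h2 : ContinuousOn (fun x : ℝ × E =>
      fderivWithin ℝ (fun x : ℝ × E => v x.1 x.2) (J ×ˢ O) x (0, w)) (J ×ˢ O) :=
    h1.clm_apply continuousOn_const
  refine h2.congr fun x hx => ?_
  rw [(hv.hasFDerivAt hx.1 hx.2).fderiv]
  rfl

lemma fderiv_of_mem_interior (hv : IsLocalSolution ħ q p m Φ h O V J v) {x : ℝ × E}
    (ht : x.1 ∈ interior J) (hz : x.2 ∈ O) :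
    (∀ w, fderiv ℝ (fun x : ℝ × E => v x.1 x.2) x (0, w) = fderiv ℝ (v x.1) x.2 w) ∧
    ∀ vt, HasDerivWithinAt (fun s => v s x.2) vt J x.1 →
      fderiv ℝ (fun x : ℝ × E => v x.1 x.2) x (1, 0) = vt := by
  have hd : HasFDerivAt (fun x : ℝ × E => v x.1 x.2) _ x :=
    ((hv.contDiffOn.differentiableOn (by simp)) x ⟨interior_subset ht, hz⟩).differentiableAt
      (prod_mem_nhds (mem_interior_iff_mem_nhds.1 ht) (hv.isOpen_left.mem_nhds hz)) |>.hasFDerivAt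
  constructor
  · intro w
    have h2 : HasFDerivAt (fun z : E => (x.1, z)) (ContinuousLinearMap.inr ℝ ℝ E) x.2 :=
      hasFDerivAt_prodMk_right x.1 x.2
    have h3 := HasFDerivAt.comp x.2 (g := fun x : ℝ × E => v x.1 x.2) (by simpa using hd) h2
    have h4 : fderiv ℝ (v x.1) x.2 = _ := h3.fderiv
    rw [h4]; rfl
  · intro vt hvt
    have h2 : HasFDerivAt (fun s : ℝ => (s, x.2)) (ContinuousLinearMap.inl ℝ ℝ E) x.1 :=
      hasFDerivAt_prodMk_left x.1 x.2
    have h3 := HasFDerivAt.comp x.1 (g := fun x : ℝ × E => v x.1 x.2) (by simpa using hd) h2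
    have h4 := h3.hasDerivAt.unique (hvt.hasDerivAt (mem_interior_iff_mem_nhds.1 ht))
    rw [← h4]; rfl

end IsLocalSolution

lemma exists_cutoff {X : Type*} [NormedAddCommGroup X] [NormedSpace ℝ X] [FiniteDimensional ℝ X]
    {K U : Set X} (hK : IsCompact K) (hU : IsOpen U) (hKU : K ⊆ U) :
    ∃ κ : X → ℝ, IsTest κ ∧ tsupport κ ⊆ U ∧ (∀ x ∈ K, κ =ᶠ[nhds x] 1) ∧
      ∀ x, κ x ∈ Set.Icc (0 : ℝ) 1 := by
  obtain ⟨L, hL, hKL, hLU⟩ := exists_compact_between hK hU hKU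
  obtain ⟨κ, h1, h2, h3⟩ := exists_contMDiffMap_one_nhds_of_subset_interior (n := (⊤ : ℕ∞)) 𝓘(ℝ, X)
    hK.isClosed hKL
  have hsupp : Function.support κ ⊆ L := fun x hx => by_contra fun hc => hx (h2 x hc)
  refine ⟨κ, ⟨κ.contMDiff.contDiff, HasCompactSupport.of_support_subset_isCompact hL hsupp⟩,
    (closure_minimal hsupp hL.isClosed).trans hLU, fun x hx => ?_, h3⟩
  exact (Filter.Eventually.filter_mono (nhds_le_nhdsSet hx) h1)

lemma dir_lift {h : E × P → ℝ} (hh : ContDiff ℝ ∞ h) (w : ℝ × E) (y : (ℝ × E) × P) :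
    dir w (fun y : (ℝ × E) × P => h (y.1.2, y.2)) y = dir w.2 h (y.1.2, y.2) := by
  unfold dir
  have h1 : HasFDerivAt (fun y : (ℝ × E) × P => (y.1.2, y.2))
      (((ContinuousLinearMap.snd ℝ ℝ E).comp (ContinuousLinearMap.fst ℝ (ℝ × E) P)).prod
        (ContinuousLinearMap.snd ℝ (ℝ × E) P)) y :=
    ContinuousLinearMap.hasFDerivAt
      (((ContinuousLinearMap.snd ℝ ℝ E).comp (ContinuousLinearMap.fst ℝ (ℝ × E) P)).prod
        (ContinuousLinearMap.snd ℝ (ℝ × E) P))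
  have h2 := HasFDerivAt.comp y ((differentiable_of_smooth hh) (y.1.2, y.2)).hasFDerivAt h1
  have h3 : fderiv ℝ (fun y : (ℝ × E) × P => h (y.1.2, y.2)) y = _ := h2.fderiv
  rw [h3]; rfl

variable (q p h) in
/-- The derivative of a function on the extended phase space along the Hamiltonian flow. -/
def flowDeriv (B : (ℝ × E) × P → ℝ) : (ℝ × E) × P → ℝ :=
  transportDeriv ((1, 0) : ℝ × E) (fun i => (0, q i)) (fun i => (0, p i))
    (fun y => h (y.1.2, y.2)) B

lemma flowDeriv_apply (hh : ContDiff ℝ ∞ h) (B : (ℝ × E) × P → ℝ) (y : (ℝ × E) × P) :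
    flowDeriv q p h B y = dir (1, 0) B y + ∑ i, (dir (p i) h (y.1.2, y.2) * dir (0, q i) B y
      - dir (q i) h (y.1.2, y.2) * dir (0, p i) B y) := by
  simp only [flowDeriv, transportDeriv, dir_lift hh]

lemma dir_eq_zero_of_notMem {X : Type*} [NormedAddCommGroup X] [NormedSpace ℝ X]
    {B : X × P → ℝ} {y : X × P} (hy : y ∉ tsupport B) (w : X) : dir w B y = 0 := by
  have : fderiv ℝ B y = 0 := by
    by_contra hc
    exact hy (support_fderiv_subset ℝ hc)
  simp [dir, this]

lemma flowDeriv_eq_zero_of_notMem (hh : ContDiff ℝ ∞ h) {B : (ℝ × E) × P → ℝ}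
    {y : (ℝ × E) × P} (hy : y ∉ tsupport B) : flowDeriv q p h B y = 0 := by
  simp [flowDeriv_apply hh, dir_eq_zero_of_notMem hy]

variable [FiniteDimensional ℝ E] [MeasurableSpace E] [BorelSpace E] (μ : Measure E)
  [μ.IsAddHaarMeasure]

/-- The global identity is used on space-time ℝ × E with time direction (1, 0). It requires a
compactly supported C¹ function on all of it, so v is multiplied by a cutoff equal to 1 near the
projection of the support of B, where alone the integrand can be nonzero. -/
theorem IsLocalSolution.integral_traceDensityAt_flowDeriv
    (hv : IsLocalSolution ħ q p m Φ h O V J v) (hħ : ħ ≠ 0)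
    (hmq : ∀ i j, m i (q j) = 0) (hmp : ∀ i j, m i (p j) = if i = j then 1 else 0)
    {B : (ℝ × E) × P → ℝ} (hB : IsTest B) (hBs : tsupport B ⊆ (interior J ×ˢ O) ×ˢ V) :
    ∫ x : ℝ × E, traceDensityAt ħ q p m (v x.1) x.2
      (op Φ fun a => flowDeriv q p h B (x, a)) ∂(volume.prod μ) = 0 := by
  let K : Set (ℝ × E) := Prod.fst '' tsupport B
  have hK : IsCompact K := hB.2.isCompact.image continuous_fst
  have hKU : K ⊆ interior J ×ˢ O := by
    rintro _ ⟨y, hy, rfl⟩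
    exact (hBs hy).1
  have hU : IsOpen (interior J ×ˢ O) := isOpen_interior.prod hv.isOpen_left
  obtain ⟨κ, hκ, hκs, hκ1, -⟩ := exists_cutoff hK hU hKU
  let u : ℝ × E → 𝓗 := fun x => κ x • v x.1 x.2
  have hvd : ∀ x ∈ interior J ×ˢ O, ContDiffAt ℝ 1 (fun x : ℝ × E => v x.1 x.2) x :=
    fun x hx => hv.contDiffOn.contDiffAt
      (prod_mem_nhds (mem_interior_iff_mem_nhds.1 hx.1) (hv.isOpen_left.mem_nhds hx.2))
  have hus : HasCompactSupport u := hκ.2.smul_right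
  have hu : ContDiff ℝ 1 u := by
    rw [contDiff_iff_contDiffAt]
    intro x
    by_cases hx : x ∈ tsupport κ
    · exact ((hκ.1.of_le (by simp)).contDiffAt).smul (hvd x (hκs hx))
    · have : u =ᶠ[nhds x] fun _ => 0 := by
        filter_upwards [notMem_tsupport_iff_eventuallyEq.1 hx] with y hy
        simp [u, hy]
      exact contDiffAt_const.congr_of_eventuallyEq this
  have huv : ∀ x ∈ K, u =ᶠ[nhds x] fun x => v x.1 x.2 := by
    intro x hx
    filter_upwards [hκ1 x hx] with y hy
    simp [u, hy]
  have hslice : ∀ {F : (ℝ × E) × P → ℝ}, (∀ y, y ∉ tsupport B → F y = 0) → ∀ x ∉ K,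
      (fun a => F (x, a)) = fun _ => 0 := by
    intro F hF x hx
    funext a
    exact hF _ fun hc => hx ⟨(x, a), hc, rfl⟩
  let q' : Fin n → ℝ × E := fun i => (0, q i)
  let p' : Fin n → ℝ × E := fun i => (0, p i)
  let m' : Fin n → ℝ × E →L[ℝ] ℝ := fun i => (m i).comp (ContinuousLinearMap.snd ℝ ℝ E)
  let h' : (ℝ × E) × P → ℝ := fun y => h (y.1.2, y.2)
  have hh' : ContDiff ℝ ∞ h' := hv.contDiff.comp (by fun_prop)
  have hK0 : ∀ j y, y ∉ tsupport B → liftK ħ q' p' m' B j y = 0 := by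
    intro j y hy
    have hB0 := image_eq_zero_of_notMem_tsupport hy
    rcases j with _ | _ | j | j <;>
    simp [liftK, coordFamily, dir_eq_zero_of_notMem hy, hB0]
  have key := integral_traceDensityAt_transportDeriv (ħ := ħ) (τ := ((1, 0) : ℝ × E)) (q := q')
    (p := p') (m := m') (h := h') (B := B) (volume.prod μ) Φ hħ hh' hB
    (by funext y; rw [dir_lift hv.contDiff]; simp [dir_zero])
    (fun i => by simp [m']) (fun i j => by simpa [m', q'] using hmq i j)
    (fun i j => by simpa [m', p'] using hmp i j) hu hus (by
      intro j x
      by_cases hx : x ∈ K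
      · obtain ⟨hd0, hd1⟩ := hv.fderiv_of_mem_interior (hKU hx).1 (hKU hx).2
        obtain ⟨vt, hvt, hw⟩ := hv.wave x.1 (interior_subset (hKU hx).1) x.2 (hKU hx).2
        have hg := (isTest_liftK (ħ := ħ) (q := q') (p := p') (m := m') hB j).isCc.slice x
        have hw1 := hw (fun a => liftK ħ q' p' m' B j (x, a)) hg (by
          have hcl : IsClosed {a : P | (x, a) ∈ tsupport B} :=
            (isClosed_tsupport B).preimage (by fun_prop)
          have hsub : tsupport (fun a => liftK ħ q' p' m' B j (x, a)) ⊆ {a | (x, a) ∈ tsupport B} :=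
            closure_minimal (fun a ha => by_contra fun hc => ha (hK0 j _ hc)) hcl
          exact fun a ha => (hBs (hsub ha)).2)
        have hux : u x = v x.1 x.2 := (huv x hx).self_of_nhds
        have hfx : fderiv ℝ u x = fderiv ℝ (fun x : ℝ × E => v x.1 x.2) x := (huv x hx).fderiv_eq
        rw [sum_coordIdx]
        simp only [opField, covDeriv, hfx, hux, coordDir, coordPhase, liftY, coordFamily,
          Sum.elim_inl, Sum.elim_inr, h', dir_lift hv.contDiff, q', p', hd0, hd1 vt hvt]
        simpa [m'] using hw1
      · refine Finset.sum_eq_zero fun k _ => ?_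
        have := hslice (F := fun y => liftK ħ q' p' m' B j y * liftY ħ q' p' m' h' k y)
          (fun y hy => by simp [hK0 j y hy]) x hx
        rw [opField, this, op_zero]
        rfl)
  rw [← key]
  congr 1
  funext x
  by_cases hx : x ∈ K
  · obtain ⟨hd0, -⟩ := hv.fderiv_of_mem_interior (hKU hx).1 (hKU hx).2
    have hux : u x = v x.1 x.2 := (huv x hx).self_of_nhds
    have hfx : fderiv ℝ u x = fderiv ℝ (fun x : ℝ × E => v x.1 x.2) x := (huv x hx).fderiv_eq
    simp only [traceDensityAt, hux, hfx, q', p', hd0, m', h']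
    rfl
  · have h1 := hslice (F := flowDeriv q p h B)
      (fun y hy => flowDeriv_eq_zero_of_notMem hv.contDiff hy) x hx
    have h2 : (fun a => transportDeriv ((1, 0) : ℝ × E) q' p' h' B (x, a)) = fun _ => 0 := h1
    rw [h1, h2, op_zero]
    simp [traceDensityAt, traceDensity_zero]

end Local

end HybridQC
end

open scoped Manifold ContDiff ZeroAtInfty
noncomputable section
namespace HybridQC

/-! ### Change in time of the density integrated against a moving test function. -/

section Slab

open MeasureTheory

variable {E : Type*} [NormedAddCommGroup E] [NormedSpace ℝ E]
variable {P : Type*} [NormedAddCommGroup P] [NormedSpace ℝ P] {n : ℕ}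
variable {𝓗 : Type*} [NormedAddCommGroup 𝓗] [InnerProductSpace ℂ 𝓗] [CompleteSpace 𝓗]
variable {ħ : ℝ} {q p : Fin n → E} {m : Fin n → E →L[ℝ] ℝ}
  {Φ : C₀(P, ℂ) →⋆ₙₐ[ℂ] (𝓗 →L[ℂ] 𝓗)} {h : E × P → ℝ} {O : Set E} {V : Set P} {J : Set ℝ}
  {v : ℝ → E → 𝓗}

namespace IsLocalSolution

lemma continuousOn_traceDensityAt (hv : IsLocalSolution ħ q p m Φ h O V J v)
    {F : (ℝ × E) × P → ℝ} (hF : IsCc F) :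
    ContinuousOn (fun x : ℝ × E => traceDensityAt ħ q p m (v x.1) x.2
      (op Φ fun a => F (x, a))) (J ×ˢ O) := by
  have h0 := hv.continuousOn
  have h1 := hv.continuousOn_fderiv
  have hG : ContinuousOn (fun x : ℝ × E => calculusL Φ (toC0 fun a => F (x, a))) (J ×ˢ O) :=
    ((calculusL Φ).continuous.comp (continuous_toC0_slice hF)).continuousOn
  have hI : ∀ {f g : ℝ × E → 𝓗}, ContinuousOn f (J ×ˢ O) → ContinuousOn g (J ×ˢ O) →
      ContinuousOn (fun x => inner ℂ (f x) (op Φ (fun a => F (x, a)) (g x))) (J ×ˢ O) :=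
    fun hf hg => hf.inner (𝕜 := ℂ) (hG.clm_apply hg)
  unfold traceDensityAt traceDensity
  refine ((continuousOn_const.mul (hI h0 h0)).add (continuousOn_finsetSum _ fun i _ => ?_)).add
    (continuousOn_const.mul (continuousOn_finsetSum _ fun i _ => ?_))
  · refine ContinuousOn.mul ?_ ((hI h0 (h1 _)).add (hI (h1 _) h0))
    exact (Complex.continuous_ofReal.comp ((m i).continuous.comp continuous_snd)).continuousOn
  · exact (hI (h1 _) (h1 _)).sub (hI (h1 _) (h1 _))

lemma continuousOn_traceDensityAt_of_support (hv : IsLocalSolution ħ q p m Φ h O V J v)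
    {F : (ℝ × E) × P → ℝ} (hF : IsCc F) {T : Set ℝ} (hT : T ⊆ J) {K : Set E} (hK : IsClosed K)
    (hKO : K ⊆ O) (hFK : ∀ t ∈ T, ∀ z ∉ K, ∀ a, F ((t, z), a) = 0) :
    ContinuousOn (fun x : ℝ × E => traceDensityAt ħ q p m (v x.1) x.2
      (op Φ fun a => F (x, a))) (T ×ˢ Set.univ) := by
  rintro ⟨t, z⟩ ⟨ht, -⟩
  by_cases hz : z ∈ O
  · have h1 := (hv.continuousOn_traceDensityAt hF).mono (Set.prod_mono hT subset_rfl) (t, z) ⟨ht, hz⟩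
    refine h1.mono_of_mem_nhdsWithin ?_
    rw [nhdsWithin_prod_eq, nhdsWithin_univ]
    exact Filter.prod_mem_prod self_mem_nhdsWithin (hv.isOpen_left.mem_nhds hz)
  · have hz' : z ∈ Kᶜ := fun hc => hz (hKO hc)
    have h0 : ∀ x ∈ T ×ˢ Kᶜ, traceDensityAt ħ q p m (v x.1) x.2 (op Φ fun a => F (x, a)) = 0 := by
      rintro ⟨s, w⟩ ⟨hs, hw⟩
      have : (fun a => F ((s, w), a)) = fun _ => 0 := funext fun a => hFK s hs w hw a
      rw [this, op_zero]
      exact traceDensity_zero _ _ _ _ _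
    have h1 : ContinuousWithinAt (fun x : ℝ × E => traceDensityAt ħ q p m (v x.1) x.2
        (op Φ fun a => F (x, a))) (T ×ˢ Kᶜ) (t, z) :=
      (continuousWithinAt_const (b := (0 : ℂ))).congr h0 (h0 _ ⟨ht, hz'⟩)
    refine h1.mono_of_mem_nhdsWithin ?_
    rw [nhdsWithin_prod_eq, nhdsWithin_univ]
    exact Filter.prod_mem_prod self_mem_nhdsWithin (hK.isOpen_compl.mem_nhds hz')

end IsLocalSolution

lemma flowDeriv_mul (hh : ContDiff ℝ ∞ h) {χ : (ℝ × E) × P → ℝ} (hχ : ContDiff ℝ ∞ χ) {η : ℝ → ℝ}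
    (hη : ContDiff ℝ ∞ η) (y : (ℝ × E) × P) :
    flowDeriv q p h (fun y => η y.1.1 * χ y) y
      = deriv η y.1.1 * χ y + η y.1.1 * flowDeriv q p h χ y := by
  have hη' : ContDiff ℝ ∞ fun y : (ℝ × E) × P => η y.1.1 := hη.comp (by fun_prop)
  have h1 : ∀ w : ℝ × E, dir w (fun y : (ℝ × E) × P => η y.1.1) y = w.1 * deriv η y.1.1 := by
    intro w
    unfold dir
    have h2 : HasFDerivAt (fun y : (ℝ × E) × P => y.1.1)
        ((ContinuousLinearMap.fst ℝ ℝ E).comp (ContinuousLinearMap.fst ℝ (ℝ × E) P)) y :=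
      ContinuousLinearMap.hasFDerivAt
        ((ContinuousLinearMap.fst ℝ ℝ E).comp (ContinuousLinearMap.fst ℝ (ℝ × E) P))
    have h3 := HasFDerivAt.comp y (differentiable_of_smooth hη y.1.1).hasFDerivAt h2
    have h4 : fderiv ℝ (fun y : (ℝ × E) × P => η y.1.1) y = _ := h3.fderiv
    rw [h4]
    change fderiv ℝ η y.1.1 w.1 = _
    simp
  rw [flowDeriv_apply hh, flowDeriv_apply hh]
  simp only [dir_mul hη' hχ, h1]
  rw [mul_add, Finset.mul_sum]
  have : ∀ i, η y.1.1 * (dir (p i) h (y.1.2, y.2) * dir (0, q i) χ y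
      - dir (q i) h (y.1.2, y.2) * dir (0, p i) χ y)
      = dir (p i) h (y.1.2, y.2) * (η y.1.1 * dir (0, q i) χ y + 0 * deriv η y.1.1 * χ y)
      - dir (q i) h (y.1.2, y.2) * (η y.1.1 * dir (0, p i) χ y + 0 * deriv η y.1.1 * χ y) :=
    fun i => by ring
  simp only [this]
  ring

variable [MeasurableSpace E] (μ : Measure E)

variable (ħ q p m Φ v) in
/-- The classical density of `v` at time `t`, integrated against `χ`. -/
def densityIntegral (χ : E × P → ℝ) (t : ℝ) : ℂ :=
  ∫ z, traceDensityAt ħ q p m (v t) z (op Φ fun a => χ (z, a)) ∂μ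

variable [BorelSpace E] [FiniteDimensional ℝ E] [μ.IsAddHaarMeasure]

/-- For χ transported exactly by the flow the integral would be constant, and `flowDeriv` χ measures
the defect. Putting B = η(t)χ into the Liouville equation shows that the integral against
`flowDeriv` χ is the weak time derivative of the integral against χ. -/
theorem IsLocalSolution.norm_densityIntegral_sub_le (hv : IsLocalSolution ħ q p m Φ h O V J v)
    (hħ : ħ ≠ 0) (hmq : ∀ i j, m i (q j) = 0) (hmp : ∀ i j, m i (p j) = if i = j then 1 else 0)
    {χ : (ℝ × E) × P → ℝ} (hχ : IsTest χ) {t₁ t₂ : ℝ} (ht : t₁ ≤ t₂) (hT : Set.Icc t₁ t₂ ⊆ J)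
    {K : Set E} {C : Set P} (hK : IsCompact K) (hC : IsCompact C) (hKO : K ⊆ O) (hCV : C ⊆ V)
    (hsupp : ∀ t ∈ Set.Icc t₁ t₂, ∀ z a, χ ((t, z), a) ≠ 0 → z ∈ K ∧ a ∈ C)
    {M ε : ℝ} (hε0 : 0 ≤ ε) (hM0 : 0 ≤ M)
    (hM : ∀ t ∈ Set.Icc t₁ t₂, ∀ z ∈ K, ∀ T, ‖traceDensityAt ħ q p m (v t) z T‖ ≤ M * ‖T‖)
    (hε : ∀ t ∈ Set.Icc t₁ t₂, ∀ z a, |flowDeriv q p h χ ((t, z), a)| ≤ ε) :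
    ‖densityIntegral ħ q p m Φ v μ (fun y => χ ((t₂, y.1), y.2)) t₂
      - densityIntegral ħ q p m Φ v μ (fun y => χ ((t₁, y.1), y.2)) t₁‖
      ≤ M * ε * μ.real K * (t₂ - t₁) := by
  rcases ht.eq_or_lt with rfl | hlt
  · simp
  have hfd : IsTest (flowDeriv q p h χ) :=
    isTest_transportDeriv (hv.contDiff.comp (by fun_prop)) hχ
  have hχK : ∀ t ∈ Set.Icc t₁ t₂, ∀ z ∉ K, ∀ a, χ ((t, z), a) = 0 := fun t ht z hz a =>
    by_contra fun hc => hz (hsupp t ht z a hc).1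
  have hfdK : ∀ t ∈ Set.Icc t₁ t₂, ∀ z ∉ K, ∀ a, flowDeriv q p h χ ((t, z), a) = 0 := by
    intro t ht z hz a
    -- The support of χ is controlled only for times in the closed interval, so at its end points
    -- the vanishing of the derivative follows by continuity from the interior.
    have hcl : IsClosed {t | flowDeriv q p h χ ((t, z), a) = 0} :=
      isClosed_eq (hfd.1.continuous.comp (by fun_prop)) continuous_const
    rw [← closure_Ioo hlt.ne] at ht
    refine closure_minimal (fun s hs => ?_) hcl ht
    refine flowDeriv_eq_zero_of_notMem hv.contDiff (notMem_tsupport_iff_eventuallyEq.2 ?_)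
    have hopen : IsOpen ((Set.Ioo t₁ t₂ ×ˢ Kᶜ) ×ˢ (Set.univ : Set P)) :=
      (isOpen_Ioo.prod hK.isClosed.isOpen_compl).prod isOpen_univ
    filter_upwards [hopen.mem_nhds ⟨⟨hs, hz⟩, Set.mem_univ a⟩] with y hy
    exact hχK y.1.1 (Set.Ioo_subset_Icc_self hy.1.1) y.1.2 hy.1.2 y.2
  have hcont : ∀ {F : (ℝ × E) × P → ℝ}, IsCc F →
      (∀ t ∈ Set.Icc t₁ t₂, ∀ z ∉ K, ∀ a, F ((t, z), a) = 0) →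
      ContinuousOn (fun x : ℝ × E => traceDensityAt ħ q p m (v x.1) x.2
        (op Φ fun a => F (x, a))) (Set.Icc t₁ t₂ ×ˢ Set.univ) := fun hF hFK =>
    hv.continuousOn_traceDensityAt_of_support hF hT hK.isClosed hKO hFK
  have hzero : ∀ {F : (ℝ × E) × P → ℝ},
      (∀ t ∈ Set.Icc t₁ t₂, ∀ z ∉ K, ∀ a, F ((t, z), a) = 0) → ∀ t ∈ Set.Icc t₁ t₂, ∀ z ∉ K,
      traceDensityAt ħ q p m (v t) z (op Φ fun a => F ((t, z), a)) = 0 := by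
    intro F hF t ht z hz
    have : (fun a => F ((t, z), a)) = fun _ => 0 := funext fun a => hF t ht z hz a
    rw [this, op_zero]
    exact traceDensity_zero _ _ _ _ _
  have hIcont : ∀ {F : (ℝ × E) × P → ℝ}, IsCc F →
      (∀ t ∈ Set.Icc t₁ t₂, ∀ z ∉ K, ∀ a, F ((t, z), a) = 0) →
      ContinuousOn (fun t => densityIntegral ħ q p m Φ v μ (fun y => F ((t, y.1), y.2)) t)
        (Set.Icc t₁ t₂) := fun hF hFK =>
    continuousOn_integral_of_compact_support hK (hcont hF hFK)
      (fun t z ht hz => hzero hFK t ht z hz)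
  have hint : ∀ {F : (ℝ × E) × P → ℝ}, IsCc F →
      (∀ t ∈ Set.Icc t₁ t₂, ∀ z ∉ K, ∀ a, F ((t, z), a) = 0) → ∀ t ∈ Set.Icc t₁ t₂,
      Integrable (fun z => traceDensityAt ħ q p m (v t) z (op Φ fun a => F ((t, z), a))) μ := by
    intro F hF hFK t ht
    refine Continuous.integrable_of_hasCompactSupport ?_
      (HasCompactSupport.intro hK fun z hz => hzero hFK t ht z hz)
    exact (hcont hF hFK).comp_continuous (f := fun z : E => (t, z)) (by fun_prop)
      fun z => ⟨ht, trivial⟩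
  have key := norm_sub_le_of_weak_deriv ht (hIcont hχ.isCc hχK) (hIcont hfd.isCc hfdK)
    (C := M * ε * μ.real K) (fun t ht => ?_) (fun η hη hηs => ?_)
  · exact key
  · have hsub : densityIntegral ħ q p m Φ v μ (fun y => flowDeriv q p h χ ((t, y.1), y.2)) t
        = ∫ z in K, traceDensityAt ħ q p m (v t) z (op Φ fun a => flowDeriv q p h χ ((t, z), a)) ∂μ :=
      (setIntegral_eq_integral_of_forall_compl_eq_zero fun z hz => hzero hfdK t ht z hz).symm
    rw [hsub]
    refine norm_setIntegral_le_of_norm_le_const (hK.measure_lt_top) fun z hz => ?_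
    refine (hM t ht z hz _).trans ?_
    gcongr
    exact norm_op_le Φ (hfd.isCc.slice (t, z)) hε0 fun a => hε t ht z a
  · let B : (ℝ × E) × P → ℝ := fun y => η y.1.1 * χ y
    have hB : IsTest B := ⟨(hη.1.comp (by fun_prop)).mul hχ.1, hχ.2.mul_left⟩
    have hηI : ∀ t ∈ tsupport η, t ∈ Set.Icc t₁ t₂ := fun t ht => Set.Ioo_subset_Icc_self (hηs ht)
    have hBs : tsupport B ⊆ (tsupport η ×ˢ K) ×ˢ C := by
      refine closure_minimal (fun y hy => ?_)
        (((isClosed_tsupport η).prod hK.isClosed).prod hC.isClosed)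
      have h1 : η y.1.1 ≠ 0 := left_ne_zero_of_mul hy
      have h2 : χ y ≠ 0 := right_ne_zero_of_mul hy
      have h3 := subset_tsupport _ h1
      have h4 := hsupp y.1.1 (hηI _ h3) y.1.2 y.2 h2
      exact ⟨⟨h3, h4.1⟩, h4.2⟩
    have hJint : tsupport η ⊆ interior J := fun t ht =>
      interior_maximal (Set.Ioo_subset_Icc_self.trans hT) isOpen_Ioo (hηs ht)
    have hL := hv.integral_traceDensityAt_flowDeriv μ hħ hmq hmp hB
      (hBs.trans (Set.prod_mono (Set.prod_mono hJint hKO) hCV))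
    have hfB : ∀ y, flowDeriv q p h B y
        = deriv η y.1.1 * χ y + η y.1.1 * flowDeriv q p h χ y := fun y =>
      flowDeriv_mul hv.contDiff hχ.1 hη.1 y
    have hfBc : IsCc (flowDeriv q p h B) :=
      (isTest_transportDeriv (hv.contDiff.comp (by fun_prop)) hB).isCc
    have hfB0 : ∀ x ∉ tsupport η ×ˢ K,
        traceDensityAt ħ q p m (v x.1) x.2 (op Φ fun a => flowDeriv q p h B (x, a)) = 0 := by
      intro x hx
      have : (fun a => flowDeriv q p h B (x, a)) = fun _ => 0 := funext fun a =>
        flowDeriv_eq_zero_of_notMem hv.contDiff fun hc => hx (hBs hc).1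
      rw [this, op_zero]
      exact traceDensity_zero _ _ _ _ _
    have hfBK : ∀ t ∈ Set.Icc t₁ t₂, ∀ z ∉ K, ∀ a, flowDeriv q p h B ((t, z), a) = 0 :=
      fun t ht z hz a => flowDeriv_eq_zero_of_notMem hv.contDiff fun hc => hz (hBs hc).1.2
    have hci : Integrable (fun x : ℝ × E => traceDensityAt ħ q p m (v x.1) x.2
        (op Φ fun a => flowDeriv q p h B (x, a))) (volume.prod μ) := by
      refine Continuous.integrable_of_hasCompactSupport ?_
        (HasCompactSupport.intro (hη.2.isCompact.prod hK) hfB0)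
      rw [continuous_iff_continuousAt]
      intro x
      by_cases hx : x.1 ∈ tsupport η
      · refine ((hcont hfBc hfBK) x ⟨hηI _ hx, trivial⟩).continuousAt ?_
        exact prod_mem_nhds (Icc_mem_nhds (hηs hx).1 (hηs hx).2) Filter.univ_mem
      · have : (fun x : ℝ × E => traceDensityAt ħ q p m (v x.1) x.2
          (op Φ fun a => flowDeriv q p h B (x, a))) =ᶠ[nhds x] fun _ => 0 := by
          have hopen : IsOpen ((tsupport η)ᶜ ×ˢ (Set.univ : Set E)) :=
            (isClosed_tsupport η).isOpen_compl.prod isOpen_univ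
          filter_upwards [hopen.mem_nhds (x := x) ⟨hx, trivial⟩] with y hy
          exact hfB0 y fun hc => hy.1 hc.1
        exact continuousAt_const.congr this.symm
    rw [integral_prod _ hci] at hL
    rw [← hL]
    congr 1
    funext t
    by_cases ht : t ∈ tsupport η
    · have h1 : ∀ z, traceDensityAt ħ q p m (v t) z (op Φ fun a => flowDeriv q p h B ((t, z), a))
          = deriv η t • traceDensityAt ħ q p m (v t) z (op Φ fun a => χ ((t, z), a))
          + η t • traceDensityAt ħ q p m (v t) z (op Φ fun a => flowDeriv q p h χ ((t, z), a)) := by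
        intro z
        simp only [hfB]
        rw [op_add Φ (IsCc.mul_left continuous_const (hχ.isCc.slice _))
          (IsCc.mul_left continuous_const (hfd.isCc.slice _)), op_smul Φ (hχ.isCc.slice _),
          op_smul Φ (hfd.isCc.slice _)]
        simp only [traceDensityAt, traceDensity_add, traceDensity_smul, Complex.real_smul]
      simp only [h1]
      have i1 : Integrable (fun z => deriv η t •
          traceDensityAt ħ q p m (v t) z (op Φ fun a => χ ((t, z), a))) μ :=
        Integrable.smul (deriv η t) (hint hχ.isCc hχK t (hηI t ht))
      have i2 : Integrable (fun z => η t •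
          traceDensityAt ħ q p m (v t) z (op Φ fun a => flowDeriv q p h χ ((t, z), a))) μ :=
        Integrable.smul (η t) (hint hfd.isCc hfdK t (hηI t ht))
      rw [integral_add i1 i2, integral_smul, integral_smul]
      rfl
    · have h1 : ∀ z, traceDensityAt ħ q p m (v t) z (op Φ fun a => flowDeriv q p h B ((t, z), a))
          = 0 := fun z => hfB0 (t, z) fun hc => ht hc.1
      have h2 : deriv η t = 0 := by_contra fun hc => ht (support_deriv_subset hc)
      simp only [h1, image_eq_zero_of_notMem_tsupport ht, h2, zero_smul, add_zero, integral_zero]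

end Slab

end HybridQC
end

open scoped Manifold ContDiff ZeroAtInfty
noncomputable section
namespace HybridQC

/-! ### Euler steps for the Hamiltonian vector field and their pull-backs. -/

section Euler

open MeasureTheory

variable {E : Type*} [NormedAddCommGroup E] [NormedSpace ℝ E] [FiniteDimensional ℝ E]
variable {P : Type*} [NormedAddCommGroup P] [NormedSpace ℝ P] [FiniteDimensional ℝ P] {n : ℕ}

lemma hasCompactSupport_of_norm_le {Y Z : Type*} [NormedAddCommGroup Y] [NormedSpace ℝ Y]
    [FiniteDimensional ℝ Y] [Zero Z] {f : Y → Z} {C : ℝ} (hf : ∀ y, f y ≠ 0 → ‖y‖ ≤ C) :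
    HasCompactSupport f := by
  have : ProperSpace Y := FiniteDimensional.proper ℝ Y
  refine HasCompactSupport.intro (isCompact_closedBall (0 : Y) C) fun y hy => ?_
  by_contra hc
  exact hy (mem_closedBall_zero_iff.2 (hf y hc))

lemma IsTest.exists_norm_le {Y : Type*} [NormedAddCommGroup Y] [NormedSpace ℝ Y] {f : Y → ℝ}
    (hf : IsTest f) : ∃ C, ∀ y, f y ≠ 0 → ‖y‖ ≤ C := by
  obtain ⟨C, hC⟩ := hf.2.isCompact.isBounded.exists_norm_le
  exact ⟨C, fun y hy => hC y (subset_tsupport _ hy)⟩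

/-- The pull back of `χ` under one step of the Euler scheme for the vector field `X`, which depends
on a parameter. -/
def eulerStep (X : E × P → E) (δ : ℝ) (χ : E × P → ℝ) : E × P → ℝ :=
  fun y => χ (y.1 + δ • X y, y.2)

/-- A smooth bounded vector field with bounded derivative, which depends on a parameter. -/
structure IsBoundedField (X : E × P → E) (M L : ℝ) : Prop where
  contDiff : ContDiff ℝ ∞ X
  norm_le : ∀ y, ‖X y‖ ≤ M
  norm_fderiv_le : ∀ y, ‖fderiv ℝ X y‖ ≤ L

variable {X : E × P → E} {M L : ℝ}

namespace IsBoundedField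

lemma nonneg_left (hX : IsBoundedField X M L) : 0 ≤ M := (norm_nonneg _).trans (hX.norm_le 0)

lemma nonneg_right (hX : IsBoundedField X M L) : 0 ≤ L :=
  (norm_nonneg _).trans (hX.norm_fderiv_le 0)

lemma norm_sub_le (hX : IsBoundedField X M L) (y z : E × P) : ‖X y - X z‖ ≤ L * ‖y - z‖ :=
  convex_univ.norm_image_sub_le_of_norm_fderiv_le
    (fun x _ => hX.contDiff.differentiable (by simp) x) (fun x _ => hX.norm_fderiv_le x)
    (Set.mem_univ z) (Set.mem_univ y)

lemma norm_smul_le (hX : IsBoundedField X M L) (σ : ℝ) (y : E × P) : ‖σ • X y‖ ≤ |σ| * M := by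
  rw [norm_smul, Real.norm_eq_abs]
  exact mul_le_mul_of_nonneg_left (hX.norm_le y) (abs_nonneg _)

lemma norm_le_add (hX : IsBoundedField X M L) (σ : ℝ) (y : E × P) :
    ‖y.1‖ ≤ ‖y.1 + σ • X y‖ + |σ| * M := by
  have h1 : y.1 = (y.1 + σ • X y) - σ • X y := by abel
  calc ‖y.1‖ = ‖(y.1 + σ • X y) - σ • X y‖ := by rw [← h1]
    _ ≤ _ := (_root_.norm_sub_le _ _).trans (add_le_add le_rfl (hX.norm_smul_le σ y))

lemma isTest_eulerStep (hX : IsBoundedField X M L) (δ : ℝ) {χ : E × P → ℝ} (hχ : IsTest χ) :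
    IsTest (eulerStep X δ χ) := by
  have hc := hX.contDiff
  refine ⟨hχ.1.comp (by fun_prop), ?_⟩
  obtain ⟨C, hC⟩ := hχ.exists_norm_le
  refine hasCompactSupport_of_norm_le (C := C + |δ| * M) fun y hy => ?_
  have h1 := hC _ hy
  rw [norm_prod_le_iff] at h1 ⊢
  have h2 : 0 ≤ |δ| * M := mul_nonneg (abs_nonneg _) hX.nonneg_left
  exact ⟨(hX.norm_le_add δ y).trans (by linarith [h1.1]), h1.2.trans (by linarith)⟩

/-- By the chain rule the direction w is replaced by w + δ DX(w, 0), so one step enlarges the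
gradient bound by at most the factor 1 + |δ|L. -/
lemma abs_fderiv_eulerStep_le (hX : IsBoundedField X M L) (δ : ℝ) {χ : E × P → ℝ} (hχ : IsTest χ)
    {G : ℝ} (hG0 : 0 ≤ G) (hG : ∀ y w, |dir w χ y| ≤ G * ‖w‖) (y : E × P) (w : E) :
    |dir w (eulerStep X δ χ) y| ≤ (1 + |δ| * L) * G * ‖w‖ := by
  have hd : HasFDerivAt X (fderiv ℝ X y) y :=
    (hX.contDiff.differentiable (by simp) y).hasFDerivAt
  have h1 : HasFDerivAt (fun y : E × P => (y.1 + δ • X y, y.2))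
      ((ContinuousLinearMap.fst ℝ E P + δ • fderiv ℝ X y).prod (ContinuousLinearMap.snd ℝ E P)) y :=
    (hasFDerivAt_fst.add (hd.const_smul δ)).prodMk hasFDerivAt_snd
  have h2 := HasFDerivAt.comp y (differentiable_of_smooth hχ.1 _).hasFDerivAt h1
  have h3 : dir w (eulerStep X δ χ) y
      = dir (w + δ • fderiv ℝ X y (w, 0)) χ (y.1 + δ • X y, y.2) := by
    have h4 : fderiv ℝ (eulerStep X δ χ) y = _ := h2.fderiv
    unfold dir
    rw [h4]
    rfl
  rw [h3]
  refine (hG _ _).trans ?_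
  have h5 : ‖fderiv ℝ X y (w, 0)‖ ≤ L * ‖w‖ := by
    refine ((fderiv ℝ X y).le_of_opNorm_le (hX.norm_fderiv_le y) _).trans_eq ?_
    simp [Prod.norm_def]
  have h6 : ‖w + δ • fderiv ℝ X y (w, 0)‖ ≤ (1 + |δ| * L) * ‖w‖ := by
    refine (norm_add_le _ _).trans ?_
    rw [norm_smul, Real.norm_eq_abs]
    have := mul_le_mul_of_nonneg_left h5 (abs_nonneg δ)
    linarith
  calc G * ‖w + δ • fderiv ℝ X y (w, 0)‖ ≤ G * ((1 + |δ| * L) * ‖w‖) := by gcongr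
    _ = _ := by ring

end IsBoundedField

/-- The Hamiltonian vector field of `h`. -/
def hamField (q p : Fin n → E) (h : E × P → ℝ) (y : E × P) : E :=
  ∑ i, (dir (p i) h y • q i - dir (q i) h y • p i)

lemma contDiff_hamField {q p : Fin n → E} {h : E × P → ℝ} (hh : ContDiff ℝ ∞ h) :
    ContDiff ℝ ∞ (hamField q p h) :=
  ContDiff.sum fun _ _ => ((contDiff_dir hh _).smul contDiff_const).sub
    ((contDiff_dir hh _).smul contDiff_const)

lemma exists_isBoundedField_hamField {q p : Fin n → E} {h : E × P → ℝ} (hh : IsTest h) :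
    ∃ M L, IsBoundedField (hamField q p h) M L := by
  have hc := contDiff_hamField (q := q) (p := p) hh.1
  have hs : HasCompactSupport (hamField q p h) := by
    obtain ⟨C, hC⟩ := hh.2.isCompact.isBounded.exists_norm_le
    refine hasCompactSupport_of_norm_le (C := C) fun y hy => hC y ?_
    by_contra hc
    exact hy (by simp [hamField, dir_eq_zero_of_notMem hc])
  obtain ⟨M, hM⟩ := hs.exists_bound_of_continuous hc.continuous
  obtain ⟨L, hL⟩ := (hs.fderiv (𝕜 := ℝ)).exists_bound_of_continuous
    (hc.continuous_fderiv (by simp))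
  exact ⟨M, L, hc, hM, hL⟩

lemma flowDeriv_eq_dir {q p : Fin n → E} {h : E × P → ℝ} (hh : ContDiff ℝ ∞ h)
    (B : (ℝ × E) × P → ℝ) (y : (ℝ × E) × P) :
    flowDeriv q p h B y = dir (1, hamField q p h (y.1.2, y.2)) B y := by
  rw [flowDeriv_apply hh]
  have h0 : ∀ w : E, dir (0, w) B y = (fderiv ℝ B y).comp
      ((ContinuousLinearMap.inl ℝ (ℝ × E) P).comp (ContinuousLinearMap.inr ℝ ℝ E)) w := fun w => rfl
  have h1 : dir (1, hamField q p h (y.1.2, y.2)) B y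
      = dir (1, 0) B y + dir (0, hamField q p h (y.1.2, y.2)) B y := by
    unfold dir
    rw [← map_add]
    simp
  rw [h1, h0 (hamField _ _ _ _), hamField, map_sum]
  simp only [map_sub, map_smul, smul_eq_mul, h0]

/-- The test function on the extended phase space that interpolates between `χ` at time `τ` and
its Euler steps. -/
def eulerSpread (X : E × P → E) (τ : ℝ) (θ : ℝ → ℝ) (χ : E × P → ℝ) : (ℝ × E) × P → ℝ :=
  fun y => θ y.1.1 * χ (y.1.2 + (τ - y.1.1) • X (y.1.2, y.2), y.2)

lemma IsBoundedField.isTest_eulerSpread (hX : IsBoundedField X M L) (τ : ℝ) {θ : ℝ → ℝ}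
    (hθ : IsTest θ) {χ : E × P → ℝ} (hχ : IsTest χ) : IsTest (eulerSpread X τ θ χ) := by
  have hc := hX.contDiff
  have hc' := hθ.1
  refine ⟨(hθ.1.comp (by fun_prop)).mul (hχ.1.comp (by fun_prop)), ?_⟩
  obtain ⟨C, hC⟩ := hχ.exists_norm_le
  obtain ⟨D, hD⟩ := hθ.exists_norm_le
  -- On the support of θ one has |t| ≤ D, so the displacement (τ - t)X is at most (|τ| + D)M.
  refine hasCompactSupport_of_norm_le (C := max D (C + (|τ| + D) * M)) fun y hy => ?_
  have h1 := hC _ (right_ne_zero_of_mul hy)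
  have h0 := hD _ (left_ne_zero_of_mul hy)
  rw [norm_prod_le_iff] at h1
  have hD0 : 0 ≤ D := (norm_nonneg _).trans h0
  have h3 : 0 ≤ (|τ| + D) * M := mul_nonneg (add_nonneg (abs_nonneg _) hD0) hX.nonneg_left
  have h2 : ‖y.1.2‖ ≤ C + (|τ| + D) * M := by
    refine (hX.norm_le_add (τ - y.1.1) (y.1.2, y.2)).trans (add_le_add h1.1 ?_)
    refine mul_le_mul_of_nonneg_right ?_ hX.nonneg_left
    refine (abs_sub _ _).trans (add_le_add le_rfl ?_)
    exact h0
  rw [norm_prod_le_iff, norm_prod_le_iff]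
  exact ⟨⟨h0.trans (le_max_left _ _), h2.trans (le_max_right _ _)⟩,
    (h1.2.trans (by linarith)).trans (le_max_right _ _)⟩

lemma abs_flowDeriv_eulerSpread_le {q p : Fin n → E} {h : E × P → ℝ} (hh : ContDiff ℝ ∞ h)
    (hX : IsBoundedField (hamField q p h) M L) (τ : ℝ) {θ : ℝ → ℝ} {χ : E × P → ℝ}
    (hχ : IsTest χ) {G : ℝ} (hG : ∀ y w, |dir w χ y| ≤ G * ‖w‖) (hG0 : 0 ≤ G)
    {t : ℝ} (ht : θ =ᶠ[nhds t] 1) (z : E) (a : P) :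
    |flowDeriv q p h (eulerSpread (hamField q p h) τ θ χ) ((t, z), a)| ≤ |τ - t| * (L * M) * G := by
  set X := hamField q p h with hXdef
  have hd : HasFDerivAt X (fderiv ℝ X (z, a)) (z, a) :=
    (hX.contDiff.differentiable (by simp) _).hasFDerivAt
  have hlin : HasFDerivAt (fun y : (ℝ × E) × P => (y.1.2, y.2))
      (((ContinuousLinearMap.snd ℝ ℝ E).comp (ContinuousLinearMap.fst ℝ (ℝ × E) P)).prod
        (ContinuousLinearMap.snd ℝ (ℝ × E) P)) ((t, z), a) :=
    ContinuousLinearMap.hasFDerivAt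
      (((ContinuousLinearMap.snd ℝ ℝ E).comp (ContinuousLinearMap.fst ℝ (ℝ × E) P)).prod
        (ContinuousLinearMap.snd ℝ (ℝ × E) P))
  have hX1 := HasFDerivAt.comp ((t, z), a) (f := fun y : (ℝ × E) × P => (y.1.2, y.2)) hd hlin
  have hp1 : HasFDerivAt (fun y : (ℝ × E) × P => y.1)
      (ContinuousLinearMap.fst ℝ (ℝ × E) P) ((t, z), a) := hasFDerivAt_fst
  have hτ : HasFDerivAt (fun y : (ℝ × E) × P => τ - y.1.1) _ ((t, z), a) := hp1.fst.const_sub τ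
  have hg := (hp1.snd.add (hτ.smul hX1)).prodMk
    (hasFDerivAt_snd (𝕜 := ℝ) (p := ((t, z), a)))
  have h2 := HasFDerivAt.comp ((t, z), a)
    (f := fun y : (ℝ × E) × P => (y.1.2 + (τ - y.1.1) • X (y.1.2, y.2), y.2))
    (differentiable_of_smooth hχ.1 _).hasFDerivAt hg
  have h3 : eulerSpread X τ θ χ =ᶠ[nhds ((t, z), a)]
      fun y => χ (y.1.2 + (τ - y.1.1) • X (y.1.2, y.2), y.2) := by
    have : Filter.Tendsto (fun y : (ℝ × E) × P => y.1.1) (nhds ((t, z), a)) (nhds t) := by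
      have : Continuous (fun y : (ℝ × E) × P => y.1.1) := by fun_prop
      exact this.tendsto _
    filter_upwards [this.eventually ht] with y hy
    simp only [eulerSpread, hy, Pi.one_apply, one_mul]
  -- Along ∂_t + X, the t-derivative of (τ - t)X gives -X, which cancels X itself. Only (τ - t) DX·X
  -- survives, and this makes the defect small near τ.
  have h4 : flowDeriv q p h (eulerSpread X τ θ χ) ((t, z), a)
      = dir ((τ - t) • fderiv ℝ X (z, a) (X (z, a), 0)) χ (z + (τ - t) • X (z, a), a) := by
    have h5 := (h2.congr_of_eventuallyEq h3).fderiv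
    rw [flowDeriv_eq_dir hh, ← hXdef]
    unfold dir
    rw [h5]
    simp
  rw [h4]
  refine (hG _ _).trans ?_
  rw [norm_smul, Real.norm_eq_abs]
  have h6 : ‖fderiv ℝ X (z, a) (X (z, a), 0)‖ ≤ L * M := by
    refine ((fderiv ℝ X _).le_of_opNorm_le (hX.norm_fderiv_le _) _).trans ?_
    refine mul_le_mul_of_nonneg_left ?_ hX.nonneg_right
    simpa [Prod.norm_def] using hX.norm_le (z, a)
  calc G * (|τ - t| * ‖fderiv ℝ X (z, a) (X (z, a), 0)‖) ≤ G * (|τ - t| * (L * M)) := by gcongr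
    _ = _ := by ring

end Euler

end HybridQC
end

open scoped Manifold ContDiff ZeroAtInfty
noncomputable section
namespace HybridQC

/-! ### Positivity is propagated by many small Euler steps. -/

section Propagation

open MeasureTheory

variable {E : Type*} [NormedAddCommGroup E] [NormedSpace ℝ E] [FiniteDimensional ℝ E]
variable {P : Type*} [NormedAddCommGroup P] [NormedSpace ℝ P] [FiniteDimensional ℝ P] {n : ℕ}
variable {𝓗 : Type*} [NormedAddCommGroup 𝓗] [InnerProductSpace ℂ 𝓗] [CompleteSpace 𝓗]
variable {ħ : ℝ} {q p : Fin n → E} {m : Fin n → E →L[ℝ] ℝ}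
  {Φ : C₀(P, ℂ) →⋆ₙₐ[ℂ] (𝓗 →L[ℂ] 𝓗)} {h : E × P → ℝ} {O : Set E} {V : Set P} {J : Set ℝ}
  {v : ℝ → E → 𝓗} {M L : ℝ}

lemma IsLocalSolution.exists_traceDensityAt_bound (hv : IsLocalSolution ħ q p m Φ h O V J v)
    {T : Set ℝ} (hT : IsCompact T) (hTJ : T ⊆ J) {K : Set E} (hK : IsCompact K) (hKO : K ⊆ O) :
    ∃ D, 0 ≤ D ∧ ∀ t ∈ T, ∀ z ∈ K, ∀ S, ‖traceDensityAt ħ q p m (v t) z S‖ ≤ D * ‖S‖ := by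
  have h0 := hv.continuousOn.mono (Set.prod_mono hTJ hKO)
  have h1 := fun w => (hv.continuousOn_fderiv w).mono (Set.prod_mono hTJ hKO)
  have hc : ContinuousOn (fun x : ℝ × E => traceDensityBound ħ (fun i => m i x.2) (v x.1 x.2)
      (fun i => fderiv ℝ (v x.1) x.2 (q i)) (fun i => fderiv ℝ (v x.1) x.2 (p i))) (T ×ˢ K) := by
    unfold traceDensityBound
    refine ((continuousOn_const.mul (h0.norm.mul h0.norm)).add
      (continuousOn_finsetSum _ fun i _ => ?_)).add
      (continuousOn_const.mul (continuousOn_finsetSum _ fun i _ => ?_))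
    · refine ContinuousOn.mul ?_ (continuousOn_const.mul (h0.norm.mul (h1 _).norm))
      exact (continuous_abs.comp ((m i).continuous.comp continuous_snd)).continuousOn
    · exact continuousOn_const.mul ((h1 _).norm.mul (h1 _).norm)
  obtain ⟨D, hD⟩ := (hT.prod hK).exists_bound_of_continuousOn hc
  refine ⟨max D 0, le_max_right _ _, fun t ht z hz S => (norm_traceDensity_le _ _ _ _ _ S).trans ?_⟩
  gcongr
  exact ((le_abs_self _).trans (hD (t, z) ⟨ht, hz⟩)).trans (le_max_left _ _)

variable [MeasurableSpace E] (μ : Measure E) [BorelSpace E] [μ.IsAddHaarMeasure]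

/-- The interpolation `eulerSpread` has defect at most |s' - s|LMG, acting for a time |s' - s|, so
the error of one step is quadratic in the step. The balls in `hsupp` contain all points that the
interpolation can meet. -/
lemma IsLocalSolution.norm_densityIntegral_eulerStep_le
    (hv : IsLocalSolution ħ q p m Φ h O V J v)
    (hħ : ħ ≠ 0) (hmq : ∀ i j, m i (q j) = 0) (hmp : ∀ i j, m i (p j) = if i = j then 1 else 0)
    (hX : IsBoundedField (hamField q p h) M L) {χ : E × P → ℝ} (hχ : IsTest χ) {s s' : ℝ}
    (hT : Set.uIcc s s' ⊆ J) {K : Set E} {C : Set P} (hK : IsCompact K) (hC : IsCompact C)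
    (hKO : K ⊆ O) (hCV : C ⊆ V)
    (hsupp : ∀ y, χ y ≠ 0 → Metric.closedBall y.1 (|s' - s| * M) ⊆ K ∧ y.2 ∈ C)
    {D G : ℝ} (hD0 : 0 ≤ D)
    (hD : ∀ t ∈ Set.uIcc s s', ∀ z ∈ K, ∀ S, ‖traceDensityAt ħ q p m (v t) z S‖ ≤ D * ‖S‖)
    (hG0 : 0 ≤ G) (hG : ∀ y w, |dir w χ y| ≤ G * ‖w‖) :
    ‖densityIntegral ħ q p m Φ v μ χ s'
      - densityIntegral ħ q p m Φ v μ (eulerStep (hamField q p h) (s' - s) χ) s‖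
      ≤ D * (|s' - s| * (L * M) * G) * μ.real K * |s' - s| := by
  have hσ : ∀ t ∈ Set.uIcc s s', |s' - t| ≤ |s' - s| := fun t ht =>
    Set.abs_sub_right_of_mem_uIcc ht
  obtain ⟨θ, hθ, -, hθ1, -⟩ := exists_cutoff (K := Set.uIcc s s') isCompact_uIcc isOpen_univ
    (Set.subset_univ _)
  have hLM : 0 ≤ L * M := mul_nonneg hX.nonneg_right hX.nonneg_left
  have key := hv.norm_densityIntegral_sub_le μ hħ hmq hmp (t₁ := min s s') (t₂ := max s s')
    (ε := |s' - s| * (L * M) * G)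
    (hX.isTest_eulerSpread s' hθ hχ) min_le_max hT hK hC hKO hCV
    (fun t ht z a hy => by
      obtain ⟨h1, h2⟩ := hsupp _ (right_ne_zero_of_mul hy)
      refine ⟨h1 ?_, h2⟩
      rw [Metric.mem_closedBall, dist_eq_norm, norm_sub_rev, add_sub_cancel_left]
      exact (hX.norm_smul_le _ _).trans
        (mul_le_mul_of_nonneg_right (hσ t ht) hX.nonneg_left))
    (by positivity) hD0 hD (fun t ht z a => by
      refine (abs_flowDeriv_eulerSpread_le hv.contDiff hX s' hχ hG hG0 (hθ1 t ht) z a).trans ?_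
      exact mul_le_mul_of_nonneg_right (mul_le_mul_of_nonneg_right (hσ t ht) hLM) hG0)
  have e1 : (fun y : E × P => eulerSpread (hamField q p h) s' θ χ ((s, y.1), y.2))
      = eulerStep (hamField q p h) (s' - s) χ := by
    funext y
    simp [eulerSpread, eulerStep, (hθ1 s Set.left_mem_uIcc).self_of_nhds]
  have e2 : (fun y : E × P => eulerSpread (hamField q p h) s' θ χ ((s', y.1), y.2)) = χ := by
    funext y
    simp [eulerSpread, (hθ1 s' Set.right_mem_uIcc).self_of_nhds]
  rcases le_total s s' with hs | hs
  · rw [min_eq_left hs, max_eq_right hs, e1, e2] at key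
    rwa [abs_of_nonneg (sub_nonneg.2 hs)] at key ⊢
  · rw [min_eq_right hs, max_eq_left hs, e1, e2, norm_sub_rev] at key
    rwa [← abs_of_nonneg (sub_nonneg.2 hs), abs_sub_comm s s'] at key

/-- The local error of the Euler scheme. -/
lemma IsBoundedField.norm_sub_sub_le {X : E × P → E} (hX : IsBoundedField X M L) {c : ℝ → E}
    {a₀ : P} {s s' : ℝ} (hc : ∀ t ∈ Set.uIcc s s', HasDerivAt c (X (c t, a₀)) t) :
    ‖c s' - c s - (s' - s) • X (c s, a₀)‖ ≤ L * (M * |s' - s|) * |s' - s| := by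
  have h1 : ∀ t ∈ Set.uIcc s s', ‖c t - c s‖ ≤ M * |t - s| := fun t ht => by
    have := (convex_uIcc s s').norm_image_sub_le_of_norm_hasDerivWithin_le
      (fun t ht => (hc t ht).hasDerivWithinAt) (fun t _ => hX.norm_le _) Set.left_mem_uIcc ht
    simpa using this
  have h2 : ∀ t ∈ Set.uIcc s s', HasDerivWithinAt (fun t => c t - t • X (c s, a₀))
      (X (c t, a₀) - X (c s, a₀)) (Set.uIcc s s') t := fun t ht => by
    have := (hc t ht).sub ((hasDerivAt_id t).smul_const (X (c s, a₀)))
    rw [one_smul] at this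
    exact this.hasDerivWithinAt
  have h3 := (convex_uIcc s s').norm_image_sub_le_of_norm_hasDerivWithin_le h2
    (C := L * (M * |s' - s|)) (fun t ht => by
      refine (hX.norm_sub_le _ _).trans (mul_le_mul_of_nonneg_left ?_ hX.nonneg_right)
      rw [Prod.mk_sub_mk, sub_self, Prod.norm_mk, norm_zero, max_eq_left (norm_nonneg _)]
      exact (h1 t ht).trans (mul_le_mul_of_nonneg_left (Set.abs_sub_left_of_mem_uIcc ht)
        hX.nonneg_left)) Set.left_mem_uIcc Set.right_mem_uIcc
  have h4 : c s' - c s - (s' - s) • X (c s, a₀)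
      = c s' - s' • X (c s, a₀) - (c s - s • X (c s, a₀)) := by
    rw [sub_smul]; abel
  rw [h4]
  exact h3

/-- The step and the trajectory diverge by |s' - s|L(‖y - c(s)‖ + r) plus the local error. Adding
the constant r + |s' - s|M to the distance absorbs the inhomogeneous part, so the estimate becomes a
pure factor 1 - |s' - s|L. The weight κ collects these factors under iteration. -/
lemma IsBoundedField.support_eulerStep {X : E × P → E} (hX : IsBoundedField X M L) {c : ℝ → E}
    {a₀ : P} {s s' r κ : ℝ} (hr : 0 ≤ r) (hκ : 0 ≤ κ)
    (hc : ∀ t ∈ Set.uIcc s s', HasDerivAt c (X (c t, a₀)) t)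
    {χ : E × P → ℝ} {S : ℝ}
    (hχ : ∀ y, χ y ≠ 0 → ‖y.2 - a₀‖ < r ∧ κ * (‖y.1 - c s'‖ + (r + |s' - s| * M)) ≤ S) (y : E × P)
    (hy : eulerStep X (s' - s) χ y ≠ 0) :
    ‖y.2 - a₀‖ < r ∧ κ * (1 - |s' - s| * L) * (‖y.1 - c s‖ + (r + |s' - s| * M)) ≤ S := by
  obtain ⟨h1, h2⟩ := hχ _ hy
  refine ⟨h1, ?_⟩
  refine le_trans ?_ h2
  rw [mul_assoc]
  refine mul_le_mul_of_nonneg_left ?_ hκ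
  have h3 := hX.norm_sub_sub_le hc
  have h4 := hX.norm_sub_le y (c s, a₀)
  have h5 : ‖y - (c s, a₀)‖ ≤ ‖y.1 - c s‖ + r := by
    rw [Prod.norm_def]
    refine max_le ?_ ?_
    · simpa using hr
    · simp only [Prod.snd_sub]
      linarith [norm_nonneg (y.1 - c s)]
  have h6 : ‖(s' - s) • (X y - X (c s, a₀))‖ ≤ |s' - s| * (L * (‖y.1 - c s‖ + r)) := by
    rw [norm_smul, Real.norm_eq_abs]
    exact mul_le_mul_of_nonneg_left (h4.trans (mul_le_mul_of_nonneg_left h5 hX.nonneg_right))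
      (abs_nonneg _)
  have h7 : y.1 - c s = (y.1 + (s' - s) • X y - c s') - (s' - s) • (X y - X (c s, a₀))
      + (c s' - c s - (s' - s) • X (c s, a₀)) := by
    rw [smul_sub]; abel
  have h8 : ‖y.1 - c s‖ ≤ ‖y.1 + (s' - s) • X y - c s'‖ + |s' - s| * (L * (‖y.1 - c s‖ + r))
      + L * (M * |s' - s|) * |s' - s| := by
    calc ‖y.1 - c s‖ ≤ ‖(y.1 + (s' - s) • X y - c s')‖ + ‖(s' - s) • (X y - X (c s, a₀))‖
        + ‖(c s' - c s - (s' - s) • X (c s, a₀))‖ := by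
          conv_lhs => rw [h7]
          exact (norm_add_le _ _).trans (add_le_add (_root_.norm_sub_le _ _) le_rfl)
      _ ≤ _ := by gcongr
  nlinarith [h8]

/-- The test function at time s₂ is pulled back to s₁ in k Euler steps. Pull-backs of nonnegative
functions are nonnegative and remain supported near the trajectory, and the sum of k errors of order
1/k² tends to 0. -/
theorem IsLocalSolution.re_densityIntegral_nonneg
    (hv : IsLocalSolution ħ q p m Φ h O V J v)
    (hħ : ħ ≠ 0) (hmq : ∀ i j, m i (q j) = 0) (hmp : ∀ i j, m i (p j) = if i = j then 1 else 0)
    (hX : IsBoundedField (hamField q p h) M L) {s₁ s₂ : ℝ} (hT : Set.uIcc s₁ s₂ ⊆ J)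
    {K : Set E} {C : Set P} (hK : IsCompact K) (hC : IsCompact C) (hKO : K ⊆ O) (hCV : C ⊆ V)
    {c : ℝ → E} {a₀ : P}
    (hc : ∀ t ∈ Set.uIcc s₁ s₂, HasDerivAt c (hamField q p h (c t, a₀)) t)
    {r : ℝ} (hr : 0 < r) (hcK : ∀ t ∈ Set.uIcc s₁ s₂, Metric.closedBall (c t) (8 * r) ⊆ K)
    (hrC : Metric.closedBall a₀ r ⊆ C) (hL : |s₂ - s₁| * L ≤ 1 / 2)
    (hpos : ∀ χ, IsTest χ → (∀ y, 0 ≤ χ y) →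
      (∀ y, χ y ≠ 0 → ‖y.1 - c s₁‖ < 8 * r ∧ ‖y.2 - a₀‖ < 8 * r) →
      0 ≤ (densityIntegral ħ q p m Φ v μ χ s₁).re)
    {χ : E × P → ℝ} (hχ : IsTest χ) (hχ0 : ∀ y, 0 ≤ χ y)
    (hχs : ∀ y, χ y ≠ 0 → ‖y.1 - c s₂‖ < r ∧ ‖y.2 - a₀‖ < r) :
    0 ≤ (densityIntegral ħ q p m Φ v μ χ s₂).re := by
  set X := hamField q p h with hXdef
  obtain ⟨D, hD0, hD⟩ := hv.exists_traceDensityAt_bound (T := Set.uIcc s₁ s₂) isCompact_uIcc hT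
    hK hKO
  obtain ⟨G, hG⟩ := (hχ.2.fderiv (𝕜 := ℝ)).exists_bound_of_continuous
    (hχ.1.continuous_fderiv (by simp))
  have hG0 : 0 ≤ G := (norm_nonneg _).trans (hG 0)
  have hG1 : ∀ y w, |dir w χ y| ≤ G * ‖w‖ := fun y w => by
    refine ((fderiv ℝ χ y).le_of_opNorm_le (hG y) _).trans_eq ?_
    simp [Prod.norm_def]
  have hM0 := hX.nonneg_left
  have hL0 := hX.nonneg_right
  set d := |s₂ - s₁| with hd
  have hd0 : 0 ≤ d := abs_nonneg _
  set B := D * (L * M * (2 * G)) * μ.real K with hB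
  have hB0 : 0 ≤ B := by positivity
  -- The condition bounds the displacement of a single step by r; the lower bound is minus k errors
  -- of size (d/k)²B.
  have main : ∀ k : ℕ, 0 < k → d / k * M ≤ r → -(d ^ 2 * B / k) ≤
      (densityIntegral ħ q p m Φ v μ χ s₂).re := by
    intro k hk hkM
    have hk' : (0 : ℝ) < k := by exact_mod_cast hk
    set δ := (s₂ - s₁) / k with hδ
    have hδa : |δ| = d / k := by rw [hδ, abs_div, abs_of_pos hk']
    have hkδ : k * δ = s₂ - s₁ := by rw [hδ]; field_simp
    set x := |δ| * L with hx
    have hx0 : 0 ≤ x := by positivity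
    have hkx : k * x ≤ 1 / 2 := by
      rw [hx, hδa]
      calc k * (d / k * L) = d * L := by field_simp
        _ ≤ _ := hL
    let τ : ℕ → ℝ := fun j => s₂ - j * δ
    have hτ1 : ∀ j, τ j - τ (j + 1) = δ := fun j => by simp only [τ]; push_cast; ring
    have hτm : ∀ j ≤ k, τ j ∈ Set.uIcc s₁ s₂ := by
      intro j hj
      have hj' : (j : ℝ) ≤ k := by exact_mod_cast hj
      have e : τ j = s₂ + (j / k : ℝ) • (s₁ - s₂) := by
        simp only [τ, hδ, smul_eq_mul]; field_simp; ring
      have := (convex_uIcc s₁ s₂).add_smul_sub_mem Set.right_mem_uIcc Set.left_mem_uIcc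
        (t := (j / k : ℝ)) ⟨by positivity, by rw [div_le_one hk']; exact hj'⟩
      rwa [← e] at this
    have hτsub : ∀ j < k, Set.uIcc (τ (j + 1)) (τ j) ⊆ Set.uIcc s₁ s₂ := fun j hj =>
      Set.uIcc_subset_uIcc (hτm _ hj) (hτm _ hj.le)
    let f : ℕ → E × P → ℝ := fun j => (eulerStep X δ)^[j] χ
    have hf1 : ∀ j, f (j + 1) = eulerStep X δ (f j) := fun j => by
      simp only [f, Function.iterate_succ', Function.comp]
    have hft : ∀ j, IsTest (f j) := fun j => by
      induction j with
      | zero => exact hχ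
      | succ j ih => rw [hf1]; exact hX.isTest_eulerStep δ ih
    have hf0 : ∀ j y, 0 ≤ f j y := fun j => by
      induction j with
      | zero => exact hχ0
      | succ j ih => rw [hf1]; exact fun y => ih _
    have hfG : ∀ j y w, |dir w (f j) y| ≤ (1 + x) ^ j * G * ‖w‖ := fun j => by
      induction j with
      | zero => intro y w; rw [pow_zero, one_mul]; exact hG1 y w
      | succ j ih =>
        intro y w
        rw [hf1, pow_succ']
        exact (hX.abs_fderiv_eulerStep_le δ (hft j) (by positivity) ih y w).trans_eq (by ring)
    have hfs : ∀ j ≤ k, ∀ y, f j y ≠ 0 → ‖y.2 - a₀‖ < r ∧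
        (1 - x) ^ j * (‖y.1 - c (τ j)‖ + (r + |δ| * M)) ≤ r + (r + |δ| * M) := by
      intro j
      induction j with
      | zero =>
        intro _ y hy
        have h1 := hχs y hy
        refine ⟨h1.2, ?_⟩
        have : τ 0 = s₂ := by simp [τ]
        rw [this, pow_zero, one_mul]
        linarith [h1.1]
      | succ j ih =>
        intro hj y hy
        rw [hf1] at hy
        have h1x : 0 ≤ 1 - x := by
          have : x ≤ k * x := le_mul_of_one_le_left hx0 (by exact_mod_cast hk)
          linarith
        have := hX.support_eulerStep (c := c) (a₀ := a₀) (s := τ (j + 1)) (s' := τ j) (r := r)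
          (κ := (1 - x) ^ j) hr.le (by positivity) (fun t ht => hc t (hτsub j (by omega) ht))
          (χ := f j) (S := r + (r + |δ| * M)) (by rw [hτ1]; exact ih (by omega)) y
          (by rw [hτ1]; exact hy)
        rw [hτ1] at this
        rw [pow_succ]
        exact this
    have hδr : |δ| * M ≤ r := by rw [hδa]; exact hkM
    -- As kx ≤ 1/2, Bernoulli's inequality gives (1 - x)^j ≥ 1/2, so the distance is at most 3r +
    -- |δ|M ≤ 4r. One more step of length at most r remains in the ball of radius 8r contained in K.
    have hfR : ∀ j ≤ k, ∀ y, f j y ≠ 0 → ‖y.2 - a₀‖ < r ∧ ‖y.1 - c (τ j)‖ ≤ 4 * r := by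
      intro j hj y hy
      obtain ⟨h1, h2⟩ := hfs j hj y hy
      refine ⟨h1, ?_⟩
      have hjx : (j : ℝ) * x ≤ 1 / 2 := by
        refine le_trans (mul_le_mul_of_nonneg_right ?_ hx0) hkx
        exact_mod_cast hj
      have hk1 : x ≤ 1 / 2 := by
        have : x ≤ k * x := le_mul_of_one_le_left hx0 (by exact_mod_cast hk)
        linarith
      have h3 : 1 / 2 ≤ (1 - x) ^ j := by
        have := one_add_mul_le_pow (a := -x) (by linarith) j
        rw [← sub_eq_add_neg] at this
        linarith
      have h4 : 1 / 2 * (‖y.1 - c (τ j)‖ + (r + |δ| * M)) ≤ r + (r + |δ| * M) :=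
        (mul_le_mul_of_nonneg_right h3 (by positivity)).trans h2
      linarith
    have hstep : ∀ j ≤ k, ‖densityIntegral ħ q p m Φ v μ χ s₂
        - densityIntegral ħ q p m Φ v μ (f j) (τ j)‖ ≤ j * (|δ| ^ 2 * B) := by
      intro j
      induction j with
      | zero => intro _; simp [f, τ]
      | succ j ih =>
        intro hj
        have h1 := ih (by omega)
        have h2 := hv.norm_densityIntegral_eulerStep_le μ hħ hmq hmp hX (hft j)
          (s := τ (j + 1)) (s' := τ j) ((hτsub j (by omega)).trans hT) hK hC hKO hCV
          (fun y hy => by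
            obtain ⟨h3, h4⟩ := hfR j (by omega) y hy
            refine ⟨fun z hz => hcK (τ j) (hτm _ (by omega)) ?_, hrC ?_⟩
            · rw [Metric.mem_closedBall] at hz ⊢
              rw [hτ1] at hz
              rw [← dist_eq_norm] at h4
              linarith [dist_triangle z y.1 (c (τ j))]
            · rw [Metric.mem_closedBall, dist_eq_norm]; exact h3.le)
          hD0 (fun t ht => hD t (hτsub j (by omega) ht)) (by positivity) (hfG j)
        rw [hτ1, ← hXdef, ← hf1] at h2
        -- The gradients stay below 2G through all steps, since (1 + x)^j ≤ exp(jx) ≤ exp(1/2); this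
        -- is the factor 2 in B.
        have h5 : (1 + x) ^ j ≤ 2 := by
          have h6 : (1 + x) ^ j ≤ (Real.exp x) ^ j := by
            gcongr
            linarith [Real.add_one_le_exp x]
          have h7 : (Real.exp x) ^ j ≤ Real.exp (1 / 2) := by
            rw [← Real.exp_nat_mul]
            refine Real.exp_le_exp.2 (le_trans (mul_le_mul_of_nonneg_right ?_ hx0) hkx)
            exact_mod_cast (by omega : j ≤ k)
          have h8 : Real.exp (1 / 2) ≤ 2 := by
            have h9 : Real.exp (1 / 2) ^ 2 ≤ 2 ^ 2 := by
              rw [← Real.exp_nat_mul]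
              have := Real.exp_one_lt_d9
              norm_num
              linarith
            exact (pow_le_pow_iff_left₀ (by positivity) (by positivity) (by norm_num)).1 h9
          linarith
        have h6 : D * (|δ| * (L * M) * ((1 + x) ^ j * G)) * μ.real K * |δ| ≤ |δ| ^ 2 * B := by
          calc D * (|δ| * (L * M) * ((1 + x) ^ j * G)) * μ.real K * |δ|
              ≤ D * (|δ| * (L * M) * (2 * G)) * μ.real K * |δ| := by gcongr
            _ = _ := by rw [hB]; ring
        have h7 := norm_add_le_of_le h1 (h2.trans h6)
        rw [sub_add_sub_cancel] at h7
        push_cast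
        linarith
    have hfin := hstep k le_rfl
    have hτk : τ k = s₁ := by simp only [τ]; linarith
    rw [hτk] at hfin
    have h1 := hpos (f k) (hft k) (hf0 k) (fun y hy => by
      obtain ⟨h3, h4⟩ := hfR k le_rfl y hy
      rw [hτk] at h4
      exact ⟨by linarith, by linarith⟩)
    have h2 := (Complex.abs_re_le_norm _).trans hfin
    rw [Complex.sub_re] at h2
    have h3 := (abs_le.1 h2).1
    have h4 : k * (|δ| ^ 2 * B) = d ^ 2 * B / k := by rw [hδa]; field_simp
    linarith
  have hlim : Filter.Tendsto (fun k : ℕ => -(d ^ 2 * B / k)) Filter.atTop (nhds 0) := by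
    have := (tendsto_const_div_atTop_nhds_zero_nat (d ^ 2 * B)).neg
    simpa using this
  have hlim2 : Filter.Tendsto (fun k : ℕ => d / k * M) Filter.atTop (nhds 0) := by
    have := (tendsto_const_div_atTop_nhds_zero_nat d).mul_const M
    simpa using this
  refine le_of_tendsto hlim ?_
  filter_upwards [Filter.eventually_gt_atTop 0, hlim2.eventually (ge_mem_nhds hr)] with k h1 h2
  exact main k h1 h2

end Propagation

end HybridQC
end

open scoped Manifold ContDiff ZeroAtInfty
noncomputable section
namespace HybridQC

/-! ### Pointwise against integrated positivity, and local transport in coordinates. -/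

section LocalPositivity

open MeasureTheory

variable {E : Type*} [NormedAddCommGroup E] [NormedSpace ℝ E]
variable {P : Type*} [NormedAddCommGroup P] [NormedSpace ℝ P] {n : ℕ}
variable {𝓗 : Type*} [NormedAddCommGroup 𝓗] [InnerProductSpace ℂ 𝓗] [CompleteSpace 𝓗]

/-- The density of the wave function `u` near `z₀` is nonnegative on nonnegative functions of the
quantum observables with support near `a₀`. -/
def IsPositiveNear (ħ : ℝ) (q p : Fin n → E) (m : Fin n → E →L[ℝ] ℝ)
    (Φ : C₀(P, ℂ) →⋆ₙₐ[ℂ] (𝓗 →L[ℂ] 𝓗)) (a₀ : P) (u : E → 𝓗) (z₀ : E) : Prop :=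
  ∃ r > 0, ∀ᶠ z in nhds z₀, ∀ g : P → ℝ, IsTest g → (∀ a, 0 ≤ g a) →
    (∀ a, g a ≠ 0 → ‖a - a₀‖ < r) → 0 ≤ (traceDensityAt ħ q p m u z (op Φ g)).re

variable {ħ : ℝ} {q p : Fin n → E} {m : Fin n → E →L[ℝ] ℝ}
  {Φ : C₀(P, ℂ) →⋆ₙₐ[ℂ] (𝓗 →L[ℂ] 𝓗)} {h : E × P → ℝ} {O : Set E} {V : Set P} {J : Set ℝ}
  {v : ℝ → E → 𝓗} {a₀ : P}

lemma IsTest.slice {f : E × P → ℝ} (hf : IsTest f) (z : E) : IsTest fun a => f (z, a) :=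
  ⟨hf.1.comp (by fun_prop), (hf.isCc.slice z).2⟩

lemma IsPositiveNear.re_densityIntegral_nonneg [MeasurableSpace E] (μ : Measure E) {s : ℝ} {z₀ : E}
    (hp : IsPositiveNear ħ q p m Φ a₀ (v s) z₀) :
    ∃ r > 0, ∀ χ : E × P → ℝ, IsTest χ → (∀ y, 0 ≤ χ y) →
      (∀ y, χ y ≠ 0 → ‖y.1 - z₀‖ < r ∧ ‖y.2 - a₀‖ < r) →
      0 ≤ (densityIntegral ħ q p m Φ v μ χ s).re := by
  obtain ⟨r₁, hr₁, h1⟩ := hp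
  obtain ⟨r₂, hr₂, h2⟩ := Metric.eventually_nhds_iff_ball.1 h1
  refine ⟨min r₁ r₂, lt_min hr₁ hr₂, fun χ hχ hχ0 hχs => ?_⟩
  unfold densityIntegral
  by_cases hi : Integrable (fun z => traceDensityAt ħ q p m (v s) z (op Φ fun a => χ (z, a))) μ
  · have h3 := integral_re hi
    change _ = (∫ z, traceDensityAt ħ q p m (v s) z (op Φ fun a => χ (z, a)) ∂μ).re at h3
    rw [← h3]
    refine integral_nonneg fun z => ?_
    change 0 ≤ (traceDensityAt ħ q p m (v s) z (op Φ fun a => χ (z, a))).re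
    by_cases hz : z ∈ Metric.ball z₀ r₂
    · exact h2 z hz _ (hχ.slice z) (fun a => hχ0 _) fun a ha =>
        (hχs _ ha).2.trans_le (min_le_left _ _)
    · have : (fun a => χ (z, a)) = fun _ => 0 := funext fun a => by
        by_contra hc
        refine hz ?_
        rw [Metric.mem_ball, dist_eq_norm]
        exact (hχs _ hc).1.trans_le (min_le_right _ _)
      rw [this, op_zero, traceDensityAt, traceDensity_zero]
      rfl
  -- A nonintegrable density has Bochner integral 0 by convention.
  · rw [integral_undef hi]
    rfl

lemma IsLocalSolution.continuousOn_traceDensityAt_const (hv : IsLocalSolution ħ q p m Φ h O V J v)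
    {s : ℝ} (hs : s ∈ J) (T : 𝓗 →L[ℂ] 𝓗) :
    ContinuousOn (fun z => traceDensityAt ħ q p m (v s) z T) O := by
  have hm : Set.MapsTo (fun z : E => (s, z)) O (J ×ˢ O) := fun z hz => ⟨hs, hz⟩
  have hp : ContinuousOn (fun z : E => (s, z)) O := by fun_prop
  have h0 : ContinuousOn (v s) O := hv.continuousOn.comp hp hm
  have h1 : ∀ w, ContinuousOn (fun z => fderiv ℝ (v s) z w) O :=
    fun w => (hv.continuousOn_fderiv w).comp hp hm
  have hI : ∀ {f g : E → 𝓗}, ContinuousOn f O → ContinuousOn g O →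
      ContinuousOn (fun x => inner ℂ (f x) (T (g x))) O :=
    fun hf hg => hf.inner (𝕜 := ℂ) (T.continuous.comp_continuousOn hg)
  unfold traceDensityAt traceDensity
  refine ((continuousOn_const.mul (hI h0 h0)).add (continuousOn_finsetSum _ fun i _ => ?_)).add
    (continuousOn_const.mul (continuousOn_finsetSum _ fun i _ => ?_))
  · refine ContinuousOn.mul ?_ ((hI h0 (h1 _)).add (hI (h1 _) h0))
    exact (Complex.continuous_ofReal.comp (m i).continuous).continuousOn
  · exact (hI (h1 _) (h1 _)).sub (hI (h1 _) (h1 _))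

variable [FiniteDimensional ℝ E] [FiniteDimensional ℝ P] [MeasurableSpace E] (μ : Measure E)
  [BorelSpace E] [μ.IsAddHaarMeasure]

/-- If the density tested with g were negative at one point, it would be negative nearby by
continuity, and the product of g with a bump in z would have negative integral. -/
lemma IsLocalSolution.isPositiveNear_of_densityIntegral
    (hv : IsLocalSolution ħ q p m Φ h O V J v) {s : ℝ} (hs : s ∈ J) {z₀ : E} (hz₀ : z₀ ∈ O) {r : ℝ}
    (hr : 0 < r) (hp : ∀ χ : E × P → ℝ, IsTest χ → (∀ y, 0 ≤ χ y) →
      (∀ y, χ y ≠ 0 → ‖y.1 - z₀‖ < r ∧ ‖y.2 - a₀‖ < r) →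
      0 ≤ (densityIntegral ħ q p m Φ v μ χ s).re) :
    IsPositiveNear ħ q p m Φ a₀ (v s) z₀ := by
  refine ⟨r, hr, ?_⟩
  filter_upwards [Metric.ball_mem_nhds z₀ hr, hv.isOpen_left.mem_nhds hz₀] with z hz hzO
  intro g hg hg0 hgs
  by_contra! hneg
  have hcont := (Complex.continuous_re.comp_continuousOn
    (hv.continuousOn_traceDensityAt_const hs (op Φ g))).continuousAt (hv.isOpen_left.mem_nhds hzO)
  have hW : ∀ᶠ w in nhds z, (traceDensityAt ħ q p m (v s) w (op Φ g)).re < 0 ∧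
      w ∈ Metric.ball z₀ r ∧ w ∈ O := by
    filter_upwards [hcont.eventually (gt_mem_nhds hneg), Metric.isOpen_ball.mem_nhds hz,
      hv.isOpen_left.mem_nhds hzO] with w h1 h2 h3
    exact ⟨h1, h2, h3⟩
  obtain ⟨U, hU, hUo, hzU⟩ := eventually_nhds_iff.1 hW
  obtain ⟨b, hb, hbs, hb1, hb01⟩ := exists_cutoff (isCompact_singleton (x := z)) hUo
    (Set.singleton_subset_iff.2 hzU)
  have hbz : b z = 1 := (hb1 z rfl).self_of_nhds
  have hbU : ∀ w, b w ≠ 0 → w ∈ U := fun w hw => hbs (subset_tsupport _ hw)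
  let F : E → ℂ := fun w => b w * traceDensityAt ħ q p m (v s) w (op Φ g)
  have hFc : Continuous F := by
    rw [continuous_iff_continuousAt]
    intro w
    by_cases hw : w ∈ tsupport b
    · exact (Complex.continuous_ofReal.comp hb.1.continuous).continuousAt.mul
        ((hv.continuousOn_traceDensityAt_const hs (op Φ g)).continuousAt
          (hv.isOpen_left.mem_nhds (hU w (hbs hw)).2.2))
    · have : F =ᶠ[nhds w] fun _ => 0 := by
        filter_upwards [notMem_tsupport_iff_eventuallyEq.1 hw] with y hy
        simp [F, hy]
      exact continuousAt_const.congr this.symm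
  have hFs : HasCompactSupport F := hb.2.mono fun w hw hc => hw (by simp [F, hc])
  have hχ : IsTest fun y : E × P => b y.1 * g y.2 := by
    refine ⟨(hb.1.comp (by fun_prop)).mul (hg.1.comp (by fun_prop)), ?_⟩
    refine HasCompactSupport.intro (hb.2.isCompact.prod hg.2.isCompact) fun y hy => ?_
    by_contra hc
    exact hy ⟨subset_tsupport _ (left_ne_zero_of_mul hc), subset_tsupport _ (right_ne_zero_of_mul hc)⟩
  have h1 := hp _ hχ (fun y => mul_nonneg (hb01 _).1 (hg0 _)) fun y hy =>
    ⟨by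
      have := (hU _ (hbU _ (left_ne_zero_of_mul hy))).2.1
      rwa [Metric.mem_ball, dist_eq_norm] at this, hgs _ (right_ne_zero_of_mul hy)⟩
  have h2 : densityIntegral ħ q p m Φ v μ (fun y => b y.1 * g y.2) s = ∫ w, F w ∂μ := by
    unfold densityIntegral
    congr 1
    funext w
    dsimp only
    rw [op_smul Φ hg.isCc]
    exact traceDensity_smul _ _ _ _ _ _ _
  rw [h2] at h1
  have h3 := integral_re (hFc.integrable_of_hasCompactSupport (μ := μ) hFs)
  change _ = (∫ w, F w ∂μ).re at h3
  rw [← h3] at h1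
  have hre : ∀ w, (F w).re = b w * (traceDensityAt ħ q p m (v s) w (op Φ g)).re := fun w =>
    Complex.re_ofReal_mul _ _
  have h4 : 0 < ∫ w, -(F w).re ∂μ := by
    refine Continuous.integral_pos_of_hasCompactSupport_nonneg_nonzero (x := z)
      (Complex.continuous_re.comp hFc).neg
      (hFs.mono fun w hw hc => hw (by simp [hc])) (fun w => ?_) ?_
    · change 0 ≤ -(F w).re
      rw [hre]
      by_cases hw : b w = 0
      · simp [hw]
      · have := (hU w (hbU w hw)).1
        exact neg_nonneg.2 (mul_nonpos_of_nonneg_of_nonpos (hb01 w).1 this.le)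
    · rw [hre, hbz, one_mul]
      exact neg_ne_zero.2 hneg.ne
  rw [integral_neg] at h4
  change 0 ≤ ∫ w, (F w).re ∂μ at h1
  linarith

/-- Local positivity is transported along the Hamiltonian trajectories. -/
theorem IsLocalSolution.exists_isPositiveNear_transport
    (hv : IsLocalSolution ħ q p m Φ h O V J v) (hJ : J.OrdConnected) (hh : HasCompactSupport h)
    (hħ : ħ ≠ 0) (hmq : ∀ i j, m i (q j) = 0) (hmp : ∀ i j, m i (p j) = if i = j then 1 else 0)
    {c : ℝ → E} {s₀ : ℝ} (hc : ∀ᶠ t in nhds s₀, HasDerivAt c (hamField q p h (c t, a₀)) t)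
    (hcO : c s₀ ∈ O) (ha₀ : a₀ ∈ V) :
    ∀ᶠ s₁ in nhds s₀, ∀ᶠ s₂ in nhds s₀, s₁ ∈ J → s₂ ∈ J →
      IsPositiveNear ħ q p m Φ a₀ (v s₁) (c s₁) → IsPositiveNear ħ q p m Φ a₀ (v s₂) (c s₂) := by
  let μ : Measure E := Measure.addHaar
  have : ProperSpace E := FiniteDimensional.proper ℝ E
  have : ProperSpace P := FiniteDimensional.proper ℝ P
  obtain ⟨M, L, hX⟩ := exists_isBoundedField_hamField (q := q) (p := p) (h := h) ⟨hv.contDiff, hh⟩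
  obtain ⟨R, hR, hRO⟩ := Metric.nhds_basis_closedBall.mem_iff.1 (hv.isOpen_left.mem_nhds hcO)
  obtain ⟨S, hS, hSV⟩ := Metric.nhds_basis_closedBall.mem_iff.1 (hv.isOpen_right.mem_nhds ha₀)
  have hcc : ContinuousAt c s₀ := hc.self_of_nhds.continuousAt
  have h1 := hcc.eventually (Metric.ball_mem_nhds (c s₀) (half_pos hR))
  have hL0 := hX.nonneg_right
  obtain ⟨ε, hε, hε1⟩ := Metric.eventually_nhds_iff_ball.1 (hc.and h1)
  -- Two times in the ball differ by at most 2d ≤ 1/(2(L + 1)), so that |s₂ - s₁|L ≤ 1/2 as the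
  -- Euler argument requires.
  set d := min ε (1 / (4 * (L + 1))) with hd
  have hd0 : 0 < d := lt_min hε (by positivity)
  have hb := Metric.ball_mem_nhds s₀ hd0
  filter_upwards [hb] with s₁ hs₁
  filter_upwards [hb] with s₂ hs₂
  intro hJ₁ hJ₂ hp
  have hsub : Set.uIcc s₁ s₂ ⊆ Metric.ball s₀ d :=
    (convex_ball s₀ d).ordConnected.uIcc_subset hs₁ hs₂
  have hsub' : Set.uIcc s₁ s₂ ⊆ Metric.ball s₀ ε :=
    hsub.trans (Metric.ball_subset_ball (min_le_left _ _))
  obtain ⟨r, hr, hr1⟩ := hp.re_densityIntegral_nonneg μ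
  -- The bound r/8 keeps the pulled-back supports in the region of known positivity. With R/16, the
  -- balls of radius 8ρ about the trajectory, itself within R/2 of its starting point, lie in the
  -- ball of radius R; S serves the spectral variable.
  set ρ := min (r / 8) (min (R / 16) S) with hρ
  have hρ0 : 0 < ρ := by positivity
  have hρr : 8 * ρ ≤ r := by linarith [min_le_left (r / 8) (min (R / 16) S)]
  have hρR : 8 * ρ ≤ R / 2 := by
    linarith [(min_le_right (r / 8) (min (R / 16) S)).trans (min_le_left _ _)]
  have hρS : ρ ≤ S := (min_le_right (r / 8) (min (R / 16) S)).trans (min_le_right _ _)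
  have hs₂' := hε1 s₂ (hsub' Set.right_mem_uIcc)
  refine hv.isPositiveNear_of_densityIntegral μ hJ₂ (hRO ?_) hρ0 fun χ hχ hχ0 hχs => ?_
  · have := hs₂'.2
    rw [Metric.mem_closedBall]
    linarith
  · refine hv.re_densityIntegral_nonneg μ hħ hmq hmp hX (hJ.uIcc_subset hJ₁ hJ₂)
      (isCompact_closedBall (c s₀) R) (isCompact_closedBall a₀ S) hRO hSV
      (fun t ht => (hε1 t (hsub' ht)).1) hρ0 (fun t ht => ?_) (Metric.closedBall_subset_closedBall hρS)
      ?_ (fun ψ hψ hψ0 hψs => hr1 ψ hψ hψ0 fun y hy => ?_) hχ hχ0 hχs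
    · refine Metric.closedBall_subset_closedBall' ?_
      have := (hε1 t (hsub' ht)).2
      linarith
    · have e1 : |s₂ - s₁| ≤ 2 * d := by
        rw [← Real.dist_eq]
        have a1 := Metric.mem_ball.1 hs₁
        have a2 := Metric.mem_ball.1 hs₂
        linarith [dist_triangle_right s₂ s₁ s₀]
      have e2 : d ≤ 1 / (4 * (L + 1)) := min_le_right _ _
      rw [le_div_iff₀ (by positivity)] at e2
      nlinarith [mul_le_mul_of_nonneg_right e1 hL0]
    · have := hψs y hy
      exact ⟨this.1.trans_le hρr, this.2.trans_le hρr⟩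

end LocalPositivity

end HybridQC
end

open scoped Manifold ContDiff ZeroAtInfty
noncomputable section
namespace HybridQC

/-! ### Linear algebra of cotangent lifts. -/

section Coordinates

variable {n : ℕ}

/-- The coordinate space of `T*Q`. -/
abbrev PhaseCoord (n : ℕ) : Type := Model n × (Model n →L[ℝ] ℝ)

/-- The coordinate direction `∂/∂qⁱ`. -/
def qDir (i : Fin n) : PhaseCoord n := (EuclideanSpace.single i 1, 0)

/-- The coordinate direction `∂/∂pᵢ`. -/
def pDir (i : Fin n) : PhaseCoord n := (0, EuclideanSpace.proj i)

/-- The momentum coordinate `pᵢ`. -/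
def momentumCoord (i : Fin n) : PhaseCoord n →L[ℝ] ℝ :=
  (ContinuousLinearMap.apply ℝ ℝ (EuclideanSpace.single i (1 : ℝ))).comp
    (ContinuousLinearMap.snd ℝ (Model n) (Model n →L[ℝ] ℝ))

lemma momentumCoord_apply (i : Fin n) (x : PhaseCoord n) :
    momentumCoord i x = x.2 (EuclideanSpace.single i 1) := rfl

lemma momentumCoord_qDir (i j : Fin n) : momentumCoord i (qDir j) = 0 := rfl

lemma momentumCoord_pDir (i j : Fin n) : momentumCoord i (pDir j) = if i = j then 1 else 0 := by
  simp [momentumCoord_apply, pDir, eq_comm]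

lemma sum_smul_single (v : Model n) : ∑ i, v i • EuclideanSpace.single i (1 : ℝ) = v := by
  ext j
  simp [Finset.sum_apply, Pi.single_apply]

lemma sum_smul_proj (l : Model n →L[ℝ] ℝ) :
    ∑ i, l (EuclideanSpace.single i 1) • (EuclideanSpace.proj i : Model n →L[ℝ] ℝ) = l := by
  ext v
  conv_rhs => rw [← sum_smul_single v, map_sum]
  simp [mul_comm]

lemma sum_momentumCoord_smul_pDir (x : PhaseCoord n) :
    ∑ i, momentumCoord i x • pDir i = (0, x.2) := by
  conv_rhs => rw [← sum_smul_proj x.2]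
  simp [pDir, momentumCoord_apply, Prod.ext_iff, Prod.fst_sum, Prod.snd_sum]

/-- The linear map `S` is the differential of the cotangent lift of a diffeomorphism of the
configuration space, and `A` is the differential of the inverse of the diffeomorphism. -/
structure IsCotangentLift (S : PhaseCoord n →L[ℝ] PhaseCoord n) (A : Model n →L[ℝ] Model n) :
    Prop where
  exists_eq : ∃ (B : Model n →L[ℝ] Model n) (Γ : Model n →L[ℝ] Model n →L[ℝ] ℝ),
    (∀ v, B (A v) = v) ∧ (∀ v w, Γ v w = Γ w v) ∧
      ∀ x, S x = (B x.1, x.2.comp A + Γ (B x.1))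

variable {M : Type*} [AddCommGroup M] [Module ℝ M]

/-- A cotangent lift leaves the Poisson bivector invariant. -/
theorem IsCotangentLift.sum_bilin {S : PhaseCoord n →L[ℝ] PhaseCoord n} {A : Model n →L[ℝ] Model n}
    (hS : IsCotangentLift S A) (β : PhaseCoord n →ₗ[ℝ] PhaseCoord n →ₗ[ℝ] M) :
    ∑ i, (β (S (qDir i)) (S (pDir i)) - β (S (pDir i)) (S (qDir i)))
      = ∑ i, (β (qDir i) (pDir i) - β (pDir i) (qDir i)) := by
  obtain ⟨B, Γ, hBA, hΓ, hS⟩ := hS.exists_eq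
  -- From BA = id, the vectors B eᵢ and the covectors eⁱ∘A are dual bases, and the canonical tensor
  -- ∑ eᵢ ⊗ eⁱ is the same in all dual bases.
  have key : ∀ b : Model n →ₗ[ℝ] (Model n →L[ℝ] ℝ) →ₗ[ℝ] M,
      ∑ i, b (B (EuclideanSpace.single i 1)) ((EuclideanSpace.proj i : Model n →L[ℝ] ℝ).comp A)
        = ∑ i, b (EuclideanSpace.single i 1) (EuclideanSpace.proj i) := by
    intro b
    have h1 : ∀ i, b (B (EuclideanSpace.single i 1))
        ((EuclideanSpace.proj i : Model n →L[ℝ] ℝ).comp A)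
        = ∑ k, b (B ((A (EuclideanSpace.single k 1)) i • EuclideanSpace.single i (1 : ℝ)))
          (EuclideanSpace.proj k) := by
      intro i
      conv_lhs => rw [← sum_smul_proj ((EuclideanSpace.proj i : Model n →L[ℝ] ℝ).comp A), map_sum]
      refine Finset.sum_congr rfl fun k _ => ?_
      simp
    simp only [h1]
    rw [Finset.sum_comm]
    refine Finset.sum_congr rfl fun k _ => ?_
    rw [← LinearMap.sum_apply, ← map_sum, ← map_sum, sum_smul_single, hBA]
  let j : Model n →ₗ[ℝ] PhaseCoord n := LinearMap.id.prod Γ.toLinearMap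
  let k : (Model n →L[ℝ] ℝ) →ₗ[ℝ] PhaseCoord n := LinearMap.inr ℝ _ _
  have h1 := key (β.compl₁₂ j k - (β.flip.compl₁₂ j k))
  have h2 : ∀ i, S (qDir i) = j (B (EuclideanSpace.single i 1)) := fun i => by
    rw [hS]; simp [qDir, j]
  have h3 : ∀ i, S (pDir i) = k ((EuclideanSpace.proj i : Model n →L[ℝ] ℝ).comp A) := fun i => by
    rw [hS]; simp [pDir, k]
  have h4 : ∀ i, j (EuclideanSpace.single i 1)
      = qDir i + ∑ l, Γ (EuclideanSpace.single i 1) (EuclideanSpace.single l 1) • pDir l := fun i => by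
    conv_lhs => rw [← zero_add (j _)]
    simp only [j, qDir, pDir, LinearMap.prod_apply, Prod.smul_mk, smul_zero]
    conv_lhs => rw [zero_add]
    refine Prod.ext ?_ ?_
    · simp [Prod.fst_sum]
    · simp only [Prod.snd_add, Prod.snd_sum, zero_add]
      exact (sum_smul_proj _).symm
  have h5 : ∀ i, k (EuclideanSpace.proj i) = pDir i := fun i => rfl
  simp only [LinearMap.sub_apply, LinearMap.compl₁₂_apply, LinearMap.flip_apply] at h1
  simp only [h2, h3, h1, h4, h5, map_add, LinearMap.add_apply, map_sum, LinearMap.sum_apply,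
    map_smul, LinearMap.smul_apply]
  -- The shear by Γ contributes only p-p terms, which cancel after antisymmetrization because Γ is
  -- symmetric.
  have h6 : ∀ i, (β (qDir i) (pDir i)
      + ∑ l, Γ (EuclideanSpace.single i 1) (EuclideanSpace.single l 1) • β (pDir l) (pDir i))
      - (β (pDir i) (qDir i)
        + ∑ l, Γ (EuclideanSpace.single i 1) (EuclideanSpace.single l 1) • β (pDir i) (pDir l))
      = (β (qDir i) (pDir i) - β (pDir i) (qDir i))
        + (∑ l, Γ (EuclideanSpace.single i 1) (EuclideanSpace.single l 1) • β (pDir l) (pDir i)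
          - ∑ l, Γ (EuclideanSpace.single i 1) (EuclideanSpace.single l 1) • β (pDir i) (pDir l)) :=
    fun i => by abel
  simp only [h6]
  rw [Finset.sum_add_distrib, Finset.sum_sub_distrib (f := fun i => ∑ l, _), add_eq_left,
    sub_eq_zero, Finset.sum_comm]
  refine Finset.sum_congr rfl fun l _ => Finset.sum_congr rfl fun i _ => ?_
  rw [hΓ]

lemma IsCotangentLift.apply_momentum {S : PhaseCoord n →L[ℝ] PhaseCoord n}
    {A : Model n →L[ℝ] Model n} (hS : IsCotangentLift S A) (l : Model n →L[ℝ] ℝ) :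
    S (0, l) = (0, l.comp A) := by
  obtain ⟨B, Γ, -, -, h⟩ := hS.exists_eq
  rw [h]; simp

end Coordinates
end HybridQC
end

open scoped Manifold ContDiff ZeroAtInfty
noncomputable section
namespace HybridQC

lemma two_le_infty : (2 : ℕ∞ω) ≤ ∞ := WithTop.coe_le_coe.2 le_top

/-! ### Canonical coordinates on T*Q change by cotangent lifts. -/

section Charts

variable {n : ℕ} {Q : Type*} [TopologicalSpace Q] [ChartedSpace (Model n) Q]
  [IsManifold 𝓘(ℝ, Model n) ∞ Q]

/-- The covector of a point of `T*Q`, in the preferred chart at its base point. -/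
def covector (z : PhaseSpace n Q) : Model n →L[ℝ] ℝ := z.snd

/-- The canonical coordinates induced by the preferred chart at `x₀`. -/
def phaseChart (z₀ : PhaseSpace n Q) : PartialEquiv (PhaseSpace n Q) (PhaseCoord n) :=
  extChartAt (phaseModel n) z₀

lemma mem_phaseChart_source {z₀ z : PhaseSpace n Q} :
    z ∈ (phaseChart z₀).source ↔ z.proj ∈ (chartAt (Model n) z₀.proj).source := by
  unfold phaseChart
  rw [FiberBundle.extChartAt]
  simp only [mfld_simps]
  have h1 := hom_trivializationAt_apply (RingHom.id ℝ) (E₁ := (TangentSpace 𝓘(ℝ, Model n) : Q → Type _))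
    (E₂ := Bundle.Trivial Q ℝ) (F₁ := Model n) (F₂ := ℝ) z₀.proj z
  simp
  intro h
  rw [h1]
  exact h

lemma phaseChart_apply {z₀ z : PhaseSpace n Q} (hz : z ∈ (phaseChart z₀).source) :
    phaseChart z₀ z = (extChartAt 𝓘(ℝ, Model n) z₀.proj z.proj,
      (covector z).comp
        (tangentCoordChange 𝓘(ℝ, Model n) z₀.proj z.proj z.proj)) := by
  rw [mem_phaseChart_source] at hz
  unfold phaseChart
  rw [FiberBundle.extChartAt]
  have h1 := hom_trivializationAt_apply (RingHom.id ℝ) (E₁ := (TangentSpace 𝓘(ℝ, Model n) : Q → Type _))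
    (E₂ := Bundle.Trivial Q ℝ) (F₁ := Model n) (F₂ := ℝ) z₀.proj z
  simp only [PartialEquiv.coe_trans, Function.comp, PartialEquiv.prod_coe, PartialEquiv.refl_coe, id]
  change ((extChartAt 𝓘(ℝ, Model n) z₀.proj) (trivializationAt (Model n →L[ℝ] ℝ)
    (fun q : Q => TangentSpace 𝓘(ℝ, Model n) q →L[ℝ] Bundle.Trivial Q ℝ q) z₀.proj z).1, _) = _
  refine Prod.ext ?_ ?_
  · dsimp only
    rw [h1]
  · change (trivializationAt (Model n →L[ℝ] ℝ)
      (fun q : Q => TangentSpace 𝓘(ℝ, Model n) q →L[ℝ] Bundle.Trivial Q ℝ q) z₀.proj z).2 = _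
    rw [h1]
    dsimp only
    rw [ContinuousLinearMap.inCoordinates, TangentBundle.symmL_trivializationAt_eq_core hz]
    simp
    rfl

/-- The cotangent lift of `τ`, where `σ` is the inverse of `τ`. -/
def cotangentLift (τ σ : Model n → Model n) (x : PhaseCoord n) : PhaseCoord n :=
  (τ x.1, x.2.comp (fderiv ℝ σ (τ x.1)))

/-- The shear term is Γ(v, w) = p(D²σ(v, w)), symmetric because σ is C². Differentiating τ∘σ = id
gives BA = id. -/
lemma exists_hasFDerivAt_cotangentLift {τ σ : Model n → Model n} {x : PhaseCoord n}
    (hτ : DifferentiableAt ℝ τ x.1) (hσ : ContDiffAt ℝ 2 σ (τ x.1))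
    (hστ : σ (τ x.1) = x.1) (hτσ : ∀ᶠ y in nhds (τ x.1), τ (σ y) = y) :
    ∃ S, HasFDerivAt (cotangentLift τ σ) S x ∧ IsCotangentLift S (fderiv ℝ σ (τ x.1)) := by
  have h1 : HasFDerivAt (fun x : PhaseCoord n => τ x.1)
      ((fderiv ℝ τ x.1).comp (ContinuousLinearMap.fst ℝ _ _)) x :=
    hτ.hasFDerivAt.comp x hasFDerivAt_fst
  have hσ1 : DifferentiableAt ℝ (fderiv ℝ σ) (τ x.1) :=
    (hσ.fderiv_right (m := 1) (by norm_num)).differentiableAt (by norm_num)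
  have h2 := hσ1.hasFDerivAt.comp x h1
  have h3 := h1.prodMk ((hasFDerivAt_snd (𝕜 := ℝ) (p := x)).clm_comp h2)
  refine ⟨_, h3, ⟨⟨fderiv ℝ τ x.1, (ContinuousLinearMap.compL ℝ _ _ ℝ x.2).comp
    (fderiv ℝ (fderiv ℝ σ) (τ x.1)), fun v => ?_, fun v w => ?_, fun y => ?_⟩⟩⟩
  · rw [← hστ] at hτ
    have h4 := (hτ.hasFDerivAt.comp (τ x.1) (hσ.differentiableAt (by norm_num)).hasFDerivAt)
    have h5 : HasFDerivAt (fun y => y) _ (τ x.1) :=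
      h4.congr_of_eventuallyEq (hτσ.mono fun y hy => hy.symm)
    have h6 := h5.unique (hasFDerivAt_id _)
    rw [hστ] at h6
    exact congrArg (fun L : Model n →L[ℝ] Model n => L v) h6
  · have := hσ.isSymmSndFDerivAt (by simp)
    simp [this.eq v w]
  · refine Prod.ext rfl ?_
    ext v
    simp [add_comm]

lemma phaseChart_eq_cotangentLift {z₀ z w : PhaseSpace n Q} (h₀ : w ∈ (phaseChart z₀).source)
    (h : w ∈ (phaseChart z).source) :
    phaseChart z₀ w = cotangentLift
      (extChartAt 𝓘(ℝ, Model n) z₀.proj ∘ (extChartAt 𝓘(ℝ, Model n) z.proj).symm)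
      (extChartAt 𝓘(ℝ, Model n) z.proj ∘ (extChartAt 𝓘(ℝ, Model n) z₀.proj).symm)
      (phaseChart z w) := by
  rw [phaseChart_apply h₀, phaseChart_apply h]
  rw [mem_phaseChart_source, ← extChartAt_source 𝓘(ℝ, Model n)] at h₀ h
  have h1 : (extChartAt 𝓘(ℝ, Model n) z.proj).symm (extChartAt 𝓘(ℝ, Model n) z.proj w.proj)
      = w.proj := PartialEquiv.left_inv _ h
  simp only [cotangentLift, Function.comp_apply, h1]
  refine Prod.ext rfl ?_
  have h2 : fderiv ℝ (extChartAt 𝓘(ℝ, Model n) z.proj ∘ (extChartAt 𝓘(ℝ, Model n) z₀.proj).symm)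
      (extChartAt 𝓘(ℝ, Model n) z₀.proj w.proj)
      = tangentCoordChange 𝓘(ℝ, Model n) z₀.proj z.proj w.proj := by
    rw [tangentCoordChange_def]
    simp
  rw [h2, ContinuousLinearMap.comp_assoc]
  congr 2
  ext1 v
  exact congrArg (covector w) (tangentCoordChange_comp ⟨⟨h₀, h⟩, mem_extChartAt_source w.proj⟩).symm

/-- The differential of canonical coordinates is a cotangent lift. -/
theorem exists_isCotangentLift {z₀ z : PhaseSpace n Q} (hz : z ∈ (phaseChart z₀).source) :
    ∃ (S : PhaseCoord n →L[ℝ] PhaseCoord n) (A : Model n →L[ℝ] Model n), IsCotangentLift S A ∧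
      mfderiv (phaseModel n) 𝓘(ℝ, PhaseCoord n) (phaseChart z₀) z = S ∧
      (phaseChart z₀ z).2 = (covector z).comp A := by
  set I := 𝓘(ℝ, Model n) with hI
  have hzz : z ∈ (phaseChart z).source := mem_extChartAt_source z
  have h₀ : z.proj ∈ (extChartAt I z₀.proj).source := by
    rw [extChartAt_source]; exact mem_phaseChart_source.1 hz
  have h1 : z.proj ∈ (extChartAt I z.proj).source := mem_extChartAt_source z.proj
  have hp := phaseChart_apply hzz
  have hp1 : (phaseChart z z).1 = extChartAt I z.proj z.proj := by rw [hp]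
  have hp2 : (phaseChart z z).2 = covector z := by
    rw [hp]
    ext v
    change (covector z) (tangentCoordChange I z.proj z.proj z.proj v) = _
    rw [tangentCoordChange_self h1]
  have hcc : ∀ {x y : Q}, z.proj ∈ (extChartAt I x).source → z.proj ∈ (extChartAt I y).source →
      ContDiffAt ℝ 2 (extChartAt I y ∘ (extChartAt I x).symm) (extChartAt I x z.proj) := by
    intro x y hx hy
    have : IsManifold I 2 Q := IsManifold.of_le (n := ∞) two_le_infty
    have := contDiffWithinAt_ext_coord_change (I := I) (n := 2) y x (y := extChartAt I x z.proj) (by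
      rw [PartialEquiv.trans_source, PartialEquiv.symm_source, Set.mem_inter_iff, Set.mem_preimage,
        PartialEquiv.left_inv _ hx]
      exact ⟨PartialEquiv.map_source _ hx, hy⟩)
    simpa [hI, contDiffWithinAt_univ] using this
  obtain ⟨S, hS, hSA⟩ := exists_hasFDerivAt_cotangentLift (x := phaseChart z z)
    (τ := extChartAt I z₀.proj ∘ (extChartAt I z.proj).symm)
    (σ := extChartAt I z.proj ∘ (extChartAt I z₀.proj).symm)
    (by rw [hp1]; exact (hcc h1 h₀).differentiableAt (by norm_num))
    (by
      rw [hp1, Function.comp_apply, PartialEquiv.left_inv _ h1]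
      exact hcc h₀ h1)
    (by
      rw [hp1]
      simp only [Function.comp_apply]
      rw [PartialEquiv.left_inv _ h1, PartialEquiv.left_inv _ h₀])
    (by
      rw [hp1, Function.comp_apply, PartialEquiv.left_inv _ h1]
      have h2 : ContinuousAt (extChartAt I z₀.proj).symm (extChartAt I z₀.proj z.proj) :=
        continuousAt_extChartAt_symm' h₀
      have h3 := h2.preimage_mem_nhds (t := (extChartAt I z.proj).source) (by
        rw [PartialEquiv.left_inv _ h₀]
        exact extChartAt_source_mem_nhds z.proj)
      have h4 : (extChartAt I z₀.proj).target ∈ nhds (extChartAt I z₀.proj z.proj) :=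
        (isOpen_extChartAt_target z₀.proj).mem_nhds (PartialEquiv.map_source _ h₀)
      filter_upwards [h3, h4] with y hy hy'
      simp only [Function.comp_apply]
      rw [PartialEquiv.left_inv _ hy, PartialEquiv.right_inv _ hy'])
  refine ⟨S, _, hSA, ?_, ?_⟩
  · have h5 : MDifferentiableAt (phaseModel n) 𝓘(ℝ, PhaseCoord n) (phaseChart z₀) z :=
      mdifferentiableAt_extChartAt (by rwa [← extChartAt_source (phaseModel n)])
    rw [h5.mfderiv]
    -- In the preferred coordinates at z the chart at z₀ is, near z, the cotangent lift of the
    -- transition map of Q, so its manifold derivative is the ordinary derivative of that lift.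
    have h6 : writtenInExtChartAt (phaseModel n) 𝓘(ℝ, PhaseCoord n) z (phaseChart z₀)
        =ᶠ[nhds (phaseChart z z)] cotangentLift
          (extChartAt I z₀.proj ∘ (extChartAt I z.proj).symm)
          (extChartAt I z.proj ∘ (extChartAt I z₀.proj).symm) := by
      have h7 : ContinuousAt (phaseChart z).symm (phaseChart z z) :=
        continuousAt_extChartAt_symm' hzz
      have h8 := h7.preimage_mem_nhds (t := (phaseChart z₀).source) (by
        rw [PartialEquiv.left_inv _ hzz]
        exact extChartAt_source_mem_nhds' hz)
      have h9 : (phaseChart z).target ∈ nhds (phaseChart z z) :=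
        (isOpen_extChartAt_target z).mem_nhds (PartialEquiv.map_source _ hzz)
      filter_upwards [h8, h9] with y hy hy'
      have := phaseChart_eq_cotangentLift hy (PartialEquiv.map_target _ hy')
      rw [PartialEquiv.right_inv _ hy'] at this
      exact this
    have h7 := h6.fderiv_eq.trans hS.fderiv
    rw [← fderivWithin_univ] at h7
    rw [← h7]
    congr 1
    simp
  · rw [phaseChart_eq_cotangentLift hz hzz]
    simp only [cotangentLift, hp2]
    rfl

end Charts
end HybridQC
end

open scoped Manifold ContDiff ZeroAtInfty
noncomputable section
namespace HybridQC

/-! ### Phase-space expressions computed in a fixed canonical chart. -/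

section ChartFormulas

variable {n : ℕ} {Q : Type*} [TopologicalSpace Q] [ChartedSpace (Model n) Q]
  [IsManifold 𝓘(ℝ, Model n) ∞ Q]
variable {F : Type*} [NormedAddCommGroup F] [NormedSpace ℝ F]
variable {𝓗 : Type*} [NormedAddCommGroup 𝓗] [InnerProductSpace ℂ 𝓗]

lemma dq_eq (i : Fin n) (f : PhaseSpace n Q → F) (z : PhaseSpace n Q) :
    dq i f z = coordDeriv f z (qDir i) := rfl

lemma dp_eq (i : Fin n) (f : PhaseSpace n Q → F) (z : PhaseSpace n Q) :
    dp i f z = coordDeriv f z (pDir i) := rfl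

/-- The sum is the derivative along the vertical vector with components the covector itself, and
cotangent lifts respect this vector. -/
lemma sum_momentum_smul_dp (f : PhaseSpace n Q → F) (z : PhaseSpace n Q) :
    ∑ i, momentum z i • dp i f z = coordDeriv f z (0, covector z) := by
  have := sum_momentumCoord_smul_pDir ((0, covector z) : PhaseCoord n)
  rw [← this, map_sum]
  simp only [map_smul]
  rfl

/-- The linear map `S` is the differential at `z` of the canonical coordinates around `z₀`. -/
structure IsChartDifferential (z₀ z : PhaseSpace n Q) (S : PhaseCoord n →L[ℝ] PhaseCoord n)
    (A : Model n →L[ℝ] Model n) : Prop where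
  mem_source : z ∈ (phaseChart z₀).source
  isCotangentLift : IsCotangentLift S A
  mfderiv_eq : mfderiv (phaseModel n) 𝓘(ℝ, PhaseCoord n) (phaseChart z₀) z = S
  snd_eq : (phaseChart z₀ z).2 = (covector z).comp A

lemma exists_isChartDifferential {z₀ z : PhaseSpace n Q} (hz : z ∈ (phaseChart z₀).source) :
    ∃ S A, IsChartDifferential z₀ z S A := by
  obtain ⟨S, A, h1, h2, h3⟩ := exists_isCotangentLift hz
  exact ⟨S, A, hz, h1, h2, h3⟩

lemma phaseChart_symm_apply {z₀ z : PhaseSpace n Q} (hz : z ∈ (phaseChart z₀).source) :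
    (phaseChart z₀).symm (phaseChart z₀ z) = z := PartialEquiv.left_inv _ hz

lemma mdifferentiableAt_phaseChart {z₀ z : PhaseSpace n Q} (hz : z ∈ (phaseChart z₀).source) :
    MDifferentiableAt (phaseModel n) 𝓘(ℝ, PhaseCoord n) (phaseChart z₀) z :=
  mdifferentiableAt_extChartAt (by rwa [← extChartAt_source (phaseModel n)])

namespace IsChartDifferential

variable {z₀ z : PhaseSpace n Q} {S : PhaseCoord n →L[ℝ] PhaseCoord n}
  {A : Model n →L[ℝ] Model n}

lemma coordDeriv_eq (hS : IsChartDifferential z₀ z S A) {f : PhaseSpace n Q → F}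
    (hf : MDifferentiableAt (phaseModel n) 𝓘(ℝ, F) f z) :
    coordDeriv f z = (fderiv ℝ (f ∘ (phaseChart z₀).symm) (phaseChart z₀ z)).comp S := by
  have hz := hS.mem_source
  have h1 : MDifferentiableAt 𝓘(ℝ, PhaseCoord n) (phaseModel n) (phaseChart z₀).symm
      (phaseChart z₀ z) :=
    ((contMDiffOn_extChartAt_symm (n := 1) z₀).mdifferentiableOn (by simp)
      (phaseChart z₀ z) (PartialEquiv.map_source _ hz)).mdifferentiableAt
      ((isOpen_extChartAt_target z₀).mem_nhds (PartialEquiv.map_source _ hz))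
  have h2 : MDifferentiableAt 𝓘(ℝ, PhaseCoord n) 𝓘(ℝ, F) (f ∘ (phaseChart z₀).symm)
      (phaseChart z₀ z) :=
    MDifferentiableAt.comp (phaseChart z₀ z) (by rwa [phaseChart_symm_apply hz]) h1
  have h3 : f =ᶠ[nhds z] (f ∘ (phaseChart z₀).symm) ∘ phaseChart z₀ := by
    filter_upwards [extChartAt_source_mem_nhds' (I := phaseModel n) hz] with w hw
    simp only [Function.comp_apply]
    rw [phaseChart_symm_apply hw]
  unfold coordDeriv
  rw [h3.mfderiv_eq, mfderiv_comp z h2 (mdifferentiableAt_phaseChart hz), mfderiv_eq_fderiv,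
    hS.mfderiv_eq]
  rfl

variable {f : PhaseSpace n Q → F}

lemma coordDeriv_momentum (hS : IsChartDifferential z₀ z S A)
    (hf : MDifferentiableAt (phaseModel n) 𝓘(ℝ, F) f z) :
    ∑ i, momentum z i • dp i f z = ∑ i, momentumCoord i (phaseChart z₀ z) •
      fderiv ℝ (f ∘ (phaseChart z₀).symm) (phaseChart z₀ z) (pDir i) := by
  rw [sum_momentum_smul_dp, hS.coordDeriv_eq hf, ContinuousLinearMap.comp_apply,
    hS.isCotangentLift.apply_momentum, ← hS.snd_eq, ← sum_momentumCoord_smul_pDir, map_sum]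
  simp only [map_smul]

lemma lagrangian_eq (hS : IsChartDifferential z₀ z S A) {h : PhaseSpace n Q → ℝ}
    (hh : MDifferentiableAt (phaseModel n) 𝓘(ℝ, ℝ) h z) :
    lagrangian h z = ∑ i, momentumCoord i (phaseChart z₀ z) *
      fderiv ℝ (h ∘ (phaseChart z₀).symm) (phaseChart z₀ z) (pDir i) - h z := by
  have := hS.coordDeriv_momentum hh
  simp only [smul_eq_mul] at this
  rw [lagrangian, this]

lemma hamiltonianVectorField_eq (hS : IsChartDifferential z₀ z S A) {h : PhaseSpace n Q → ℝ}
    (hh : MDifferentiableAt (phaseModel n) 𝓘(ℝ, ℝ) h z) :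
    S (hamiltonianVectorField h z) =
      ∑ i, (fderiv ℝ (h ∘ (phaseChart z₀).symm) (phaseChart z₀ z) (pDir i) • qDir i
        - fderiv ℝ (h ∘ (phaseChart z₀).symm) (phaseChart z₀ z) (qDir i) • pDir i) := by
  set D := fderiv ℝ (h ∘ (phaseChart z₀).symm) (phaseChart z₀ z)
  have h1 : (hamiltonianVectorField h z : PhaseCoord n)
      = ∑ i, (dp i h z • qDir i - dq i h z • pDir i) := by
    simp only [hamiltonianVectorField, qDir, pDir]
    refine Prod.ext ?_ ?_
    · simp [Prod.fst_sum]
    · simp [Prod.snd_sum]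
  -- Contracting one leg of the Poisson bivector with dh gives X_h, so invariance of the bivector
  -- transports the vector field.
  let β : PhaseCoord n →ₗ[ℝ] PhaseCoord n →ₗ[ℝ] PhaseCoord n :=
    LinearMap.mk₂ ℝ (fun x y => D y • x) (fun _ _ _ => smul_add _ _ _)
      (fun _ _ _ => smul_comm _ _ _) (fun _ _ _ => by rw [map_add, add_smul])
      (fun _ _ _ => by rw [map_smul, smul_eq_mul, mul_smul])
  have h2 := hS.isCotangentLift.sum_bilin β
  simp only [β, LinearMap.mk₂_apply] at h2
  rw [← h2]
  refine (congrArg S h1).trans ?_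
  rw [map_sum]
  refine Finset.sum_congr rfl fun i _ => ?_
  rw [map_sub, map_smul, map_smul, dq_eq, dp_eq, hS.coordDeriv_eq hh]
  rfl

/-- The momentum terms depend on the chart only through the derivative along p∂/∂p, and the bracket
term only through the Poisson bivector; both are invariant under cotangent lifts. -/
lemma traceDensity_eq (hS : IsChartDifferential z₀ z S A) {u : PhaseSpace n Q → 𝓗}
    (hu : MDifferentiableAt (phaseModel n) 𝓘(ℝ, 𝓗) u z) (ħ : ℝ) (T : 𝓗 →L[ℂ] 𝓗) :
    traceDensity ħ (momentum z) (u z) (fun i => dq i u z) (fun i => dp i u z) T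
      = traceDensityAt ħ qDir pDir momentumCoord (u ∘ (phaseChart z₀).symm) (phaseChart z₀ z) T := by
  set D := fderiv ℝ (u ∘ (phaseChart z₀).symm) (phaseChart z₀ z) with hD
  have h0 : (u ∘ (phaseChart z₀).symm) (phaseChart z₀ z) = u z := by
    rw [Function.comp_apply, phaseChart_symm_apply hS.mem_source]
  have h1 := hS.coordDeriv_momentum hu
  have h2 : ∀ (m : Fin n → ℝ) (w : Fin n → 𝓗), ∑ i, (m i : ℂ) * (inner ℂ (u z) (T (w i))
      + inner ℂ (w i) (T (u z)))
      = inner ℂ (u z) (T (∑ i, m i • w i)) + inner ℂ (∑ i, m i • w i) (T (u z)) := by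
    intro m w
    rw [map_sum, inner_sum, sum_inner, ← Finset.sum_add_distrib]
    refine Finset.sum_congr rfl fun i _ => ?_
    rw [← Complex.coe_smul, map_smul, inner_smul_right, inner_smul_left, Complex.conj_ofReal]
    ring
  let β : PhaseCoord n →ₗ[ℝ] PhaseCoord n →ₗ[ℝ] ℂ :=
    LinearMap.mk₂ ℝ (fun x y => inner ℂ (D y) (T (D x)))
      (fun _ _ _ => by rw [map_add, map_add, inner_add_right])
      (fun _ _ _ => by
        rw [map_smul, ← Complex.coe_smul, map_smul, inner_smul_right, Complex.real_smul])
      (fun _ _ _ => by rw [map_add, inner_add_left])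
      (fun _ _ _ => by
        rw [map_smul, ← Complex.coe_smul, inner_smul_left, Complex.conj_ofReal, Complex.real_smul])
  have h3 := hS.isCotangentLift.sum_bilin β
  simp only [β, LinearMap.mk₂_apply] at h3
  have h4 : ∀ w, coordDeriv u z w = D (S w) := fun w => by rw [hS.coordDeriv_eq hu]; rfl
  simp only [dp_eq, h4, ← hD] at h1
  simp only [traceDensityAt, traceDensity, h0, h2, h1, ← hD, dq_eq, dp_eq, ← h3, h4]

end IsChartDifferential

end ChartFormulas

end HybridQC
end

open scoped Manifold ContDiff ZeroAtInfty
noncomputable section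
namespace HybridQC

/-! ### The hybrid wave equation in canonical coordinates. -/

section LocalForm

variable {n N : ℕ} {Q : Type*} [TopologicalSpace Q] [ChartedSpace (Model n) Q]
  [IsManifold 𝓘(ℝ, Model n) ∞ Q]
variable {𝓗 : Type*} [NormedAddCommGroup 𝓗] [InnerProductSpace ℂ 𝓗] [CompleteSpace 𝓗]

/-- The function `h` on a coordinate space represents the Hamiltonian `H` on `O × V`. -/
structure IsLocalHamiltonian (z₀ : PhaseSpace n Q) (H : PhaseSpace n Q → (Fin N → ℝ) → ℝ)
    (h : PhaseCoord n × (Fin N → ℝ) → ℝ) (O : Set (PhaseCoord n)) (V : Set (Fin N → ℝ)) :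
    Prop where
  contDiff : ContDiff ℝ ∞ h
  isOpen_left : IsOpen O
  isOpen_right : IsOpen V
  subset_target : O ⊆ (phaseChart z₀).target
  eq_on : ∀ x ∈ O, ∀ a ∈ V, h (x, a) = H ((phaseChart z₀).symm x) a

lemma isOpen_phaseChart_target (z₀ : PhaseSpace n Q) : IsOpen (phaseChart z₀).target :=
  isOpen_extChartAt_target z₀

lemma isOpen_phaseChart_source (z₀ : PhaseSpace n Q) : IsOpen (phaseChart z₀).source :=
  isOpen_extChartAt_source z₀

lemma contMDiffOn_phaseChart_symm (z₀ : PhaseSpace n Q) :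
    ContMDiffOn 𝓘(ℝ, PhaseCoord n) (phaseModel n) ∞ (phaseChart z₀).symm
      (phaseChart z₀).target :=
  contMDiffOn_extChartAt_symm z₀

variable {H : PhaseSpace n Q → (Fin N → ℝ) → ℝ}

lemma mdifferentiableAt_hamiltonian
    (hH : ContMDiff ((phaseModel n).prod 𝓘(ℝ, Fin N → ℝ)) 𝓘(ℝ, ℝ) ∞
      (fun x : PhaseSpace n Q × (Fin N → ℝ) => H x.1 x.2)) (a : Fin N → ℝ) (z : PhaseSpace n Q) :
    MDifferentiableAt (phaseModel n) 𝓘(ℝ, ℝ) (fun w => H w a) z := by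
  have h1 : ContMDiff (phaseModel n) ((phaseModel n).prod 𝓘(ℝ, Fin N → ℝ)) ∞
      (fun w : PhaseSpace n Q => (w, a)) := contMDiff_id.prodMk contMDiff_const
  exact (hH.comp h1).mdifferentiableAt (by simp)

/-- Multiplying H in coordinates by a cutoff that is 1 near (x₁, a₀) gives a global smooth h of
compact support. Its Hamiltonian field is bounded with bounded derivative, as the Euler scheme
needs. -/
lemma exists_isLocalHamiltonian
    (hH : ContMDiff ((phaseModel n).prod 𝓘(ℝ, Fin N → ℝ)) 𝓘(ℝ, ℝ) ∞
      (fun x : PhaseSpace n Q × (Fin N → ℝ) => H x.1 x.2)) (z₀ : PhaseSpace n Q)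
    {x₁ : PhaseCoord n} (hx₁ : x₁ ∈ (phaseChart z₀).target) (a₀ : Fin N → ℝ) :
    ∃ h O V, IsLocalHamiltonian z₀ H h O V ∧ HasCompactSupport h ∧ x₁ ∈ O ∧ a₀ ∈ V := by
  have hU : IsOpen ((phaseChart z₀).target ×ˢ (Set.univ : Set (Fin N → ℝ))) :=
    (isOpen_phaseChart_target z₀).prod isOpen_univ
  obtain ⟨κ, hκ, hκs, hκ1, -⟩ := exists_cutoff (isCompact_singleton (x := (x₁, a₀))) hU
    (Set.singleton_subset_iff.2 ⟨hx₁, trivial⟩)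
  obtain ⟨W, hW, hWo, hxW⟩ := eventually_nhds_iff.1 (hκ1 _ rfl)
  obtain ⟨O, V, hO, hV, hxO, haV, hOV⟩ := isOpen_prod_iff.1 hWo x₁ a₀ hxW
  let H' : PhaseCoord n × (Fin N → ℝ) → ℝ := fun y => H ((phaseChart z₀).symm y.1) y.2
  have hH' : ContDiffOn ℝ ∞ H' ((phaseChart z₀).target ×ˢ Set.univ) := by
    rw [← contMDiffOn_iff_contDiffOn]
    refine hH.comp_contMDiffOn (f := fun y : PhaseCoord n × (Fin N → ℝ) =>
      ((phaseChart z₀).symm y.1, y.2)) (ContMDiffOn.prodMk ?_ contDiff_snd.contMDiff.contMDiffOn)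
    exact (contMDiffOn_phaseChart_symm z₀).comp contDiff_fst.contMDiff.contMDiffOn fun y hy => hy.1
  refine ⟨fun y => κ y * H' y, O ∩ (phaseChart z₀).target, V, ⟨?_, ?_, hV, Set.inter_subset_right,
    fun x hx a ha => ?_⟩, hκ.2.mul_right, ⟨hxO, hx₁⟩, haV⟩
  · rw [contDiff_iff_contDiffAt]
    intro y
    by_cases hy : y ∈ tsupport κ
    · exact hκ.1.contDiffAt.mul (hH'.contDiffAt (hU.mem_nhds (hκs hy)))
    · have : (fun y => κ y * H' y) =ᶠ[nhds y] fun _ => 0 := by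
        filter_upwards [notMem_tsupport_iff_eventuallyEq.1 hy] with w hw
        simp [hw]
      exact contDiffAt_const.congr_of_eventuallyEq this
  · exact hO.inter (isOpen_phaseChart_target z₀)
  · have : κ (x, a) = 1 := hW _ (hOV ⟨hx.1, ha⟩)
    simp [this, H']

namespace IsLocalHamiltonian

variable {z₀ : PhaseSpace n Q} {h : PhaseCoord n × (Fin N → ℝ) → ℝ} {O : Set (PhaseCoord n)}
  {V : Set (Fin N → ℝ)}

lemma fderiv_eq (hh : IsLocalHamiltonian z₀ H h O V) {x : PhaseCoord n} (hx : x ∈ O)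
    {a : Fin N → ℝ} (ha : a ∈ V) (w : PhaseCoord n) :
    fderiv ℝ ((fun z => H z a) ∘ (phaseChart z₀).symm) x w = dir w h (x, a) := by
  have h1 : ((fun z => H z a) ∘ (phaseChart z₀).symm) =ᶠ[nhds x] fun x => h (x, a) := by
    filter_upwards [hh.isOpen_left.mem_nhds hx] with y hy
    exact (hh.eq_on y hy a ha).symm
  have h2 : HasFDerivAt (fun x => h (x, a)) _ x :=
    ((differentiable_of_smooth hh.contDiff (x, a)).hasFDerivAt).comp x (hasFDerivAt_prodMk_left x a)
  rw [h1.fderiv_eq, h2.fderiv]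
  rfl

variable {z : PhaseSpace n Q} {S : PhaseCoord n →L[ℝ] PhaseCoord n} {A : Model n →L[ℝ] Model n}

lemma coordDeriv_eq (hh : IsLocalHamiltonian z₀ H h O V)
    (hH : ContMDiff ((phaseModel n).prod 𝓘(ℝ, Fin N → ℝ)) 𝓘(ℝ, ℝ) ∞
      (fun x : PhaseSpace n Q × (Fin N → ℝ) => H x.1 x.2))
    (hS : IsChartDifferential z₀ z S A) (hz : phaseChart z₀ z ∈ O) {a : Fin N → ℝ} (ha : a ∈ V)
    (w : PhaseCoord n) :
    coordDeriv (fun z => H z a) z w = dir (S w) h (phaseChart z₀ z, a) := by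
  rw [hS.coordDeriv_eq (mdifferentiableAt_hamiltonian hH a z), ← hh.fderiv_eq hz ha]
  rfl

lemma lagrangian_eq (hh : IsLocalHamiltonian z₀ H h O V)
    (hH : ContMDiff ((phaseModel n).prod 𝓘(ℝ, Fin N → ℝ)) 𝓘(ℝ, ℝ) ∞
      (fun x : PhaseSpace n Q × (Fin N → ℝ) => H x.1 x.2))
    (hS : IsChartDifferential z₀ z S A) (hz : phaseChart z₀ z ∈ O) {a : Fin N → ℝ} (ha : a ∈ V) :
    lagrangian (fun z => H z a) z = ∑ i, momentumCoord i (phaseChart z₀ z) *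
      dir (pDir i) h (phaseChart z₀ z, a) - h (phaseChart z₀ z, a) := by
  rw [hS.lagrangian_eq (mdifferentiableAt_hamiltonian hH a z), hh.eq_on _ hz a ha,
    phaseChart_symm_apply hS.mem_source]
  simp only [hh.fderiv_eq hz ha]

lemma hamiltonianVectorField_eq (hh : IsLocalHamiltonian z₀ H h O V)
    (hH : ContMDiff ((phaseModel n).prod 𝓘(ℝ, Fin N → ℝ)) 𝓘(ℝ, ℝ) ∞
      (fun x : PhaseSpace n Q × (Fin N → ℝ) => H x.1 x.2))
    (hS : IsChartDifferential z₀ z S A) (hz : phaseChart z₀ z ∈ O) {a : Fin N → ℝ} (ha : a ∈ V) :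
    S (hamiltonianVectorField (fun z => H z a) z) = hamField qDir pDir h (phaseChart z₀ z, a) := by
  rw [hS.hamiltonianVectorField_eq (mdifferentiableAt_hamiltonian hH a z)]
  simp only [hh.fderiv_eq hz ha]
  rfl

lemma hasDerivAt_of_isMIntegralCurve (hh : IsLocalHamiltonian z₀ H h O V)
    (hH : ContMDiff ((phaseModel n).prod 𝓘(ℝ, Fin N → ℝ)) 𝓘(ℝ, ℝ) ∞
      (fun x : PhaseSpace n Q × (Fin N → ℝ) => H x.1 x.2)) {a : Fin N → ℝ} (ha : a ∈ V)
    {γ : ℝ → PhaseSpace n Q}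
    (hγ : IsMIntegralCurve (I := phaseModel n) γ (hamiltonianVectorField fun z => H z a)) {s : ℝ}
    (hs : γ s ∈ (phaseChart z₀).source) (hsO : phaseChart z₀ (γ s) ∈ O) :
    HasDerivAt (fun t => phaseChart z₀ (γ t)) (hamField qDir pDir h (phaseChart z₀ (γ s), a)) s := by
  obtain ⟨S, A, hS⟩ := exists_isChartDifferential hs
  have h1 := (mdifferentiableAt_phaseChart hs).hasMFDerivAt.comp s (hγ s)
  rw [hS.mfderiv_eq] at h1
  let X : PhaseCoord n := hamiltonianVectorField (fun z => H z a) (γ s)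
  have h2 : HasFDerivAt (fun t => phaseChart z₀ (γ t))
      (S.comp (ContinuousLinearMap.smulRight (1 : ℝ →L[ℝ] ℝ) X)) s :=
    hasMFDerivAt_iff_hasFDerivAt.1 h1
  have h3 := h2.hasDerivAt
  rw [← hh.hamiltonianVectorField_eq hH hS hsO ha]
  convert h3 using 1
  change _ = S ((1 : ℝ) • X)
  rw [one_smul]

variable {ħ : ℝ} {A : Fin N → 𝓗 →ₗ.[ℂ] 𝓗} {Φ : C₀(Fin N → ℝ, ℂ) →⋆ₙₐ[ℂ] (𝓗 →L[ℂ] 𝓗)}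
  {J : Set ℝ} {Υ : ℝ → PhaseSpace n Q → 𝓗}

lemma mdifferentiableAt_solution (hΥ : IsSolution ħ A H J Υ) {t : ℝ} (ht : t ∈ J)
    (z : PhaseSpace n Q) : MDifferentiableAt (phaseModel n) 𝓘(ℝ, 𝓗) (Υ t) z := by
  have h1 : ContMDiff (phaseModel n) (𝓘(ℝ, ℝ).prod (phaseModel n)) 1
      (fun w : PhaseSpace n Q => (t, w)) := contMDiff_const.prodMk contMDiff_id
  have h2 := hΥ.contMDiffOn.comp h1.contMDiffOn (s := Set.univ) fun w _ => ⟨ht, trivial⟩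
  exact (contMDiffOn_univ.1 h2).mdifferentiableAt (by simp)

/-- A solution of the hybrid wave equation is a local solution in canonical coordinates. -/
theorem isLocalSolution (hh : IsLocalHamiltonian z₀ H h O V)
    (hH : ContMDiff ((phaseModel n).prod 𝓘(ℝ, Fin N → ℝ)) 𝓘(ℝ, ℝ) ∞
      (fun x : PhaseSpace n Q × (Fin N → ℝ) => H x.1 x.2)) (hħ : ħ ≠ 0)
    (hΦ : IsJointCalculus A Φ) (hJ : UniqueDiffOn ℝ J) (hΥ : IsSolution ħ A H J Υ) :
    IsLocalSolution ħ qDir pDir momentumCoord Φ h O V J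
      (fun t => Υ t ∘ (phaseChart z₀).symm) where
  isOpen_left := hh.isOpen_left
  isOpen_right := hh.isOpen_right
  uniqueDiffOn := hJ
  contDiff := hh.contDiff
  contDiffOn := by
    rw [← contMDiffOn_iff_contDiffOn]
    refine hΥ.contMDiffOn.comp (g := fun x : ℝ × PhaseSpace n Q => Υ x.1 x.2)
      (f := fun x : ℝ × PhaseCoord n => (x.1, (phaseChart z₀).symm x.2)) ?_
      fun x hx => ⟨hx.1, trivial⟩
    refine contDiff_fst.contMDiff.contMDiffOn.prodMk ?_
    exact ((contMDiffOn_phaseChart_symm z₀).of_le (by simp)).comp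
      contDiff_snd.contMDiff.contMDiffOn fun x hx => hh.subset_target hx.2
  wave := by
    intro t ht x hx
    set z := (phaseChart z₀).symm x with hz
    have hxt := hh.subset_target hx
    have hzs : z ∈ (phaseChart z₀).source := PartialEquiv.map_target _ hxt
    have hzx : phaseChart z₀ z = x := PartialEquiv.right_inv _ hxt
    obtain ⟨S, B, hS⟩ := exists_isChartDifferential hzs
    obtain ⟨Υt, hd, hL⟩ := hΥ.wave_equation t ht z
    refine ⟨Υt, hd, fun g hg hgV => ?_⟩
    have hzO : phaseChart z₀ z ∈ O := by rwa [hzx]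
    have hga : ∀ a, a ∉ V → g a = 0 := fun a ha =>
      image_eq_zero_of_notMem_tsupport fun hc => ha (hgV hc)
    have hdc : ∀ w, Continuous fun a => dir w h (x, a) := fun w =>
      (contDiff_dir hh.contDiff w).continuous.comp (by fun_prop)
    have hdg : ∀ w, IsCc fun a => g a * dir w h (x, a) := fun w => hg.mul_right (hdc w)
    have hhc : Continuous fun a => h (x, a) := hh.contDiff.continuous.comp (by fun_prop)
    let l : (Fin N → ℝ) → ℝ := fun a => ∑ i, momentumCoord i x * dir (pDir i) h (x, a) - h (x, a)
    have hl : Continuous l :=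
      (continuous_finsetSum _ fun i _ => continuous_const.mul (hdc _)).sub hhc
    have hlg : IsCc fun a => g a * l a := hg.mul_right hl
    -- Because g is supported in V, its product with a coefficient of H equals its product with the
    -- coefficient of the local h: they agree on V and both vanish off V.
    have h1 := hL Φ hΦ (toC0 g) (Sum.elim (fun i => toC0 fun a => g a * dir (S (qDir i)) h (x, a))
      (Sum.elim (fun i => toC0 fun a => g a * dir (S (pDir i)) h (x, a))
        (fun _ => -toC0 fun a => g a * l a))) (by
      intro j a
      rw [toC0_apply hg]
      by_cases ha : a ∈ V
      · rcases j with i | i | _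
        · simp only [Sum.elim_inl]
          rw [toC0_apply (hdg _), dq_eq, hh.coordDeriv_eq hH hS hzO ha, hzx]
          push_cast; rfl
        · simp only [Sum.elim_inl, Sum.elim_inr]
          rw [toC0_apply (hdg _), dp_eq, hh.coordDeriv_eq hH hS hzO ha, hzx]
          push_cast; rfl
        · simp only [Sum.elim_inr]
          rw [hh.lagrangian_eq hH hS hzO ha, hzx]
          change -(toC0 (fun a => g a * l a) a) = _
          rw [toC0_apply hlg]
          push_cast
          simp only [l]
          push_cast
          ring
      · rw [hga a ha]
        rcases j with i | i | _
        · simp only [Sum.elim_inl]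
          rw [toC0_apply (hdg _), hga a ha]; simp
        · simp only [Sum.elim_inl, Sum.elim_inr]
          rw [toC0_apply (hdg _), hga a ha]; simp
        · simp only [Sum.elim_inr]
          change -(toC0 (fun a => g a * l a) a) = _
          rw [toC0_apply hlg, hga a ha]; simp)
    set D := fderiv ℝ (Υ t ∘ (phaseChart z₀).symm) x with hD
    have hdu : ∀ w, coordDeriv (Υ t) z w = D (S w) := fun w => by
      rw [hS.coordDeriv_eq (mdifferentiableAt_solution hΥ ht z), hzx]
      rfl
    have hdir : ∀ w, dir w h = fun y => fderiv ℝ h y (ContinuousLinearMap.inl ℝ _ _ w) :=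
      fun w => rfl
    -- The transport part of the wave equation is also a contraction of the bivector, with one leg
    -- differentiating h and the other Υ. Its invariance replaces the coordinates preferred at z by
    -- those of the fixed chart.
    let β : PhaseCoord n →ₗ[ℝ] PhaseCoord n →ₗ[ℝ] 𝓗 :=
      LinearMap.mk₂ ℝ (fun v w => op Φ (fun a => g a * dir w h (x, a)) (D v))
        (fun _ _ _ => by rw [map_add, map_add])
        (fun c _ _ => by
          rw [map_smul, ← Complex.coe_smul, map_smul, Complex.coe_smul])
        (fun v w₁ w₂ => by
          have : (fun a => g a * dir (w₁ + w₂) h (x, a))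
              = fun a => g a * dir w₁ h (x, a) + g a * dir w₂ h (x, a) := by
            simp only [hdir, map_add, mul_add]
          rw [this, op_add Φ (hdg _) (hdg _)]
          rfl)
        (fun c v w => by
          have : (fun a => g a * dir (c • w) h (x, a)) = fun a => c * (g a * dir w h (x, a)) := by
            simp only [hdir, map_smul, smul_eq_mul, mul_left_comm]
          rw [this, op_smul Φ (hdg _), smul_apply, Complex.coe_smul])
    have h2 := hS.isCotangentLift.sum_bilin β
    simp only [β, LinearMap.mk₂_apply] at h2
    have h3 : op Φ (fun a => g a * (-ħ⁻¹ * l a)) (Complex.I • (Υ t ∘ (phaseChart z₀).symm) x)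
        = (-ħ⁻¹ : ℂ) • Complex.I • op Φ (fun a => g a * l a) (Υ t z) := by
      have : (fun a => g a * (-ħ⁻¹ * l a)) = fun a => -ħ⁻¹ * (g a * l a) := by
        funext a; ring
      rw [this, op_smul Φ hlg, smul_apply, map_smul]
      push_cast
      rfl
    have h4 : ∀ w v, op Φ (fun a => g a * -dir w h (x, a)) v
        = -op Φ (fun a => g a * dir w h (x, a)) v := by
      intro w v
      have : (fun a => g a * -dir w h (x, a)) = fun a => -(g a * dir w h (x, a)) := by
        funext a; ring
      rw [this, op_neg Φ (hdg _)]
      rfl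
    have h5 : op Φ g ((Complex.I * ħ) • Υt) = (Complex.I * ħ) • (-∑ i,
        (op Φ (fun a => g a * dir (S (pDir i)) h (x, a)) (D (S (qDir i)))
          - op Φ (fun a => g a * dir (S (qDir i)) h (x, a)) (D (S (pDir i)))))
        - op Φ (fun a => g a * l a) (Υ t z) := by
      refine h1.trans ?_
      simp only [Fintype.sum_sum_type, Sum.elim_inl, Sum.elim_inr, Finset.univ_unique,
        Finset.sum_singleton, dq_eq, dp_eq, hdu, map_neg, map_smul]
      rw [Finset.sum_sub_distrib, neg_sub, smul_sub, Finset.smul_sum, Finset.smul_sum,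
        Finset.sum_neg_distrib]
      simp only [op, neg_apply]
      abel
    rw [h2, map_smul] at h5
    have hI : (Complex.I * ħ : ℂ) ≠ 0 := mul_ne_zero Complex.I_ne_zero (by exact_mod_cast hħ)
    have h6 : op Φ g Υt = (-∑ i, (op Φ (fun a => g a * dir (pDir i) h (x, a)) (D (qDir i))
          - op Φ (fun a => g a * dir (qDir i) h (x, a)) (D (pDir i))))
        - (Complex.I * ħ : ℂ)⁻¹ • op Φ (fun a => g a * l a) (Υ t z) := by
      rw [← inv_smul_smul₀ hI (op Φ g Υt), h5, smul_sub, inv_smul_smul₀ hI]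
    change op Φ g Υt + (op Φ (fun a => g a * (-ħ⁻¹ * l a)) _ + _) = 0
    rw [h3, h6]
    simp only [h4]
    have h7 : (-ħ⁻¹ : ℂ) * Complex.I = (Complex.I * ħ : ℂ)⁻¹ := by
      rw [mul_inv, Complex.inv_I]; push_cast; ring
    rw [smul_smul, h7, Finset.sum_sub_distrib, Finset.sum_neg_distrib]
    abel
end IsLocalHamiltonian

end LocalForm

end HybridQC
end

open scoped Manifold ContDiff ZeroAtInfty
noncomputable section
namespace HybridQC

/-! ### The trace of 𝒟 in a Hilbert basis. -/

section Trace

variable {n : ℕ} {Q : Type*} [TopologicalSpace Q] [ChartedSpace (Model n) Q]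
  [IsManifold 𝓘(ℝ, Model n) ∞ Q]
variable {𝓗 : Type*} [NormedAddCommGroup 𝓗] [InnerProductSpace ℂ 𝓗] [CompleteSpace 𝓗]

omit [CompleteSpace 𝓗] in
lemma ketBra_apply (u v w : 𝓗) : ketBra u v w = (inner ℂ v w : ℂ) • u :=
  InnerProductSpace.rankOne_apply u v w

omit [CompleteSpace 𝓗] in
lemma ketBra_add_left (u u' v : 𝓗) : ketBra (u + u') v = ketBra u v + ketBra u' v := by
  ext w
  simp only [ketBra_apply, add_apply, smul_add]

omit [CompleteSpace 𝓗] in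
lemma ketBra_add_right (u v v' : 𝓗) : ketBra u (v + v') = ketBra u v + ketBra u v' := map_add _ _ _

omit [CompleteSpace 𝓗] in
lemma ketBra_smul_left (c : ℝ) (u v : 𝓗) : ketBra (c • u) v = c • ketBra u v := by
  ext w
  rw [ketBra_apply, smul_apply, ketBra_apply, smul_comm]

omit [CompleteSpace 𝓗] in
lemma ketBra_smul_right (c : ℝ) (u v : 𝓗) : ketBra u (c • v) = c • ketBra u v := by
  ext w
  rw [smul_apply, ketBra_apply, ketBra_apply, ← Complex.coe_smul, inner_smul_left,
    Complex.conj_ofReal, mul_smul, Complex.coe_smul]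

omit [CompleteSpace 𝓗] in
lemma isBoundedBilinearMap_ketBra : IsBoundedBilinearMap ℝ fun p : 𝓗 × 𝓗 => ketBra p.1 p.2 where
  add_left := ketBra_add_left
  smul_left := ketBra_smul_left
  add_right := ketBra_add_right
  smul_right := ketBra_smul_right
  bound := ⟨1, one_pos, fun u v => by
    rw [one_mul]; exact (InnerProductSpace.norm_rankOne u v).le⟩

variable {u : PhaseSpace n Q → 𝓗} {z : PhaseSpace n Q}

lemma dp_ketBra (hu : MDifferentiableAt (phaseModel n) 𝓘(ℝ, 𝓗) u z) (i : Fin n) :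
    dp i (fun w => ketBra (u w) (u w)) z = ketBra (u z) (dp i u z) + ketBra (dp i u z) (u z) := by
  have h1 : HasFDerivAt (fun v : 𝓗 => ketBra v v) _ (u z) :=
    HasFDerivAt.comp (u z) (g := fun p : 𝓗 × 𝓗 => ketBra p.1 p.2) (f := fun v => (v, v))
      (isBoundedBilinearMap_ketBra.hasFDerivAt (u z, u z))
      ((hasFDerivAt_id (u z)).prodMk (hasFDerivAt_id (u z)))
  have h2 := mfderiv_comp z h1.differentiableAt.mdifferentiableAt hu
  have h3 : dp i (fun w => ketBra (u w) (u w)) z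
      = fderiv ℝ (fun v : 𝓗 => ketBra v v) (u z) (dp i u z) := by
    rw [mfderiv_eq_fderiv] at h2
    exact congrArg (fun L : PhaseCoord n →L[ℝ] (𝓗 →L[ℂ] 𝓗) => L (pDir i)) h2
  rw [h3, h1.fderiv]
  rfl

/-- The trace of `T 𝒟(z)` for the hybrid density operator `𝒟(z)` of the wave function `u`. -/
def phaseDensity (ħ : ℝ) (u : PhaseSpace n Q → 𝓗) (z : PhaseSpace n Q) (T : 𝓗 →L[ℂ] 𝓗) : ℂ :=
  traceDensity ħ (momentum z) (u z) (fun i => dq i u z) (fun i => dp i u z) T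

/-- `𝒟(z)` paired with the Hilbert basis `b`, after localization by a symmetric operator `R`. -/
theorem hasSum_inner_densityOperator {ι : Type*} (b : HilbertBasis ι ℂ 𝓗) (ħ : ℝ)
    (hu : MDifferentiableAt (phaseModel n) 𝓘(ℝ, 𝓗) u z) {R T : 𝓗 →L[ℂ] 𝓗}
    (hR : ∀ v w, inner ℂ (R v) w = inner ℂ v (R w))
    (hT : ∀ v w, inner ℂ v (T w) = inner ℂ (R v) (R w)) :
    HasSum (fun j => inner ℂ (R (b j)) (densityOperator ħ u z (R (b j)))) (phaseDensity ħ u z T) := by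
  -- Parseval's identity for Ra and Rc. As 𝒟 is a finite combination of such rank-one operators,
  -- this covers every term and proves convergence.
  have key : ∀ a c : 𝓗, HasSum (fun j => inner ℂ (R (b j)) (ketBra a c (R (b j))))
      (inner ℂ c (T a)) := by
    intro a c
    rw [hT]
    have h := b.hasSum_inner_mul_inner (R c) (R a)
    have e : (fun j => inner ℂ (R (b j)) (ketBra a c (R (b j))))
        = fun j => inner ℂ (R c) (b j) * inner ℂ (b j) (R a) := funext fun j => by
      rw [ketBra_apply, inner_smul_right, hR c, hR (b j)]
    rw [e]
    exact h
  have hmom : ∀ i, HasSum (fun j => inner ℂ (R (b j))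
      (((momentum z i : ℂ) • dp i (fun w => ketBra (u w) (u w)) z) (R (b j))))
      (momentum z i * (inner ℂ (u z) (T (dp i u z)) + inner ℂ (dp i u z) (T (u z)))) := by
    intro i
    have h := ((key (dp i u z) (u z)).add (key (u z) (dp i u z))).mul_left (momentum z i : ℂ)
    have e : (fun j => inner ℂ (R (b j))
        (((momentum z i : ℂ) • dp i (fun w => ketBra (u w) (u w)) z) (R (b j))))
        = fun j => (momentum z i : ℂ) * (inner ℂ (R (b j)) (ketBra (dp i u z) (u z) (R (b j)))
          + inner ℂ (R (b j)) (ketBra (u z) (dp i u z) (R (b j)))) := funext fun j => by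
      rw [dp_ketBra hu, smul_apply, inner_smul_right, add_apply, inner_add_right, add_comm]
    rw [e]
    exact h
  have hpoi : ∀ i, HasSum (fun j => inner ℂ (R (b j))
      ((ketBra (dq i u z) (dp i u z) - ketBra (dp i u z) (dq i u z)) (R (b j))))
      (inner ℂ (dp i u z) (T (dq i u z)) - inner ℂ (dq i u z) (T (dp i u z))) := by
    intro i
    have h := (key (dq i u z) (dp i u z)).sub (key (dp i u z) (dq i u z))
    have e : (fun j => inner ℂ (R (b j))
        ((ketBra (dq i u z) (dp i u z) - ketBra (dp i u z) (dq i u z)) (R (b j))))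
        = fun j => inner ℂ (R (b j)) (ketBra (dq i u z) (dp i u z) (R (b j)))
          - inner ℂ (R (b j)) (ketBra (dp i u z) (dq i u z) (R (b j))) := funext fun j => by
      rw [sub_apply, inner_sub_right]
    rw [e]
    exact h
  have h1 := (((key (u z) (u z)).add (((key (u z) (u z)).mul_left (n : ℂ)).add
    (hasSum_sum fun i (_ : i ∈ Finset.univ) => hmom i)))).add
    ((hasSum_sum fun i (_ : i ∈ Finset.univ) => hpoi i).mul_left (Complex.I * ħ))
  convert h1 using 1
  · funext j
    simp only [densityOperator, add_apply, inner_add_right, smul_apply, inner_smul_right,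
      sum_apply, inner_sum]
  · rw [phaseDensity, traceDensity]
    ring

/-- Conjugation exchanges the two summands in each momentum term, and reverses the sign of the
bracket sum, which the factor iħ compensates. -/
lemma im_phaseDensity_one (ħ : ℝ) (u : PhaseSpace n Q → 𝓗) (z : PhaseSpace n Q) :
    (phaseDensity ħ u z (1 : 𝓗 →L[ℂ] 𝓗)).im = 0 := by
  rw [← Complex.conj_eq_iff_im, phaseDensity, traceDensity]
  simp only [map_add, map_mul, map_sum, map_sub, Complex.conj_I, Complex.conj_ofReal, map_one,
    map_natCast, inner_conj_symm, one_apply_eq_self]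
  have h1 : ∀ i, (inner ℂ (dp i u z) (u z) : ℂ) + inner ℂ (u z) (dp i u z)
      = inner ℂ (u z) (dp i u z) + inner ℂ (dp i u z) (u z) := fun i => add_comm _ _
  have h2 : ∀ i, (inner ℂ (dq i u z) (dp i u z) : ℂ) - inner ℂ (dp i u z) (dq i u z)
      = -(inner ℂ (dp i u z) (dq i u z) - inner ℂ (dq i u z) (dp i u z)) := fun i =>
    (neg_sub _ _).symm
  simp only [h1, h2, Finset.sum_neg_distrib]
  ring

end Trace

end HybridQC
end

open scoped Manifold ContDiff ZeroAtInfty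
noncomputable section
namespace HybridQC

/-! ### Transport on the manifold and assembly over the joint spectrum. -/

section Positivity

variable {n N : ℕ} {Q : Type*} [TopologicalSpace Q] [ChartedSpace (Model n) Q]
  [IsManifold 𝓘(ℝ, Model n) ∞ Q]
variable {𝓗 : Type*} [NormedAddCommGroup 𝓗] [InnerProductSpace ℂ 𝓗] [CompleteSpace 𝓗]
variable {ħ : ℝ} {A : Fin N → 𝓗 →ₗ.[ℂ] 𝓗} {Φ : C₀(Fin N → ℝ, ℂ) →⋆ₙₐ[ℂ] (𝓗 →L[ℂ] 𝓗)}
  {J : Set ℝ} {Υ : ℝ → PhaseSpace n Q → 𝓗} {H : PhaseSpace n Q → (Fin N → ℝ) → ℝ}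
  {u : PhaseSpace n Q → 𝓗} {a₀ : Fin N → ℝ}

/-- The density of the wave function `u` near `z₀` is nonnegative on nonnegative functions of the
quantum observables with support near `a₀`. -/
def IsPhasePositiveNear (ħ : ℝ) (Φ : C₀(Fin N → ℝ, ℂ) →⋆ₙₐ[ℂ] (𝓗 →L[ℂ] 𝓗)) (a₀ : Fin N → ℝ)
    (u : PhaseSpace n Q → 𝓗) (z₀ : PhaseSpace n Q) : Prop :=
  ∃ r > 0, ∀ᶠ z in nhds z₀, ∀ g : (Fin N → ℝ) → ℝ, IsTest g → (∀ a, 0 ≤ g a) →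
    (∀ a, g a ≠ 0 → ‖a - a₀‖ < r) → 0 ≤ (phaseDensity ħ u z (op Φ g)).re

omit [CompleteSpace 𝓗] in
lemma phaseDensity_eq_traceDensityAt (hu : ∀ z, MDifferentiableAt (phaseModel n) 𝓘(ℝ, 𝓗) u z)
    {z₀ z : PhaseSpace n Q} (hz : z ∈ (phaseChart z₀).source) (ħ : ℝ) (T : 𝓗 →L[ℂ] 𝓗) :
    phaseDensity ħ u z T = traceDensityAt ħ qDir pDir momentumCoord (u ∘ (phaseChart z₀).symm)
      (phaseChart z₀ z) T := by
  obtain ⟨S, B, hS⟩ := exists_isChartDifferential hz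
  exact hS.traceDensity_eq (hu z) ħ T

lemma isPhasePositiveNear_iff (hu : ∀ z, MDifferentiableAt (phaseModel n) 𝓘(ℝ, 𝓗) u z)
    {z₀ z₁ : PhaseSpace n Q} (hz : z₁ ∈ (phaseChart z₀).source) :
    IsPhasePositiveNear ħ Φ a₀ u z₁ ↔ IsPositiveNear ħ qDir pDir momentumCoord Φ a₀
      (u ∘ (phaseChart z₀).symm) (phaseChart z₀ z₁) := by
  have hs := (isOpen_phaseChart_source z₀).mem_nhds hz
  have ht := (isOpen_phaseChart_target z₀).mem_nhds (PartialEquiv.map_source _ hz)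
  have hc : Filter.Tendsto (phaseChart z₀) (nhds z₁) (nhds (phaseChart z₀ z₁)) :=
    continuousAt_extChartAt' (I := phaseModel n) hz
  have hc' : Filter.Tendsto (phaseChart z₀).symm (nhds (phaseChart z₀ z₁)) (nhds z₁) := by
    have : ContinuousAt (phaseChart z₀).symm (phaseChart z₀ z₁) :=
      continuousAt_extChartAt_symm' (I := phaseModel n) hz
    have := this.tendsto
    rwa [phaseChart_symm_apply hz] at this
  constructor
  · rintro ⟨r, hr, h⟩
    refine ⟨r, hr, ?_⟩
    filter_upwards [hc'.eventually h, ht] with x hx hxt g hg hg0 hgs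
    have := hx g hg hg0 hgs
    rwa [phaseDensity_eq_traceDensityAt hu (PartialEquiv.map_target _ hxt),
      PartialEquiv.right_inv _ hxt] at this
  · rintro ⟨r, hr, h⟩
    refine ⟨r, hr, ?_⟩
    filter_upwards [hc.eventually h, hs] with z hz hzs g hg hg0 hgs
    rw [phaseDensity_eq_traceDensityAt hu hzs]
    exact hz g hg hg0 hgs

/-- Local positivity is transported along the Hamiltonian trajectories. -/
theorem isPhasePositiveNear_transport
    (hH : ContMDiff ((phaseModel n).prod 𝓘(ℝ, Fin N → ℝ)) 𝓘(ℝ, ℝ) ∞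
      (fun x : PhaseSpace n Q × (Fin N → ℝ) => H x.1 x.2)) (hħ : ħ ≠ 0)
    (hΦ : IsJointCalculus A Φ) (hJ : J.OrdConnected) (hJu : UniqueDiffOn ℝ J)
    (hΥ : IsSolution ħ A H J Υ) {γ : ℝ → PhaseSpace n Q}
    (hγ : IsMIntegralCurve (I := phaseModel n) γ (hamiltonianVectorField fun z => H z a₀))
    {t₀ t₁ : ℝ} (ht₀ : t₀ ∈ J) (ht₁ : t₁ ∈ J)
    (hp : IsPhasePositiveNear ħ Φ a₀ (Υ t₀) (γ t₀)) :
    IsPhasePositiveNear ħ Φ a₀ (Υ t₁) (γ t₁) := by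
  have hloc : ∀ s₀, ∀ᶠ s₁ in nhds s₀, ∀ᶠ s₂ in nhds s₀, s₁ ∈ J → s₂ ∈ J →
      IsPhasePositiveNear ħ Φ a₀ (Υ s₁) (γ s₁) → IsPhasePositiveNear ħ Φ a₀ (Υ s₂) (γ s₂) := by
    intro s₀
    set z₀ := γ s₀ with hz₀
    have hs : γ s₀ ∈ (phaseChart z₀).source := mem_extChartAt_source z₀
    obtain ⟨h, O, V, hh, hhc, hxO, haV⟩ := exists_isLocalHamiltonian hH z₀
      (PartialEquiv.map_source _ hs) a₀
    have hv := hh.isLocalSolution hH hħ hΦ hJu hΥ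
    have hγc : ContinuousAt γ s₀ := (hγ s₀).continuousAt
    have hsrc : ∀ᶠ s in nhds s₀, γ s ∈ (phaseChart z₀).source :=
      hγc ((isOpen_phaseChart_source z₀).mem_nhds hs)
    have hφc : ContinuousAt (phaseChart z₀) (γ s₀) :=
      continuousAt_extChartAt' (I := phaseModel n) hs
    have hO : ∀ᶠ s in nhds s₀, phaseChart z₀ (γ s) ∈ O :=
      (hφc.comp hγc) (hh.isOpen_left.mem_nhds hxO)
    have hc : ∀ᶠ s in nhds s₀, HasDerivAt (fun t => phaseChart z₀ (γ t))
        (hamField qDir pDir h (phaseChart z₀ (γ s), a₀)) s := by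
      filter_upwards [hsrc, hO] with s h1 h2
      exact hh.hasDerivAt_of_isMIntegralCurve hH haV hγ h1 h2
    borelize (PhaseCoord n)
    have key := hv.exists_isPositiveNear_transport hJ hhc hħ momentumCoord_qDir momentumCoord_pDir
      hc hxO haV
    filter_upwards [key, hsrc] with s₁ hk h1
    filter_upwards [hk, hsrc] with s₂ hk h2
    intro hJ₁ hJ₂
    rw [isPhasePositiveNear_iff (fun z => IsLocalHamiltonian.mdifferentiableAt_solution hΥ hJ₁ z) h1,
      isPhasePositiveNear_iff (fun z => IsLocalHamiltonian.mdifferentiableAt_solution hΥ hJ₂ z) h2]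
    exact hk hJ₁ hJ₂
  have hpre : IsPreconnected (Set.uIcc t₀ t₁) := isPreconnected_uIcc
  have hsub : Set.uIcc t₀ t₁ ⊆ J := hJ.uIcc_subset ht₀ ht₁
  -- The implication from time s₁ to time s₂ is transitive and, by the local result, holds in both
  -- directions between nearby times; connectedness extends it to the end points.
  refine hpre.induction₂' (fun s₁ s₂ => IsPhasePositiveNear ħ Φ a₀ (Υ s₁) (γ s₁) →
    IsPhasePositiveNear ħ Φ a₀ (Υ s₂) (γ s₂)) (fun s hs => ?_)
    (fun x y z _ _ _ h1 h2 h => h2 (h1 h)) Set.left_mem_uIcc Set.right_mem_uIcc hp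
  have h1 := (hloc s).self_of_nhds
  have h2 := (hloc s).mono fun s₁ h => h.self_of_nhds
  filter_upwards [mem_nhdsWithin_of_mem_nhds h1, mem_nhdsWithin_of_mem_nhds h2,
    self_mem_nhdsWithin] with s' h3 h4 h5
  exact ⟨h3 (hsub hs) (hsub h5), h4 (hsub h5) (hsub hs)⟩

/-- A positive density operator is positive on functions of the quantum observables. -/
lemma re_phaseDensity_nonneg_of_isPositive
    (hu : ∀ z, MDifferentiableAt (phaseModel n) 𝓘(ℝ, 𝓗) u z) {z : PhaseSpace n Q}
    (hpos : (densityOperator ħ u z).IsPositive) {ι : Type*} (b : HilbertBasis ι ℂ 𝓗)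
    {g : (Fin N → ℝ) → ℝ} (hg : IsCc g) (hg0 : ∀ a, 0 ≤ g a) :
    0 ≤ (phaseDensity ħ u z (op Φ g)).re := by
  have h := hasSum_inner_densityOperator b ħ (hu z) (R := op Φ fun a => Real.sqrt (g a))
    (T := op Φ g) (fun v w => inner_op_left Φ hg.sqrt v w) (inner_op_eq_sqrt Φ hg hg0)
  exact (Complex.hasSum_re h).nonneg fun j => hpos.re_inner_nonneg_right _

omit [CompleteSpace 𝓗] in
lemma phaseDensity_sum {κ : Type*} (ħ : ℝ) (u : PhaseSpace n Q → 𝓗) (z : PhaseSpace n Q)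
    (s : Finset κ) (T : κ → 𝓗 →L[ℂ] 𝓗) :
    phaseDensity ħ u z (∑ j ∈ s, T j) = ∑ j ∈ s, phaseDensity ħ u z (T j) := by
  classical
  induction s using Finset.induction_on with
  | empty => simp [phaseDensity, traceDensity_zero]
  | insert j s hj ih =>
    rw [Finset.sum_insert hj, Finset.sum_insert hj, ← ih]
    exact traceDensity_add _ _ _ _ _ _ _

/-- Positivity on functions of the quantum observables is a local property. -/
lemma re_phaseDensity_nonneg_of_local {z : PhaseSpace n Q}
    (hloc : ∀ a₀ : Fin N → ℝ, ∃ r > 0, ∀ g : (Fin N → ℝ) → ℝ, IsTest g → (∀ a, 0 ≤ g a) →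
      (∀ a, g a ≠ 0 → ‖a - a₀‖ < r) → 0 ≤ (phaseDensity ħ u z (op Φ g)).re)
    {g : (Fin N → ℝ) → ℝ} (hg : IsTest g) (hg0 : ∀ a, 0 ≤ g a) :
    0 ≤ (phaseDensity ħ u z (op Φ g)).re := by
  choose r hr hloc using hloc
  obtain ⟨f, hf⟩ := SmoothPartitionOfUnity.exists_isSubordinate 𝓘(ℝ, Fin N → ℝ)
    (isClosed_tsupport g) (fun a₀ : Fin N → ℝ => Metric.ball a₀ (r a₀))
    (fun _ => Metric.isOpen_ball) (fun a _ => Set.mem_iUnion.2 ⟨a, Metric.mem_ball_self (hr a)⟩)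
  -- Compactness of the support of g leaves finitely many terms of the partition, so only finite
  -- additivity of the calculus is needed.
  have hfin := f.locallyFinite.finite_nonempty_inter_compact hg.2.isCompact
  have hfg : ∀ i, IsTest fun a => f i a * g a := fun i =>
    ⟨((f i).contMDiff.contDiff).mul hg.1, hg.2.mul_left⟩
  have hsum : g = fun a => ∑ i ∈ hfin.toFinset, f i a * g a := by
    funext a
    by_cases ha : g a = 0
    · simp [ha]
    · have hat : a ∈ tsupport g := subset_tsupport _ ha
      rw [← Finset.sum_mul]
      have h1 := f.sum_eq_one hat
      rw [finsum_eq_sum_of_support_subset _ (s := hfin.toFinset)] at h1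
      · rw [h1, one_mul]
      · intro i hi
        simp only [Set.Finite.coe_toFinset]
        exact ⟨a, hi, hat⟩
  have hop : op Φ g = ∑ i ∈ hfin.toFinset, op Φ fun a => f i a * g a := by
    conv_lhs => rw [hsum]
    exact op_sum Φ _ fun i => (hfg i).isCc
  rw [hop, phaseDensity_sum, Complex.re_sum]
  refine Finset.sum_nonneg fun i _ => hloc i _ (hfg i)
    (fun a => mul_nonneg (f.nonneg i a) (hg0 a)) fun a ha => ?_
  have := hf i (subset_tsupport _ (left_ne_zero_of_mul ha))
  rwa [Metric.mem_ball, dist_eq_norm] at this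

lemma IsJointCalculus.tendsto_phaseDensity (hΦ : IsJointCalculus A Φ) (ħ : ℝ)
    (u : PhaseSpace n Q → 𝓗) (z : PhaseSpace n Q) :
    Filter.Tendsto (fun k => phaseDensity ħ u z (op Φ (cutoffBump N k))) Filter.atTop
      (nhds (phaseDensity ħ u z 1)) := by
  have h : ∀ v w : 𝓗, Filter.Tendsto (fun k => (inner ℂ v (op Φ (cutoffBump N k) w) : ℂ))
      Filter.atTop (nhds (inner ℂ v ((1 : 𝓗 →L[ℂ] 𝓗) w))) := fun v w =>
    Filter.Tendsto.inner tendsto_const_nhds (hΦ.tendsto_op_cutoffBump w)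
  unfold phaseDensity traceDensity
  refine (((h _ _).const_mul _).add (tendsto_finsetSum _ fun i _ => ?_)).add
    ((tendsto_finsetSum _ fun i _ => ?_).const_mul _)
  · exact ((h _ _).add (h _ _)).const_mul _
  · exact (h _ _).sub (h _ _)

/-- Positivity is first shown for test functions g of the observables: by transport from time 0 near
points of the joint spectrum, and since g(A) = 0 near other points. Strong convergence of the
cutoffs to the identity then reaches the full trace. -/
theorem re_phaseDensity_one_nonneg
    (hH : ContMDiff ((phaseModel n).prod 𝓘(ℝ, Fin N → ℝ)) 𝓘(ℝ, ℝ) ∞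
      (fun x : PhaseSpace n Q × (Fin N → ℝ) => H x.1 x.2)) (hħ : ħ ≠ 0)
    (hflow : ∀ a ∈ jointSpectrum A, HasCompleteFlow (fun z => H z a))
    (hΦ : IsJointCalculus A Φ) (hJ : J.OrdConnected) (hJ0 : (0 : ℝ) ∈ J)
    (hΥ : IsSolution ħ A H J Υ) (hpos : ∀ z, (densityOperator ħ (Υ 0) z).IsPositive)
    {ι : Type*} (b : HilbertBasis ι ℂ 𝓗) {t : ℝ} (ht : t ∈ J) (z : PhaseSpace n Q) :
    0 ≤ (phaseDensity ħ (Υ t) z (1 : 𝓗 →L[ℂ] 𝓗)).re := by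
  have hd : ∀ t ∈ J, ∀ z, MDifferentiableAt (phaseModel n) 𝓘(ℝ, 𝓗) (Υ t) z := fun t ht z =>
    IsLocalHamiltonian.mdifferentiableAt_solution hΥ ht z
  have h0 : ∀ (z : PhaseSpace n Q) (g : (Fin N → ℝ) → ℝ), IsTest g → (∀ a, 0 ≤ g a) →
      0 ≤ (phaseDensity ħ (Υ 0) z (op Φ g)).re := fun z g hg hg0 =>
    re_phaseDensity_nonneg_of_isPositive (hd 0 hJ0) (hpos z) b hg.isCc hg0
  have key : ∀ g : (Fin N → ℝ) → ℝ, IsTest g → (∀ a, 0 ≤ g a) →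
      0 ≤ (phaseDensity ħ (Υ t) z (op Φ g)).re := by
    rcases eq_or_ne t 0 with rfl | ht0
    · exact h0 z
    -- A time t other than 0 gives the interval J an interior, so that derivatives within J are
    -- determined.
    have hJu : UniqueDiffOn ℝ J := by
      refine uniqueDiffOn_convex hJ.convex ?_
      have hsub : Set.uIcc 0 t ⊆ J := hJ.uIcc_subset hJ0 ht
      refine (Set.Nonempty.mono (interior_mono hsub) ?_)
      rw [Set.uIcc, interior_Icc, Set.nonempty_Ioo, inf_lt_sup]
      exact ht0.symm
    refine fun g hg hg0 => re_phaseDensity_nonneg_of_local (fun a₀ => ?_) hg hg0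
    by_cases ha : a₀ ∈ jointSpectrum A
    · obtain ⟨γ, hγ0, hγ⟩ := hflow a₀ ha z
      -- The shifted curve is at z at time t; at time 0 it is at γ(-t), where positivity holds since
      -- it is assumed at all points.
      have hγ' := hγ.comp_add (-t)
      have hp : IsPhasePositiveNear ħ Φ a₀ (Υ 0) ((γ ∘ fun s => s + -t) 0) :=
        ⟨1, one_pos, Filter.Eventually.of_forall fun z g hg hg0 _ => h0 z g hg hg0⟩
      obtain ⟨r, hr, h1⟩ := isPhasePositiveNear_transport hH hħ hΦ hJ hJu hΥ hγ' hJ0 ht hp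
      refine ⟨r, hr, ?_⟩
      have h2 := h1.self_of_nhds
      simpa [hγ0] using h2
    · obtain ⟨δ, hδ, h1⟩ := hΦ.op_eq_zero_of_notMem_jointSpectrum ha
      refine ⟨δ, hδ, fun g hg _ hgs => ?_⟩
      rw [h1 g hg.isCc fun a ha => by rw [Metric.mem_ball, dist_eq_norm]; exact hgs a ha,
        phaseDensity, traceDensity_zero]
      rfl
  refine ge_of_tendsto' ((Complex.continuous_re.tendsto _).comp
    (hΦ.tendsto_phaseDensity ħ (Υ t) z)) fun k => ?_
  exact key _ ⟨(cutoffBump N k).contDiff, (cutoffBump N k).hasCompactSupport⟩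
    fun a => (cutoffBump N k).nonneg

end Positivity

end HybridQC
end

theorem mainTheorem7 {n N : ℕ}
    {Q : Type*} [TopologicalSpace Q] [T2Space Q] [SecondCountableTopology Q]
    [ChartedSpace (HybridQC.Model n) Q] [IsManifold 𝓘(ℝ, HybridQC.Model n) ∞ Q]
    {𝓗 : Type*} [NormedAddCommGroup 𝓗] [InnerProductSpace ℂ 𝓗] [CompleteSpace 𝓗]
    (ħ : ℝ) (hħ : 0 < ħ)
    (A : Fin N → 𝓗 →ₗ.[ℂ] 𝓗) (hA : ∀ i, IsSelfAdjoint (A i))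
    (hcomm : ∀ i j, HybridQC.OperatorsCommute (A i) (A j))
    (H : HybridQC.PhaseSpace n Q → (Fin N → ℝ) → ℝ)
    (hH : ContMDiff ((HybridQC.phaseModel n).prod 𝓘(ℝ, Fin N → ℝ)) 𝓘(ℝ, ℝ) ∞
      (fun x : HybridQC.PhaseSpace n Q × (Fin N → ℝ) => H x.1 x.2))
    (hflow : ∀ a ∈ HybridQC.jointSpectrum A, HybridQC.HasCompleteFlow (fun z => H z a))
    (J : Set ℝ) (hJ : J.OrdConnected) (hJ0 : (0 : ℝ) ∈ J)
    (Υ : ℝ → HybridQC.PhaseSpace n Q → 𝓗) (hΥ : HybridQC.IsSolution ħ A H J Υ)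
    (hpos : ∀ z, (HybridQC.densityOperator ħ (Υ 0) z).IsPositive)
    {ι : Type*} (b : HilbertBasis ι ℂ 𝓗) :
    ∀ t ∈ J, ∀ z,
      HasSum (fun j => inner ℂ (b j) (HybridQC.densityOperator ħ (Υ t) z (b j)))
        (HybridQC.classicalDensity b ħ (Υ t) z : ℂ) ∧
      0 ≤ HybridQC.classicalDensity b ħ (Υ t) z := by
  intro t ht z
  obtain ⟨Φ, hΦ⟩ := HybridQC.exists_isJointCalculus A hA hcomm
  have h := HybridQC.hasSum_inner_densityOperator (R := 1) (T := 1) b ħ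
    (HybridQC.IsLocalHamiltonian.mdifferentiableAt_solution hΥ ht z)
    (fun _ _ => rfl) (fun _ _ => rfl)
  have e : HybridQC.classicalDensity b ħ (Υ t) z = (HybridQC.phaseDensity ħ (Υ t) z 1).re :=
    (Complex.hasSum_re h).tsum_eq
  rw [e]
  refine ⟨?_, HybridQC.re_phaseDensity_one_nonneg hH hħ.ne' hflow hΦ hJ hJ0 hΥ hpos b ht z⟩
  have er : ((HybridQC.phaseDensity ħ (Υ t) z (1 : 𝓗 →L[ℂ] 𝓗)).re : ℂ)
      = HybridQC.phaseDensity ħ (Υ t) z 1 :=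
    Complex.ext rfl (HybridQC.im_phaseDensity_one ħ (Υ t) z).symm
  rw [er]
  exact h
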